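/- Let $\theta>0$, $\omega=2\pi/\theta$, $\mu_0,\lambda\in\mathbb R$. Let $\mathcal H_B$ be the Bargmann space of holomorphic functions on $\mathbb C^2$ with $\langle\phi,\chi\rangle_B=\int d\mu\,\overline{\phi}\,\chi$, $d\mu(z)=(\omega/\pi)^2e^{-\omega|z|^2}\,d\Re(z)\,d\Im(z)$, and let $\mathcal E_B(\mathbb C^2)$ be the image of the Schwartz space $\mathcal S(\mathbb R^2)$ under the Bargmann transform. Let $\Gamma=\{\frac{\theta}{\sqrt2}(m+in): m,n\in\mathbb Z^2\}\subset\mathbb C^2$ and, for $\gamma\in\Gamma$, $(U_\gamma\phi)(z)=(\phi U_\gamma)(z)=e^{-\frac{\omega}{2}|\gamma|^2-\omega\bar\gamma\cdot z}\phi(z+\gamma)$; these operators give the right action of the noncommutative four-torus $\mathcal A_\theta$ on $\mathcal E_B(\mathbb C^2)$. Put $(\phi,\chi)_{\mathcal A_\theta}=\sum_{\gamma\in\Gamma}\langle\phi,\chi U_\gamma\rangle_B\,U_{-\gamma}$, and let $\mathrm{Tr}_{\mathcal A_\theta}\big(\sum_\gamma a_\gamma U_\gamma\big)=a_0$. Consider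 the theory with quadratic part given by $H=2\omega(z\cdot\partial_z+1)+\mu_0^2$ and interaction $\frac{\lambda}{2}\mathrm{Tr}_{\mathcal A_\theta}[(\phi,\phi)_{\mathcal A_\theta}^2]$, regularized by the propagator $H_\epsilon^{-1}=\int_\epsilon^\infty e^{-\beta H}\,d\beta$, $\epsilon>0$. Its one-loop planar four-point 1PI function is the sum $\Gamma^{(1)}_{4,\mathrm{planar}}=\Gamma^{(1)}_{4a}+\Gamma^{(1)}_{4b}$ of the two planar one-loop four-point graphs, where, with $\mathrm{Tr}$ the operator trace on $\mathcal H_B$, $$\Gamma^{(1)}_{4a}[\overline{\varphi_1},\varphi_2,\overline{\varphi_3},\varphi_4]=-2\Big(\frac{\lambda}{2}\Big)^2\sum_{\gamma_1,\gamma_2\in\Gamma}\langle\varphi_1,U_{\gamma_1}\varphi_2\rangle_B\,\langle\varphi_3,U_{-\gamma_2}\varphi_4\rangle_B\,\mathrm{Tr}\big(U_{-\gamma_1}H_\epsilon^{-1}U_{\gamma_2}H_\epsilon^{-1}\big),$$ $$\Gamma^{(1)}_{4b}[\overline{\varphi_1},\varphi_2,\overline{\varphi_3},\varphi_4]=-2\Big(\frac{\lambda}{2}\Big)^2\sum_{\gamma_1,\gamma_2\in\Gamma}\langle\varphi_1,U_{\gamma_1}H_\epsilon^{-1}U_{\gamma_2}\varphi_2\rangle_B\,\langle\varphi_3,U_{-\gamma_2}H_\epsilon^{-1}U_{-\gamma_1}\varphi_4\rangle_B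 .$$ **Proposition.** Let $\varphi_1,\varphi_2,\varphi_3,\varphi_4\in\mathcal E_B(\mathbb C^2)$. For every $\epsilon>0$ the traces and the sums over $\Gamma\times\Gamma$ above converge absolutely. As $\epsilon\to0^+$ the divergent part of the one-loop planar four-point 1PI function is $$\Gamma^{(1)}_{4,\mathrm{planar},\mathrm{div}}[\overline{\varphi_1},\varphi_2,\overline{\varphi_3},\varphi_4]=-\frac{\lambda^2}{8\omega^2}\Big(1+\frac1{\theta^2}\Big)\mathrm{Tr}_{\mathcal A_\theta}\big[(\varphi_1,\varphi_2)_{\mathcal A_\theta}(\varphi_3,\varphi_4)_{\mathcal A_\theta}\big]\ln\frac1\epsilon,$$ that is, $\Gamma^{(1)}_{4,\mathrm{planar}}-\Gamma^{(1)}_{4,\mathrm{planar},\mathrm{div}}$ converges to a finite limit. More precisely, $\Gamma^{(1)}_{4a}$ and $\Gamma^{(1)}_{4b}$ contribute the terms with $1$ and with $1/\theta^2$ of this divergent part, respectively, and what remains of each graph after subtracting its term converges to a finite limit. The divergence is a local renormalization of the coupling constant: replacing $\lambda$ by $\lambda+\frac{\lambda^2}{4\omega^2}\big(1+\frac1{\theta^2}\big)\ln\frac1\epsilon$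 in the quartic term $\frac{\lambda}{2}\mathrm{Tr}_{\mathcal A_\theta}[(\varphi_1,\varphi_2)_{\mathcal A_\theta}(\varphi_3,\varphi_4)_{\mathcal A_\theta}]$ of the action and adding $\Gamma^{(1)}_{4,\mathrm{planar}}$ gives an expression with a finite limit as $\epsilon\to0^+$. -/

import Mathlib

open MeasureTheory Filter Topology
open scoped SchwartzMap ComplexConjugate

noncomputable section

namespace HeisenbergQFT

/-- The phase space `ℂ²` on which the functions of the Bargmann space are defined. Its Hermitian
structure is spelled out by `herm` and `sqNorm` (the sup norm of the Pi type is never used);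
its measure is Lebesgue measure. -/
abbrev C2 : Type := Fin 2 → ℂ

/-- Labels of the lattice `Γ ≃ ℤ⁴`: the pair `(m, n)` stands for `(θ/√2)(m + i n) ∈ ℂ²`. -/
abbrev Mode : Type := (Fin 2 → ℤ) × (Fin 2 → ℤ)

/-- `v̄ · z`. -/
def herm (v z : C2) : ℂ := ∑ i, conj (v i) * z i

/-- `|z|²`. -/
def sqNorm (z : C2) : ℝ := ∑ i, Complex.normSq (z i)

/-- The frequency `ω = 2π/θ`. -/
def freq (θ : ℝ) : ℝ := 2 * Real.pi / θ

/-- The Bargmann scalar product `⟨φ, χ⟩_B = ∫ dμ(z) conj (φ z) χ(z)`, with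
`dμ(z) = (ω/π)² exp (-ω|z|²) dRe(z) dIm(z)` on `ℂ²`. -/
def bargmannInner (θ : ℝ) (φ χ : C2 → ℂ) : ℂ :=
  ∫ z : C2, (((freq θ / Real.pi) ^ 2 * Real.exp (-(freq θ * sqNorm z)) : ℝ) : ℂ) *
    (conj (φ z) * χ z)

/-- The Bargmann transform of a function on `ℝ²`. -/
def bargmannTransform (θ : ℝ) (χ : EuclideanSpace ℝ (Fin 2) → ℂ) (z : C2) : ℂ :=
  ((Real.sqrt (freq θ / Real.pi) : ℝ) : ℂ) *
    ∫ x : EuclideanSpace ℝ (Fin 2),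
      Complex.exp (-((freq θ : ℂ) / 2) * ∑ i, (((x i : ℝ) : ℂ) ^ 2 + z i ^ 2) +
        ((Real.sqrt 2 : ℝ) : ℂ) * (freq θ : ℂ) * ∑ i, z i * ((x i : ℝ) : ℂ)) * χ x

/-- The smooth Heisenberg module in the holomorphic representation: the image of the Schwartz
space of `ℝ²` under the Bargmann transform. -/
def heisenbergModule (θ : ℝ) : Set (C2 → ℂ) :=
  Set.range fun χ : 𝓢(EuclideanSpace ℝ (Fin 2), ℂ) => bargmannTransform θ χ

/-- The projective representation
`(T_v φ)(z) = exp (-ω|v|²/2 - ω v̄·z) φ(z + v)` of `ℂ²`. -/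
def translation (θ : ℝ) (v : C2) (φ : C2 → ℂ) (z : C2) : ℂ :=
  Complex.exp (-((freq θ * sqNorm v / 2 : ℝ) : ℂ) - (freq θ : ℂ) * herm v z) * φ (z + v)

/-- The point `(θ/√2)(m + i n)` of the lattice `Γ ⊂ ℂ²`. -/
def latticePoint (θ : ℝ) (γ : Mode) : C2 :=
  fun i => ((θ / Real.sqrt 2 : ℝ) : ℂ) * ((γ.1 i : ℂ) + (γ.2 i : ℂ) * Complex.I)

/-- The operator `U_γ`, by which the generator `U_γ` of the noncommutative torus acts (on the
right) on the module: `φ U_γ = T_γ φ`. -/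
def U (θ : ℝ) (γ : Mode) (φ : C2 → ℂ) : C2 → ℂ := translation θ (latticePoint θ γ) φ

/-- The antisymmetric form `Θ(γ, δ)` of the four-dimensional noncommutative torus, the direct sum
of two blocks `(0, θ; -θ, 0)`. -/
def torusForm (θ : ℝ) (γ δ : Mode) : ℝ :=
  θ * ∑ i, ((γ.1 i : ℝ) * (δ.2 i : ℝ) - (γ.2 i : ℝ) * (δ.1 i : ℝ))

/-- The product of two elements `∑ a_γ U_γ` and `∑ b_γ U_γ` of the noncommutative torus, each given
by its Fourier coefficients, for `U_γ U_δ = exp (-iπ Θ(γ, δ)) U_{γ+δ}`. -/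
def torusMul (θ : ℝ) (a b : Mode → ℂ) (γ : Mode) : ℂ :=
  ∑' δ : Mode, a δ * b (γ - δ) *
    Complex.exp (-(Complex.I * (Real.pi : ℂ) * (torusForm θ δ (γ - δ) : ℂ)))

/-- The trace of the noncommutative torus: `Tr (∑ a_γ U_γ) = a_0`. -/
def torusTrace (a : Mode → ℂ) : ℂ := a 0

/-- The scalar product with values in the noncommutative torus,
`(φ, χ) = ∑_γ ⟨φ, χ U_γ⟩_B U_{-γ}`, given by its Fourier coefficients. -/
def modulePairing (θ : ℝ) (φ χ : C2 → ℂ) : Mode → ℂ :=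
  fun γ => bargmannInner θ φ (U θ (-γ) χ)

/-- `Tr [(φ₁, φ₂) (φ₃, φ₄)]`. -/
def quarticTrace (θ : ℝ) (φ₁ φ₂ φ₃ φ₄ : C2 → ℂ) : ℂ :=
  torusTrace (torusMul θ (modulePairing θ φ₁ φ₂) (modulePairing θ φ₃ φ₄))

/-- The (polarized) quartic interaction `(g/2) Tr [(φ₁, φ₂) (φ₃, φ₄)]` of the classical action,
with coupling constant `g`. -/
def interaction (θ g : ℝ) (φ₁ φ₂ φ₃ φ₄ : C2 → ℂ) : ℂ :=
  ((g / 2 : ℝ) : ℂ) * quarticTrace θ φ₁ φ₂ φ₃ φ₄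

/-- The operator of the kinetic and mass terms of the action: the Hamiltonian
`H = 2ω (z₁ ∂₁ + z₂ ∂₂ + 1) + μ₀²` of the two-dimensional harmonic oscillator. -/
def hamiltonian (θ μ₀ : ℝ) (φ : C2 → ℂ) (z : C2) : ℂ :=
  2 * (freq θ : ℂ) * (fderiv ℂ φ z z + φ z) + ((μ₀ ^ 2 : ℝ) : ℂ) * φ z

/-- The semigroup `exp (-β H)`. -/
def heat (θ μ₀ β : ℝ) (φ : C2 → ℂ) (z : C2) : ℂ :=
  ((Real.exp (-(β * (2 * freq θ + μ₀ ^ 2))) : ℝ) : ℂ) *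
    φ (((Real.exp (-(2 * freq θ * β)) : ℝ) : ℂ) • z)

theorem heat_zero (θ μ₀ : ℝ) (φ : C2 → ℂ) : heat θ μ₀ 0 φ = φ := by
  funext z
  simp [heat]

/-- `heat` solves `∂_β u = -H u` on holomorphic functions. -/
theorem hasDerivAt_heat (θ μ₀ β : ℝ) (φ : C2 → ℂ) (hφ : Differentiable ℂ φ) (z : C2) :
    HasDerivAt (fun b : ℝ => heat θ μ₀ b φ z)
      (-(hamiltonian θ μ₀ (heat θ μ₀ β φ) z)) β := by
  have hr : HasDerivAt (fun b : ℝ => ((Real.exp (-(2 * freq θ * b)) : ℝ) : ℂ))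
      ((Real.exp (-(2 * freq θ * β)) * (-(2 * freq θ)) : ℝ) : ℂ) β := by
    refine HasDerivAt.ofReal_comp (HasDerivAt.exp ?_)
    exact (((hasDerivAt_id' β).const_mul (2 * freq θ)).fun_neg).congr_deriv (by ring)
  have hc : HasDerivAt (fun b : ℝ => ((Real.exp (-(b * (2 * freq θ + μ₀ ^ 2))) : ℝ) : ℂ))
      ((Real.exp (-(β * (2 * freq θ + μ₀ ^ 2))) * (-(2 * freq θ + μ₀ ^ 2)) : ℝ) : ℂ) β := by
    refine HasDerivAt.ofReal_comp (HasDerivAt.exp ?_)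
    exact (((hasDerivAt_id' β).mul_const (2 * freq θ + μ₀ ^ 2)).fun_neg).congr_deriv (by ring)
  set r : ℂ := ((Real.exp (-(2 * freq θ * β)) : ℝ) : ℂ) with hrdef
  set c : ℂ := ((Real.exp (-(β * (2 * freq θ + μ₀ ^ 2))) : ℝ) : ℂ) with hcdef
  have hφr : HasFDerivAt φ ((fderiv ℂ φ (r • z)).restrictScalars ℝ) (r • z) :=
    ((hφ (r • z)).hasFDerivAt).restrictScalars ℝ
  have h1 := hφr.comp_hasDerivAt β (hr.smul_const z)
  have h2 := hc.mul h1
  have hL : HasFDerivAt (fun w : C2 => r • w) (r • ContinuousLinearMap.id ℂ C2) z :=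
    (hasFDerivAt_id z).const_smul r
  have h3 : HasFDerivAt (heat θ μ₀ β φ)
      (c • ((fderiv ℂ φ (r • z)).comp (r • ContinuousLinearMap.id ℂ C2))) z :=
    (HasFDerivAt.comp z (hφ (r • z)).hasFDerivAt hL).const_mul c
  have h4 : fderiv ℂ (heat θ μ₀ β φ) z z = c * (r * fderiv ℂ φ (r • z) z) := by
    rw [h3.fderiv]
    simp
  refine h2.congr_deriv ?_
  have h5 : heat θ μ₀ β φ z = c * φ (r • z) := rfl
  simp only [hamiltonian, h4, h5, Function.comp, ContinuousLinearMap.coe_restrictScalars']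
  push_cast
  rw [map_smul, smul_eq_mul]
  simp only [hrdef, hcdef]
  push_cast
  ring

/-- The regularized propagator `∫_ε^∞ exp (-β H) dβ = H⁻¹ exp (-ε H)`. -/
def propagator (θ μ₀ ε : ℝ) (φ : C2 → ℂ) (z : C2) : ℂ :=
  ∫ β in Set.Ioi ε, heat θ μ₀ β φ z

/-- The orthonormal basis `(ω^{|n|}/n!)^{1/2} z^n` of the Bargmann space. -/
def monomialBasis (θ : ℝ) (n : Fin 2 → ℕ) (z : C2) : ℂ :=
  ∏ i, (((Real.sqrt (freq θ ^ n i / (n i).factorial) : ℝ) : ℂ) * z i ^ n i)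

/-- The operator trace on the Bargmann space. -/
def operatorTrace (θ : ℝ) (A : (C2 → ℂ) → (C2 → ℂ)) : ℂ :=
  ∑' n : Fin 2 → ℕ, bargmannInner θ (monomialBasis θ n) (A (monomialBasis θ n))

/-- The operator `U_{-γ₁} H_ε⁻¹ U_{γ₂} H_ε⁻¹` read along the closed loop of the bubble graph. -/
def bubbleLoop (θ μ₀ ε : ℝ) (γ₁ γ₂ : Mode) (φ : C2 → ℂ) : C2 → ℂ :=
  U θ (-γ₁) (propagator θ μ₀ ε (U θ γ₂ (propagator θ μ₀ ε φ)))

/-- The contribution of the lattice momenta `γ₁, γ₂` to the bubble graph: two vertices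
`(λ/2) ∑_γ U_γ ⊗ U_{-γ}` whose inner lines form a closed loop of two propagators. The graph appears
four times in the expansion and carries the factor `1/2!` of the two vertices and the sign of the
second order term. -/
def bubbleTerm (θ μ₀ lam ε : ℝ) (φ₁ φ₂ φ₃ φ₄ : C2 → ℂ) (p : Mode × Mode) : ℂ :=
  -(4 / (Nat.factorial 2 : ℂ)) * ((lam / 2 : ℝ) : ℂ) ^ 2 *
    (bargmannInner θ φ₁ (U θ p.1 φ₂) * bargmannInner θ φ₃ (U θ (-p.2) φ₄) *
      operatorTrace θ (bubbleLoop θ μ₀ ε p.1 p.2))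

/-- The planar bubble graph, evaluated on external fields. -/
def bubbleGraph (θ μ₀ lam ε : ℝ) (φ₁ φ₂ φ₃ φ₄ : C2 → ℂ) : ℂ :=
  ∑' p : Mode × Mode, bubbleTerm θ μ₀ lam ε φ₁ φ₂ φ₃ φ₄ p

/-- The contribution of the lattice momenta `γ₁, γ₂` to the ladder graph: two open lines, with one
propagator each, exchanging `γ₁` and `γ₂`, in opposite orders along the two (oriented) lines. The
combinatorial factor is that of the bubble graph. -/
def ladderTerm (θ μ₀ lam ε : ℝ) (φ₁ φ₂ φ₃ φ₄ : C2 → ℂ) (p : Mode × Mode) : ℂ :=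
  -(4 / (Nat.factorial 2 : ℂ)) * ((lam / 2 : ℝ) : ℂ) ^ 2 *
    (bargmannInner θ φ₁ (U θ p.1 (propagator θ μ₀ ε (U θ p.2 φ₂))) *
      bargmannInner θ φ₃ (U θ (-p.2) (propagator θ μ₀ ε (U θ (-p.1) φ₄))))

/-- The planar ladder graph, evaluated on external fields. -/
def ladderGraph (θ μ₀ lam ε : ℝ) (φ₁ φ₂ φ₃ φ₄ : C2 → ℂ) : ℂ :=
  ∑' p : Mode × Mode, ladderTerm θ μ₀ lam ε φ₁ φ₂ φ₃ φ₄ p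

/-- The regularized one-loop planar four-point 1PI function: the sum of the two planar one-loop
graphs with four external legs. -/
def planarFourPoint (θ μ₀ lam ε : ℝ) (φ₁ φ₂ φ₃ φ₄ : C2 → ℂ) : ℂ :=
  bubbleGraph θ μ₀ lam ε φ₁ φ₂ φ₃ φ₄ + ladderGraph θ μ₀ lam ε φ₁ φ₂ φ₃ φ₄

end HeisenbergQFT

end

/-!
Both planar graphs become double proper time integrals over `s, t > ε`, damped by
`exp (-(2ω + μ₀²)(s + t))`, of sums over pairs of lattice momenta. In each case the sum is
`Q / (s + t)²` near the origin, with an error `O((s + t)^{-3/2})`. As `∫∫ (s + t)⁻²` over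
`ε < s, t ≤ 1` is `log (1/ε)` up to a convergent term and the error is integrable, the
logarithmic divergence has the coefficient `Q` (`tendsto_tsum_integral_sub_log`). It remains to find
`Q` for the two graphs. Elements of the Heisenberg module, together with their derivatives, decay
rapidly relative to the Gaussian weight (`exists_rapidDecay_deriv`), because multiplication by `z i`
is a creation operator on the Schwartz side. Hence `⟨φ, U_γ χ⟩` decays rapidly in `γ`, which
controls all sums over the momenta transferred to the external fields.

*Bubble.* In the Bargmann representation `exp (-βH)` is, up to a scalar, the dilation by
`exp (-2ωβ)`, and `T_{-v₁} R_r T_{v₂} R_s`, with dilations `R_r`, `R_s`, maps `φ` to a multiplier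
times the composition of `φ` with an affine contraction. Its trace is the Gaussian integral of the
reproducing kernel over the diagonal, `(1 - rs)⁻²` times an exponential (`hasSum_bubbleLoop`). The
exponent contains
`-(ω/2) (r + s)/(1 - rs) |v₁ - v₂|²`, so unequal momenta contribute a bounded amount, while equal
momenta give `(1 - rs)⁻² ≈ (2ω(s + t))⁻²`. Therefore `Q = Q₀ / (4ω²)`, where `Q₀` is the quartic
trace of the external fields.

*Ladder.* The dilation conjugated by a translation, `T_v⁻¹ R T_v`, with `R` the dilation by `1 - x`,
is close to multiplication by `exp (-ωx|v|²)` when `x` is small, with remainders that decay on the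
scale `x^{-1/2}` in `v` (`exists_conjDilation_bound`, `exists_conjDilation_sub_bound`). Up to
admissible errors the product of the two open lines is thus `exp (-ω(x + y)|γ₂|²)` times a matrix
element product that depends only on `γ₁ + γ₂`: the phases from composing the translations on the
two lines cancel. The sum over `γ₁ + γ₂` is `Q₀`, and the Gaussian sum over `γ₂` is
`(θ(x + y))⁻²` up to `O((x + y)^{-3/2})` by Jacobi's inversion formula (`exists_hasSum_gaussian`).
Since `x + y ≈ 2ω(s + t)`, this gives `Q = Q₀ / (4ω²θ²)`.

The symmetry factor `-2(λ/2)²` turns these coefficients into the asserted ones, and the shift of the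
coupling constant cancels them.
-/

namespace HeisenbergQFT

/-! ### The Hermitian geometry of `ℂ²` -/

/-- The weight `1 + |z|²`, in powers of which decay on phase space is measured. -/
noncomputable def bracket (z : C2) : ℝ := 1 + sqNorm z

lemma freq_pos {θ : ℝ} (hθ : 0 < θ) : 0 < freq θ := by
  unfold freq; positivity

lemma sqNorm_nonneg (z : C2) : 0 ≤ sqNorm z :=
  Finset.sum_nonneg fun _ _ => Complex.normSq_nonneg _

lemma one_le_bracket (z : C2) : 1 ≤ bracket z := by
  have := sqNorm_nonneg z
  unfold bracket; linarith

lemma bracket_pos (z : C2) : 0 < bracket z := lt_of_lt_of_le one_pos (one_le_bracket z)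

lemma continuous_sqNorm : Continuous sqNorm := by
  unfold sqNorm; fun_prop

lemma continuous_bracket : Continuous bracket := continuous_const.add continuous_sqNorm

lemma continuous_herm : Continuous fun p : C2 × C2 => herm p.1 p.2 := by
  unfold herm
  refine continuous_finsetSum _ fun i _ => ?_
  exact (Complex.continuous_conj.comp (by fun_prop)).mul (by fun_prop)

lemma sqNorm_add (z w : C2) : sqNorm (z + w) = sqNorm z + 2 * (herm z w).re + sqNorm w := by
  simp [sqNorm, herm, Complex.normSq_apply, Fin.sum_univ_two]
  ring

lemma sqNorm_smul (t : ℝ) (z : C2) : sqNorm ((t : ℂ) • z) = t ^ 2 * sqNorm z := by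
  simp [sqNorm, Complex.normSq_apply, Fin.sum_univ_two]
  ring

lemma sqNorm_neg (z : C2) : sqNorm (-z) = sqNorm z := by
  simp [sqNorm]

lemma sqNorm_zero : sqNorm 0 = 0 := by
  simp [sqNorm]

lemma bracket_neg (z : C2) : bracket (-z) = bracket z := by
  simp [bracket, sqNorm_neg]

lemma herm_add_right (v z w : C2) : herm v (z + w) = herm v z + herm v w := by
  simp [herm, mul_add, Finset.sum_add_distrib]

lemma herm_add_left (v w z : C2) : herm (v + w) z = herm v z + herm w z := by
  simp [herm, add_mul, Finset.sum_add_distrib]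

lemma herm_neg_left (v z : C2) : herm (-v) z = -herm v z := by
  simp [herm]

lemma herm_neg_right (v z : C2) : herm v (-z) = -herm v z := by
  simp [herm]

lemma herm_sub_right (v z w : C2) : herm v (z - w) = herm v z - herm v w := by
  rw [sub_eq_add_neg, herm_add_right, herm_neg_right, sub_eq_add_neg]

lemma herm_sub_left (v w z : C2) : herm (v - w) z = herm v z - herm w z := by
  rw [sub_eq_add_neg, herm_add_left, herm_neg_left, sub_eq_add_neg]

lemma herm_smul_right (c : ℂ) (v z : C2) : herm v (c • z) = c * herm v z := by
  simp [herm]; ring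

lemma herm_self (v : C2) : herm v v = (sqNorm v : ℂ) := by
  simp [herm, sqNorm, Complex.normSq_eq_conj_mul_self]

lemma conj_herm (v z : C2) : conj (herm v z) = herm z v := by
  simp [herm]; ring

lemma herm_re_comm (v z : C2) : (herm v z).re = (herm z v).re := by
  rw [← conj_herm, Complex.conj_re]

lemma sqNorm_sub (z w : C2) : sqNorm (z - w) = sqNorm z - 2 * (herm z w).re + sqNorm w := by
  rw [sub_eq_add_neg, sqNorm_add, sqNorm_neg, herm_neg_right, Complex.neg_re]; ring

lemma sqNorm_add_le (z w : C2) : sqNorm (z + w) ≤ 2 * sqNorm z + 2 * sqNorm w := by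
  have := sqNorm_nonneg (z - w)
  rw [sqNorm_sub] at this
  rw [sqNorm_add]; linarith

lemma norm_sq_apply_le (z : C2) (i : Fin 2) : ‖z i‖ ^ 2 ≤ sqNorm z := by
  rw [← Complex.normSq_eq_norm_sq]
  exact Finset.single_le_sum (f := fun i => Complex.normSq (z i))
    (fun i _ => Complex.normSq_nonneg _) (Finset.mem_univ i)

lemma norm_apply_le (z : C2) (i : Fin 2) : ‖z i‖ ≤ √(bracket z) := by
  apply Real.le_sqrt_of_sq_le
  have := norm_sq_apply_le z i
  unfold bracket; linarith

lemma sqrt_bracket_le (z : C2) : √(bracket z) ≤ bracket z := by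
  rw [Real.sqrt_le_left (bracket_pos z).le]
  have := one_le_bracket z
  nlinarith

lemma one_le_sqrt_bracket (z : C2) : 1 ≤ √(bracket z) := by
  rw [Real.one_le_sqrt]; exact one_le_bracket z

/-- The Cauchy–Schwarz inequality. -/
lemma norm_herm_le (v z : C2) : ‖herm v z‖ ≤ √(sqNorm v) * √(sqNorm z) := by
  have h : ‖herm v z‖ ≤ ∑ i, ‖v i‖ * ‖z i‖ := by
    refine (norm_sum_le _ _).trans (le_of_eq ?_)
    simp
  have h2 := Real.sum_mul_le_sqrt_mul_sqrt Finset.univ (fun i => ‖v i‖) (fun i => ‖z i‖)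
  refine h.trans (h2.trans (le_of_eq ?_))
  simp [sqNorm, Complex.normSq_eq_norm_sq]

lemma norm_herm_le_bracket (v z : C2) : ‖herm v z‖ ≤ √(bracket v) * √(bracket z) := by
  refine (norm_herm_le v z).trans ?_
  have h : ∀ z, √(sqNorm z) ≤ √(bracket z) := fun z =>
    Real.sqrt_le_sqrt (by unfold bracket; linarith)
  exact mul_le_mul (h v) (h z) (Real.sqrt_nonneg _) (Real.sqrt_nonneg _)

/-- Peetre's inequality. -/
lemma one_add_mul_sqNorm_add_le {x : ℝ} (hx : 0 ≤ x) (z w : C2) :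
    1 + x * sqNorm (z + w) ≤ 2 * (1 + x * sqNorm z) * (1 + x * sqNorm w) := by
  have h1 := mul_le_mul_of_nonneg_left (sqNorm_add_le z w) hx
  have h2 : 0 ≤ (x * sqNorm z) * (x * sqNorm w) :=
    mul_nonneg (mul_nonneg hx (sqNorm_nonneg z)) (mul_nonneg hx (sqNorm_nonneg w))
  nlinarith

lemma bracket_add_le (z w : C2) : bracket (z + w) ≤ 2 * bracket z * bracket w := by
  simpa [bracket] using one_add_mul_sqNorm_add_le zero_le_one z w

lemma one_add_mul_sqNorm_pos {x : ℝ} (hx : 0 ≤ x) (z : C2) : 0 < 1 + x * sqNorm z := by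
  have := mul_nonneg hx (sqNorm_nonneg z)
  linarith

lemma one_add_mul_sqNorm_le_bracket {x : ℝ} (hx1 : x ≤ 1) (z : C2) :
    1 + x * sqNorm z ≤ bracket z := by
  have := mul_le_mul_of_nonneg_right hx1 (sqNorm_nonneg z)
  unfold bracket; linarith

lemma norm_sq_le_sqNorm (z : C2) : ‖z‖ ^ 2 ≤ sqNorm z := by
  obtain ⟨i, -, hi⟩ := Finset.exists_max_image Finset.univ (fun i => ‖z i‖) ⟨0, Finset.mem_univ 0⟩
  have h : ‖z‖ ≤ ‖z i‖ := (pi_norm_le_iff_of_nonneg (norm_nonneg _)).2 fun j =>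
    hi j (Finset.mem_univ j)
  exact (pow_le_pow_left₀ (norm_nonneg _) h 2).trans (norm_sq_apply_le z i)

lemma integrable_inv_bracket_pow : Integrable fun z : C2 => (bracket z ^ 4)⁻¹ := by
  have hr : (Module.finrank ℝ C2 : ℝ) < 8 := by
    rw [Module.finrank_pi_fintype]
    simp [Complex.finrank_real_complex]; norm_num
  have h := (integrable_one_add_norm (μ := (volume : Measure C2)) hr).const_mul 16
  refine h.mono' ((continuous_bracket.pow 4).inv₀
    fun z => (pow_pos (bracket_pos z) 4).ne').aestronglyMeasurable (ae_of_all _ fun z => ?_)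
  rw [Real.norm_of_nonneg (inv_nonneg.2 (pow_nonneg (bracket_pos z).le 4))]
  have hz : 0 < 1 + ‖z‖ := by positivity
  rw [Real.rpow_neg hz.le, show (8 : ℝ) = ((8 : ℕ) : ℝ) by norm_num, Real.rpow_natCast,
    ← div_eq_mul_inv, inv_eq_one_div, div_le_div_iff₀ (pow_pos (bracket_pos z) 4) (pow_pos hz 8),
    one_mul]
  have h1 : (1 + ‖z‖) ^ 2 ≤ 2 * bracket z := by
    have := norm_sq_le_sqNorm z
    unfold bracket; nlinarith [sq_nonneg (1 - ‖z‖)]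
  calc (1 + ‖z‖) ^ 8 = ((1 + ‖z‖) ^ 2) ^ 4 := by ring
    _ ≤ (2 * bracket z) ^ 4 := pow_le_pow_left₀ (by positivity) h1 4
    _ = 16 * bracket z ^ 4 := by ring

/-! ### Phase space translations -/

/-- The phase `exp (-iω Im (w̄ v))` in `T_v T_w = exp (-iω Im (w̄ v)) T_{v+w}`. -/
noncomputable def cocycle (θ : ℝ) (v w : C2) : ℂ :=
  Complex.exp (-((freq θ * (herm w v).im : ℝ) : ℂ) * Complex.I)

lemma norm_cocycle (θ : ℝ) (v w : C2) : ‖cocycle θ v w‖ = 1 := by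
  unfold cocycle
  rw [← Complex.ofReal_neg, Complex.norm_exp_ofReal_mul_I]

lemma translation_translation (θ : ℝ) (v w : C2) (φ : C2 → ℂ) (z : C2) :
    translation θ v (translation θ w φ) z = cocycle θ v w * translation θ (v + w) φ z := by
  simp only [translation, cocycle]
  rw [← mul_assoc, ← mul_assoc, ← Complex.exp_add, ← Complex.exp_add, add_assoc]
  congr 2
  have him : ((herm w v : ℂ)) = (((herm w v).re : ℝ) : ℂ) + (((herm w v).im : ℝ) : ℂ) * Complex.I :=
    (Complex.re_add_im _).symm
  rw [sqNorm_add, herm_add_left, herm_add_right, herm_re_comm v w]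
  push_cast
  linear_combination (-(freq θ : ℂ)) * him

lemma cocycle_neg_neg_mul (θ : ℝ) (v w : C2) :
    cocycle θ (-w) (-v) * cocycle θ v w = 1 := by
  unfold cocycle
  rw [← Complex.exp_add, ← Complex.exp_zero]
  congr 1
  rw [herm_neg_left, herm_neg_right, neg_neg, ← conj_herm, Complex.conj_im]
  push_cast
  ring

lemma continuous_translation (θ : ℝ) (v : C2) {φ : C2 → ℂ} (hφ : Continuous φ) :
    Continuous (translation θ v φ) := by
  unfold translation
  have h : Continuous fun z => herm v z := continuous_herm.comp (Continuous.prodMk_right v)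
  fun_prop

/-- Translations are isometric for the Gaussian weight. -/
lemma norm_translation (θ : ℝ) (v : C2) (φ : C2 → ℂ) (z : C2) :
    ‖translation θ v φ z‖ = Real.exp (freq θ * sqNorm z / 2) *
      (‖φ (z + v)‖ * Real.exp (-(freq θ * sqNorm (z + v) / 2))) := by
  unfold translation
  rw [norm_mul, Complex.norm_exp, mul_comm ‖φ (z + v)‖, ← mul_assoc, ← Real.exp_add]
  congr 2
  rw [sqNorm_add, herm_re_comm z v]
  simp
  ring

/-! ### Decay of Bargmann transforms of Schwartz functions -/

/-- The kernel of the Bargmann transform. -/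
noncomputable def bargmannKernel (θ : ℝ) (z : C2) (x : EuclideanSpace ℝ (Fin 2)) : ℂ :=
  Complex.exp (-((freq θ : ℂ) / 2) * ∑ i, (((x i : ℝ) : ℂ) ^ 2 + z i ^ 2) +
    ((Real.sqrt 2 : ℝ) : ℂ) * (freq θ : ℂ) * ∑ i, z i * ((x i : ℝ) : ℂ))

lemma bargmannTransform_eq (θ : ℝ) (χ : EuclideanSpace ℝ (Fin 2) → ℂ) (z : C2) :
    bargmannTransform θ χ z = ((Real.sqrt (freq θ / Real.pi) : ℝ) : ℂ) *
      ∫ x, bargmannKernel θ z x * χ x := rfl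

/-- The exponent falls short of `ω|z|²/2` by a sum of squares. -/
lemma norm_bargmannKernel_le {θ : ℝ} (hθ : 0 < θ) (z : C2) (x : EuclideanSpace ℝ (Fin 2)) :
    ‖bargmannKernel θ z x‖ ≤ Real.exp (freq θ * sqNorm z / 2) := by
  unfold bargmannKernel
  rw [Complex.norm_exp]
  apply Real.exp_le_exp.2
  have hω := freq_pos hθ
  have h2 : √2 ^ 2 = 2 := Real.sq_sqrt zero_le_two
  have h : ∀ i, 0 ≤ freq θ / 2 * (x i - √2 * (z i).re) ^ 2 := fun i => by positivity
  have key : freq θ * sqNorm z / 2 - (-((freq θ : ℂ) / 2) *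
      ∑ i, (((x i : ℝ) : ℂ) ^ 2 + z i ^ 2) + ((Real.sqrt 2 : ℝ) : ℂ) * (freq θ : ℂ) *
        ∑ i, z i * ((x i : ℝ) : ℂ)).re = ∑ i, freq θ / 2 * (x i - √2 * (z i).re) ^ 2 := by
    simp [sqNorm, Fin.sum_univ_two, Complex.normSq_apply, pow_two]
    linear_combination (-(freq θ / 2) * ((z 0).re ^ 2 + (z 1).re ^ 2)) * h2
  have := Finset.sum_nonneg fun i (_ : i ∈ Finset.univ) => h i
  linarith

/-- The coordinate `x ↦ x i`, with complex values. -/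
noncomputable def coordCLM (i : Fin 2) : EuclideanSpace ℝ (Fin 2) →L[ℝ] ℂ :=
  Complex.ofRealCLM.comp (EuclideanSpace.proj i : EuclideanSpace ℝ (Fin 2) →L[ℝ] ℝ)

lemma coordCLM_apply (i : Fin 2) (x : EuclideanSpace ℝ (Fin 2)) :
    coordCLM i x = ((x i : ℝ) : ℂ) := rfl

/-- Multiplication of a Schwartz function by a coordinate. -/
noncomputable def mulCoord (i : Fin 2) (χ : 𝓢(EuclideanSpace ℝ (Fin 2), ℂ)) :
    𝓢(EuclideanSpace ℝ (Fin 2), ℂ) :=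
  SchwartzMap.smulLeftCLM ℂ (coordCLM i) χ

lemma mulCoord_apply (i : Fin 2) (χ : 𝓢(EuclideanSpace ℝ (Fin 2), ℂ))
    (x : EuclideanSpace ℝ (Fin 2)) : mulCoord i χ x = ((x i : ℝ) : ℂ) * χ x := by
  unfold mulCoord
  rw [SchwartzMap.smulLeftCLM_apply_apply (ContinuousLinearMap.hasTemperateGrowth _),
    coordCLM_apply, smul_eq_mul]

/-- The partial derivative of a Schwartz function. -/
noncomputable def partialDeriv (i : Fin 2) (χ : 𝓢(EuclideanSpace ℝ (Fin 2), ℂ)) :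
    𝓢(EuclideanSpace ℝ (Fin 2), ℂ) :=
  LineDeriv.lineDerivOp (EuclideanSpace.single i (1 : ℝ)) χ

lemma partialDeriv_apply (i : Fin 2) (χ : 𝓢(EuclideanSpace ℝ (Fin 2), ℂ))
    (x : EuclideanSpace ℝ (Fin 2)) :
    partialDeriv i χ x = fderiv ℝ χ x (EuclideanSpace.single i (1 : ℝ)) :=
  SchwartzMap.lineDerivOp_apply_eq_fderiv _ _ _

lemma continuous_bargmannKernel (θ : ℝ) (z : C2) : Continuous (bargmannKernel θ z) := by
  unfold bargmannKernel
  fun_prop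

lemma integrable_bargmannKernel_mul {θ : ℝ} (hθ : 0 < θ) (z : C2)
    (χ : 𝓢(EuclideanSpace ℝ (Fin 2), ℂ)) :
    Integrable fun x => bargmannKernel θ z x * χ x := by
  refine (χ.integrable (μ := volume)).bdd_mul
    (c := Real.exp (freq θ * sqNorm z / 2)) (continuous_bargmannKernel θ z).aestronglyMeasurable
    (ae_of_all _ fun x => norm_bargmannKernel_le hθ z x)

lemma norm_bargmannTransform_le {θ : ℝ} (hθ : 0 < θ) (χ : 𝓢(EuclideanSpace ℝ (Fin 2), ℂ)) :
    ∃ C, ∀ z, ‖bargmannTransform θ χ z‖ ≤ C * Real.exp (freq θ * sqNorm z / 2) := by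
  refine ⟨Real.sqrt (freq θ / Real.pi) * ∫ x, ‖χ x‖, fun z => ?_⟩
  rw [bargmannTransform_eq, norm_mul, Complex.norm_real, Real.norm_of_nonneg (Real.sqrt_nonneg _),
    mul_assoc]
  refine mul_le_mul_of_nonneg_left ?_ (Real.sqrt_nonneg _)
  rw [← integral_mul_const]
  refine norm_integral_le_of_norm_le ((χ.integrable (μ := volume)).norm.mul_const _)
    (ae_of_all _ fun x => ?_)
  rw [norm_mul, mul_comm]
  exact mul_le_mul_of_nonneg_left (norm_bargmannKernel_le hθ z x) (norm_nonneg _)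

lemma hasFDerivAt_bargmannKernel_right (θ : ℝ) (z : C2) (x : EuclideanSpace ℝ (Fin 2)) :
    HasFDerivAt (bargmannKernel θ z)
      (∑ i, (bargmannKernel θ z x * (-(freq θ : ℂ) * ((x i : ℝ) : ℂ) +
        ((Real.sqrt 2 : ℝ) : ℂ) * (freq θ : ℂ) * z i)) •
        coordCLM i) x := by
  have hp : ∀ i, HasFDerivAt (fun y : EuclideanSpace ℝ (Fin 2) => ((y i : ℝ) : ℂ))
      (coordCLM i) x := fun i => (coordCLM i).hasFDerivAt
  have h1 : HasFDerivAt (fun y : EuclideanSpace ℝ (Fin 2) =>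
      ∑ i, (((y i : ℝ) : ℂ) ^ 2 + z i ^ 2)) _ x :=
    HasFDerivAt.fun_sum fun i _ => ((hp i).pow 2).add_const (z i ^ 2)
  have h2 : HasFDerivAt (fun y : EuclideanSpace ℝ (Fin 2) =>
      ∑ i, z i * ((y i : ℝ) : ℂ)) _ x :=
    HasFDerivAt.fun_sum fun i _ => (hp i).const_mul (z i)
  have h3 := ((h1.const_mul (-((freq θ : ℂ) / 2))).add
    (h2.const_mul (((Real.sqrt 2 : ℝ) : ℂ) * (freq θ : ℂ)))).cexp
  refine h3.congr_fderiv ?_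
  ext y
  simp [bargmannKernel, Fin.sum_univ_two, coordCLM_apply]
  ring

lemma hasFDerivAt_bargmannKernel_left (θ : ℝ) (z : C2) (x : EuclideanSpace ℝ (Fin 2)) :
    HasFDerivAt (fun w => bargmannKernel θ w x)
      (∑ i, (bargmannKernel θ z x * (-(freq θ : ℂ) * z i +
        ((Real.sqrt 2 : ℝ) : ℂ) * (freq θ : ℂ) * ((x i : ℝ) : ℂ))) •
        ContinuousLinearMap.proj (R := ℂ) (φ := fun _ : Fin 2 => ℂ) i) z := by
  have hp : ∀ i, HasFDerivAt (fun y : C2 => y i)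
      (ContinuousLinearMap.proj (R := ℂ) (φ := fun _ : Fin 2 => ℂ) i) z :=
    fun i => (ContinuousLinearMap.proj (R := ℂ) (φ := fun _ : Fin 2 => ℂ) i).hasFDerivAt
  have h1 : HasFDerivAt (fun y : C2 => ∑ i, (((x i : ℝ) : ℂ) ^ 2 + y i ^ 2)) _ z :=
    HasFDerivAt.fun_sum fun i _ => ((hp i).pow 2).const_add (((x i : ℝ) : ℂ) ^ 2)
  have h2 : HasFDerivAt (fun y : C2 => ∑ i, y i * ((x i : ℝ) : ℂ)) _ z :=
    HasFDerivAt.fun_sum fun i _ => (hp i).mul_const ((x i : ℝ) : ℂ)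
  have h3 := ((h1.const_mul (-((freq θ : ℂ) / 2))).add
    (h2.const_mul (((Real.sqrt 2 : ℝ) : ℂ) * (freq θ : ℂ)))).cexp
  refine h3.congr_fderiv ?_
  ext y
  simp [bargmannKernel, Fin.sum_univ_two]
  ring

/-- The Bargmann transform turns the creation operator into multiplication by `z i`. -/
lemma mul_bargmannTransform {θ : ℝ} (hθ : 0 < θ) (i : Fin 2)
    (χ : 𝓢(EuclideanSpace ℝ (Fin 2), ℂ)) (z : C2) :
    z i * bargmannTransform θ χ z = bargmannTransform θ
      (((((Real.sqrt 2 * freq θ)⁻¹ : ℝ) : ℂ) • ((freq θ : ℂ) • mulCoord i χ - partialDeriv i χ) :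
        𝓢(EuclideanSpace ℝ (Fin 2), ℂ))) z := by
  have hω := freq_pos hθ
  set e : EuclideanSpace ℝ (Fin 2) := EuclideanSpace.single i (1 : ℝ)
  have hK : ∀ x, fderiv ℝ (bargmannKernel θ z) x e = bargmannKernel θ z x *
      (-(freq θ : ℂ) * ((x i : ℝ) : ℂ) + ((Real.sqrt 2 : ℝ) : ℂ) * (freq θ : ℂ) * z i) := by
    intro x
    rw [(hasFDerivAt_bargmannKernel_right θ z x).fderiv]
    fin_cases i <;> simp [e, Fin.sum_univ_two, coordCLM_apply]
  have i0 := integrable_bargmannKernel_mul hθ z χ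
  have i1 := integrable_bargmannKernel_mul hθ z (mulCoord i χ)
  have i2 := integrable_bargmannKernel_mul hθ z (partialDeriv i χ)
  have e1 : ∀ x, fderiv ℝ (bargmannKernel θ z) x e * χ x =
      (-(freq θ : ℂ)) * (bargmannKernel θ z x * mulCoord i χ x) +
      (((Real.sqrt 2 : ℝ) : ℂ) * (freq θ : ℂ) * z i) * (bargmannKernel θ z x * χ x) := by
    intro x; rw [hK, mulCoord_apply]; ring
  -- integration by parts moves the derivative from the kernel to `χ`
  have hparts := integral_mul_fderiv_eq_neg_fderiv_mul_of_integrable (μ := volume)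
    (f := bargmannKernel θ z) (g := χ) (v := e)
    (by
      simp only [e1]
      exact (i1.const_mul _).add (i0.const_mul _))
    (by simpa only [partialDeriv_apply] using i2) i0
    (fun x _ => (hasFDerivAt_bargmannKernel_right θ z x).differentiableAt)
    (fun x _ => χ.differentiableAt)
  simp only [e1] at hparts
  rw [integral_add (i1.const_mul _) (i0.const_mul _), integral_const_mul,
    integral_const_mul] at hparts
  have e2 : ∀ x, bargmannKernel θ z x *
      (((((Real.sqrt 2 * freq θ)⁻¹ : ℝ) : ℂ) • ((freq θ : ℂ) • mulCoord i χ - partialDeriv i χ) :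
        𝓢(EuclideanSpace ℝ (Fin 2), ℂ))) x =
      (((Real.sqrt 2 * freq θ)⁻¹ : ℝ) : ℂ) * ((freq θ : ℂ) *
        (bargmannKernel θ z x * mulCoord i χ x) -
        bargmannKernel θ z x * fderiv ℝ χ x e) := by
    intro x
    simp only [smul_apply, sub_apply, smul_eq_mul, partialDeriv_apply, e]
    ring
  rw [bargmannTransform_eq, bargmannTransform_eq]
  simp only [e2]
  rw [integral_const_mul, integral_sub (i1.const_mul _)
    (by simpa only [partialDeriv_apply] using i2), integral_const_mul, hparts]
  have hω' : (freq θ : ℂ) ≠ 0 := by exact_mod_cast hω.ne'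
  have h2' : ((Real.sqrt 2 : ℝ) : ℂ) ≠ 0 := by
    exact_mod_cast (Real.sqrt_pos.2 zero_lt_two).ne'
  push_cast
  field_simp
  ring

/-- Continuity together with decay, faster than any power of `1 + |z|²`, of
`exp (-ω|z|²/2) φ(z)`. -/
structure RapidDecay (θ : ℝ) (φ : C2 → ℂ) : Prop where
  continuous : Continuous φ
  bound : ∀ N : ℕ, ∃ C, ∀ z, ‖φ z‖ * bracket z ^ N ≤ C * Real.exp (freq θ * sqNorm z / 2)

/-- Rapid decay by induction: `(1 + |z|²) |Bχ|` is a sum of moduli of Bargmann transforms of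
Schwartz functions. -/
lemma bargmannTransform_bound {θ : ℝ} (hθ : 0 < θ) (N : ℕ) :
    ∀ χ : 𝓢(EuclideanSpace ℝ (Fin 2), ℂ), ∃ C, ∀ z, ‖bargmannTransform θ χ z‖ * bracket z ^ N ≤
      C * Real.exp (freq θ * sqNorm z / 2) := by
  induction N with
  | zero => intro χ; simpa using norm_bargmannTransform_le hθ χ
  | succ N ih =>
    intro χ
    have hmul : ∀ i, ∃ χ' : 𝓢(EuclideanSpace ℝ (Fin 2), ℂ), ∀ z,
        z i ^ 2 * bargmannTransform θ χ z = bargmannTransform θ χ' z := fun i =>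
      ⟨_, fun z => by rw [pow_two, mul_assoc, mul_bargmannTransform hθ, mul_bargmannTransform hθ]⟩
    obtain ⟨χ₀, h₀⟩ := hmul 0
    obtain ⟨χ₁, h₁⟩ := hmul 1
    obtain ⟨C, hC⟩ := ih χ
    obtain ⟨C₀, hC₀⟩ := ih χ₀
    obtain ⟨C₁, hC₁⟩ := ih χ₁
    refine ⟨C + C₀ + C₁, fun z => ?_⟩
    have hb : ‖bargmannTransform θ χ z‖ * bracket z ^ (N + 1) =
        ‖bargmannTransform θ χ z‖ * bracket z ^ N + ‖bargmannTransform θ χ₀ z‖ * bracket z ^ N +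
          ‖bargmannTransform θ χ₁ z‖ * bracket z ^ N := by
      rw [← h₀, ← h₁]
      simp only [norm_mul, norm_pow, bracket, sqNorm, Fin.sum_univ_two, Complex.normSq_eq_norm_sq]
      ring
    rw [hb, add_mul, add_mul]
    exact add_le_add (add_le_add (hC z) (hC₀ z)) (hC₁ z)

lemma hasFDerivAt_bargmannTransform {θ : ℝ} (hθ : 0 < θ)
    (χ : 𝓢(EuclideanSpace ℝ (Fin 2), ℂ)) (z : C2) :
    HasFDerivAt (bargmannTransform θ χ) (∑ i, (-(freq θ : ℂ) * (z i * bargmannTransform θ χ z) +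
        ((Real.sqrt 2 : ℝ) : ℂ) * (freq θ : ℂ) * bargmannTransform θ (mulCoord i χ) z) •
        ContinuousLinearMap.proj (R := ℂ) (φ := fun _ : Fin 2 => ℂ) i) z := by
  have hω := freq_pos hθ
  have hK0 : ∀ w, AEStronglyMeasurable (fun x => bargmannKernel θ w x * χ x) volume := fun w =>
    (integrable_bargmannKernel_mul hθ w χ).aestronglyMeasurable
  -- the kernel and its derivative are bounded near `z` by the maximum of the Gaussian factor
  obtain ⟨C, hC⟩ := (isCompact_closedBall z 1).exists_bound_of_continuousOn
    (f := fun w => Real.exp (freq θ * sqNorm w / 2))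
    (Real.continuous_exp.comp ((continuous_const.mul continuous_sqNorm).div_const 2)).continuousOn
  have hC' : ∀ w ∈ Metric.ball z 1, Real.exp (freq θ * sqNorm w / 2) ≤ C := fun w hw =>
    (le_abs_self _).trans (hC w (Metric.ball_subset_closedBall hw))
  have hC0 : 0 ≤ C := (norm_nonneg _).trans (hC z (Metric.mem_closedBall_self zero_le_one))
  set P := fun i => ContinuousLinearMap.proj (R := ℂ) (φ := fun _ : Fin 2 => ℂ) i with hP
  have hPn : ∀ i, ‖P i‖ ≤ 1 := fun i =>
    ContinuousLinearMap.opNorm_le_bound _ zero_le_one fun v => by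
      simpa [hP] using norm_le_pi_norm v i
  have hder : ∀ (w : C2) (x : EuclideanSpace ℝ (Fin 2)), HasFDerivAt
      (fun w => bargmannKernel θ w x * χ x)
      (∑ i, ((-(freq θ : ℂ) * w i) * (bargmannKernel θ w x * χ x) +
        (((Real.sqrt 2 : ℝ) : ℂ) * (freq θ : ℂ)) * (bargmannKernel θ w x * mulCoord i χ x)) •
        P i) w := by
    intro w x
    refine ((hasFDerivAt_bargmannKernel_left θ w x).mul_const (χ x)).congr_fderiv ?_
    ext y
    simp [mulCoord_apply, Fin.sum_univ_two, hP]
    ring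
  have hint : ∀ i, Integrable (fun x => (-(freq θ : ℂ) * z i) * (bargmannKernel θ z x * χ x) +
        (((Real.sqrt 2 : ℝ) : ℂ) * (freq θ : ℂ)) * (bargmannKernel θ z x * mulCoord i χ x)) :=
    fun i => ((integrable_bargmannKernel_mul hθ z χ).const_mul _).add
      ((integrable_bargmannKernel_mul hθ z (mulCoord i χ)).const_mul _)
  have main := hasFDerivAt_integral_of_dominated_of_fderiv_le (𝕜 := ℂ) (μ := volume)
    (F := fun w x => bargmannKernel θ w x * χ x) (x₀ := z) (s := Metric.ball z 1)
    (F' := fun w x => ∑ i, ((-(freq θ : ℂ) * w i) * (bargmannKernel θ w x * χ x) +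
        (((Real.sqrt 2 : ℝ) : ℂ) * (freq θ : ℂ)) * (bargmannKernel θ w x * mulCoord i χ x)) • P i)
    (bound := fun x => ∑ i, ((freq θ * (‖z‖ + 1)) * (C * ‖χ x‖) +
      (√2 * freq θ) * (C * ‖mulCoord i χ x‖)))
    (Metric.ball_mem_nhds z one_pos) (Eventually.of_forall hK0)
    (integrable_bargmannKernel_mul hθ z χ)
    (integrable_finsetSum _ fun i _ => (hint i).smul_const (P i)).aestronglyMeasurable
    (ae_of_all _ fun x w hw => by
      refine (norm_sum_le _ _).trans (Finset.sum_le_sum fun i _ => ?_)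
      have hwn : ‖w i‖ ≤ ‖z‖ + 1 := by
        have h1 : ‖w‖ ≤ ‖z‖ + 1 := by
          have := norm_sub_norm_le w z
          rw [Metric.mem_ball, dist_eq_norm] at hw
          linarith
        exact (norm_le_pi_norm w i).trans h1
      have hKC : ‖bargmannKernel θ w x‖ ≤ C := (norm_bargmannKernel_le hθ w x).trans (hC' w hw)
      rw [norm_smul]
      refine (mul_le_of_le_one_right (norm_nonneg _) (hPn i)).trans ((norm_add_le _ _).trans ?_)
      simp only [norm_mul, norm_neg, Complex.norm_real, Real.norm_of_nonneg hω.le,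
        Real.norm_of_nonneg (Real.sqrt_nonneg 2)]
      gcongr)
    (integrable_finsetSum _ fun i _ =>
      (((χ.integrable (μ := volume)).norm.const_mul C).const_mul _).add
        ((((mulCoord i χ).integrable (μ := volume)).norm.const_mul C).const_mul _))
    (ae_of_all _ fun x w _ => hder w x)
  have main' := main.const_mul ((Real.sqrt (freq θ / Real.pi) : ℝ) : ℂ)
  refine main'.congr_fderiv ?_
  rw [integral_finsetSum _ fun i _ => (hint i).smul_const (P i)]
  simp only [bargmannTransform_eq]
  rw [Finset.smul_sum]
  refine Finset.sum_congr rfl fun i _ => ?_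
  rw [integral_smul_const, integral_add ((integrable_bargmannKernel_mul hθ z χ).const_mul _)
    ((integrable_bargmannKernel_mul hθ z (mulCoord i χ)).const_mul _), integral_const_mul,
    integral_const_mul, smul_smul]
  congr 1
  ring

lemma continuous_bargmannTransform {θ : ℝ} (hθ : 0 < θ) (χ : 𝓢(EuclideanSpace ℝ (Fin 2), ℂ)) :
    Continuous (bargmannTransform θ χ) :=
  continuous_iff_continuousAt.2 fun z => (hasFDerivAt_bargmannTransform hθ χ z).continuousAt

lemma rapidDecay_bargmannTransform {θ : ℝ} (hθ : 0 < θ) (χ : 𝓢(EuclideanSpace ℝ (Fin 2), ℂ)) :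
    RapidDecay θ (bargmannTransform θ χ) :=
  ⟨continuous_bargmannTransform hθ χ, fun N => bargmannTransform_bound hθ N χ⟩

lemma RapidDecay.add {θ : ℝ} {φ χ : C2 → ℂ} (hφ : RapidDecay θ φ) (hχ : RapidDecay θ χ) :
    RapidDecay θ (fun z => φ z + χ z) := by
  refine ⟨hφ.continuous.add hχ.continuous, fun N => ?_⟩
  obtain ⟨C, hC⟩ := hφ.bound N
  obtain ⟨C', hC'⟩ := hχ.bound N
  refine ⟨C + C', fun z => ?_⟩
  have := mul_le_mul_of_nonneg_right (norm_add_le (φ z) (χ z)) (pow_nonneg (bracket_pos z).le N)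
  linarith [hC z, hC' z]

lemma RapidDecay.const_mul {θ : ℝ} {φ : C2 → ℂ} (hφ : RapidDecay θ φ) (c : ℂ) :
    RapidDecay θ (fun z => c * φ z) := by
  refine ⟨hφ.continuous.const_mul c, fun N => ?_⟩
  obtain ⟨C, hC⟩ := hφ.bound N
  refine ⟨‖c‖ * C, fun z => ?_⟩
  rw [norm_mul, mul_assoc, mul_assoc]
  exact mul_le_mul_of_nonneg_left (hC z) (norm_nonneg c)

/-- Elements of the Heisenberg module and their partial derivatives decay rapidly. -/
lemma exists_rapidDecay_deriv {θ : ℝ} (hθ : 0 < θ) {φ : C2 → ℂ} (hφ : φ ∈ heisenbergModule θ) :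
    RapidDecay θ φ ∧ ∃ D : Fin 2 → C2 → ℂ, (∀ i, RapidDecay θ (D i)) ∧
      ∀ z, HasFDerivAt φ (∑ i, D i z •
        ContinuousLinearMap.proj (R := ℂ) (φ := fun _ : Fin 2 => ℂ) i) z := by
  obtain ⟨χ, rfl⟩ := hφ
  refine ⟨rapidDecay_bargmannTransform hθ χ, _, fun i => ?_,
    fun z => hasFDerivAt_bargmannTransform hθ χ z⟩
  have h := rapidDecay_bargmannTransform hθ
    (((((Real.sqrt 2 * freq θ)⁻¹ : ℝ) : ℂ) • ((freq θ : ℂ) • mulCoord i χ - partialDeriv i χ) :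
        𝓢(EuclideanSpace ℝ (Fin 2), ℂ)))
  have h' : RapidDecay θ fun z => z i * bargmannTransform θ χ z := by
    simpa only [mul_bargmannTransform hθ] using h
  exact (h'.const_mul (-(freq θ : ℂ))).add
    ((rapidDecay_bargmannTransform hθ (mulCoord i χ)).const_mul _)

/-! ### The heat semigroup conjugated by translations -/

lemma exists_one_add_pow_mul_exp_neg_le (m : ℕ) {c : ℝ} (hc : 0 < c) :
    ∃ C, 0 ≤ C ∧ ∀ u, 0 ≤ u → (1 + u) ^ m * Real.exp (-(c * u)) ≤ C := by
  refine ⟨m.factorial * Real.exp c / c ^ m, by positivity, fun u hu => ?_⟩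
  have h := Real.pow_div_factorial_le_exp (c * (1 + u)) (by positivity) m
  rw [div_le_iff₀ (by positivity), mul_pow, mul_add, mul_one, Real.exp_add] at h
  rw [le_div_iff₀ (by positivity), Real.exp_neg, mul_assoc, ← div_eq_inv_mul, mul_div_assoc',
    div_le_iff₀ (Real.exp_pos _)]
  linarith

/-- Bookkeeping of Peetre's inequality: weights in `z` and `v` are paid for by weights in the
shifted point and in the two distances that come with a Gaussian. -/
lemma weights_le {J W p q B : ℝ} (N k : ℕ) (hJ : 0 ≤ J) (hp : 0 ≤ p) (hq : 0 ≤ q)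
    (hB : 0 ≤ B) (h1 : J ≤ 2 * W * p) (h2 : B ≤ q * (2 * p * J)) :
    J ^ N * B ^ k ≤ 2 ^ (N + 2 * k) * (W ^ (N + k) * p ^ (N + 2 * k) * q ^ k) := by
  calc J ^ N * B ^ k ≤ J ^ N * (q * (2 * p * J)) ^ k := by gcongr
    _ = J ^ (N + k) * (q ^ k * (2 * p) ^ k) := by ring
    _ ≤ (2 * W * p) ^ (N + k) * (q ^ k * (2 * p) ^ k) := by gcongr
    _ = _ := by ring

/-- A path from `exp (-ωx|v|²) η` (at `t = 0`) to `T_v⁻¹ R T_v η` (at `t = 1`), where `R` is the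
dilation `η ↦ η ((1 - x) ·)`. -/
noncomputable def conjDilation (θ x t : ℝ) (v : C2) (η : C2 → ℂ) (z : C2) : ℂ :=
  Complex.exp (-((freq θ * x * sqNorm v : ℝ) : ℂ) + ((freq θ * (t * x) : ℝ) : ℂ) * herm v z) *
    η (z + ((t * x : ℝ) : ℂ) • (v - z))

lemma conjDilation_zero (θ x : ℝ) (v : C2) (η : C2 → ℂ) (z : C2) :
    conjDilation θ x 0 v η z = ((Real.exp (-(freq θ * x * sqNorm v)) : ℝ) : ℂ) * η z := by
  simp [conjDilation]

/-- The decay of `T_v⁻¹ R T_v η` on phase space is uniform in `v` and in the dilation, and it is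
of Gaussian width `x^{-1/2}` in `v`. The Gaussian weight of the point `z + tx(v - z)`, compared with
that of `z`, produces the factors `exp (-ω(1-t)x|v|²)` and `exp (-ωtx|v - z|²/2)`; the polynomial
weights are then redistributed with Peetre's inequality. -/
lemma exists_conjDilation_bound {θ : ℝ} (hθ : 0 < θ) {η : C2 → ℂ} (hη : RapidDecay θ η)
    (N k : ℕ) : ∃ C, ∀ (x t : ℝ) (v z : C2), 0 ≤ x → x ≤ 1 → 0 ≤ t → t ≤ 1 →
      ‖conjDilation θ x t v η z‖ * bracket z ^ N * (1 + x * sqNorm v) ^ k ≤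
        C * Real.exp (freq θ * sqNorm z / 2) := by
  have hω := freq_pos hθ
  obtain ⟨C₀, hC₀⟩ := hη.bound (N + k)
  obtain ⟨C₁, hC₁0, hC₁⟩ := exists_one_add_pow_mul_exp_neg_le k hω
  obtain ⟨C₂, hC₂0, hC₂⟩ := exists_one_add_pow_mul_exp_neg_le (N + 2 * k) (half_pos hω)
  have hC₀0 : 0 ≤ C₀ := by
    have h1 : 0 ≤ C₀ * Real.exp (freq θ * sqNorm 0 / 2) := le_trans (mul_nonneg (norm_nonneg _)
      (pow_nonneg (bracket_pos 0).le _)) (hC₀ 0)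
    exact nonneg_of_mul_nonneg_left h1 (Real.exp_pos _)
  refine ⟨2 ^ (N + 2 * k) * C₀ * C₁ * C₂, fun x t v z hx0 hx1 ht0 ht1 => ?_⟩
  set y := t * x with hy
  have hy0 : 0 ≤ y := mul_nonneg ht0 hx0
  have hyx : y ≤ x := mul_le_of_le_one_left hx0 ht1
  have hy1 : y ≤ 1 := hyx.trans hx1
  set w : C2 := z + (y : ℂ) • (v - z) with hw
  set s := sqNorm (v - z) with hs
  set b := sqNorm v with hb
  have hs0 : 0 ≤ s := sqNorm_nonneg _
  have hb0 : 0 ≤ b := sqNorm_nonneg _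
  have hJz := bracket_pos z
  have hJw := bracket_pos w
  have hys0 : 0 < 1 + y * s := by positivity
  have hxb : 0 < 1 + (x - y) * b := by have := mul_nonneg (sub_nonneg.2 hyx) hb0; linarith
  have h1 : bracket z ≤ 2 * bracket w * (1 + y * s) := by
    have e : z = w + -((y : ℂ) • (v - z)) := by rw [hw]; abel
    have h := bracket_add_le w (-((y : ℂ) • (v - z)))
    rw [← e, bracket_neg] at h
    refine h.trans (mul_le_mul_of_nonneg_left ?_ (by positivity))
    unfold bracket
    rw [sqNorm_smul]
    nlinarith [mul_nonneg hy0 hs0, mul_nonneg (mul_nonneg hy0 hs0) (sub_nonneg.2 hy1)]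
  have h2 : 1 + x * b ≤ (1 + (x - y) * b) * (2 * (1 + y * s) * bracket z) := by
    have h3 : 1 + y * b ≤ 2 * (1 + y * s) * bracket z := by
      have h := one_add_mul_sqNorm_add_le hy0 (v - z) z
      rw [sub_add_cancel] at h
      exact h.trans (mul_le_mul_of_nonneg_left (one_add_mul_sqNorm_le_bracket hy1 z)
        (by positivity))
    refine le_trans ?_ (mul_le_mul_of_nonneg_left h3 hxb.le)
    nlinarith [mul_nonneg (mul_nonneg (sub_nonneg.2 hyx) hb0) (mul_nonneg hy0 hb0)]
  have h4 : bracket z ^ N * (1 + x * b) ^ k ≤ 2 ^ (N + 2 * k) *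
      (bracket w ^ (N + k) * (1 + y * s) ^ (N + 2 * k) * (1 + (x - y) * b) ^ k) := by
    exact weights_le N k hJz.le hys0.le hxb.le (by positivity) h1 h2
  have hn : ‖conjDilation θ x t v η z‖ =
      Real.exp (-(freq θ * x * b) + freq θ * y * (herm v z).re) * ‖η w‖ := by
    unfold conjDilation
    rw [norm_mul, Complex.norm_exp]
    congr 1
    congr 1
    simp [hb, ← hy]
  have hexp : Real.exp (-(freq θ * x * b) + freq θ * y * (herm v z).re) *
      Real.exp (freq θ * sqNorm w / 2) ≤ Real.exp (freq θ * sqNorm z / 2) *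
        Real.exp (-(freq θ * ((x - y) * b))) * Real.exp (-(freq θ / 2 * (y * s))) := by
    rw [← Real.exp_add, ← Real.exp_add, ← Real.exp_add]
    apply Real.exp_le_exp.2
    have e1 : sqNorm w = sqNorm z + 2 * y * ((herm v z).re - sqNorm z) + y ^ 2 * s := by
      rw [hw, sqNorm_add, sqNorm_smul, herm_smul_right, herm_sub_right, herm_self,
        herm_re_comm v z]
      simp
      ring
    have e2 : s = b - 2 * (herm v z).re + sqNorm z := by rw [hs, sqNorm_sub]
    have e3 : 0 ≤ freq θ / 2 * ((y - y ^ 2) * s) := by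
      have : 0 ≤ y - y ^ 2 := by nlinarith
      positivity
    have e4 : freq θ * sqNorm z / 2 + -(freq θ * ((x - y) * b)) + -(freq θ / 2 * (y * s)) -
        (-(freq θ * x * b) + freq θ * y * (herm v z).re + freq θ * sqNorm w / 2) =
        freq θ / 2 * ((y - y ^ 2) * s) := by
      rw [e1]
      linear_combination (-(freq θ * y)) * e2
    linarith
  have hη' := hC₀ w
  have g1 := hC₁ ((x - y) * b) (mul_nonneg (sub_nonneg.2 hyx) hb0)
  have g2 := hC₂ (y * s) (by positivity)
  rw [hn]
  set E := Real.exp (-(freq θ * x * b) + freq θ * y * (herm v z).re) with hE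
  have hEpos : 0 < E := Real.exp_pos _
  calc E * ‖η w‖ * bracket z ^ N * (1 + x * b) ^ k
      = E * ‖η w‖ * (bracket z ^ N * (1 + x * b) ^ k) := by ring
    _ ≤ E * ‖η w‖ * (2 ^ (N + 2 * k) *
      (bracket w ^ (N + k) * (1 + y * s) ^ (N + 2 * k) * (1 + (x - y) * b) ^ k)) := by gcongr
    _ = 2 ^ (N + 2 * k) * E * (‖η w‖ * bracket w ^ (N + k)) *
        ((1 + y * s) ^ (N + 2 * k) * (1 + (x - y) * b) ^ k) := by ring
    _ ≤ 2 ^ (N + 2 * k) * E * (C₀ * Real.exp (freq θ * sqNorm w / 2)) *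
        ((1 + y * s) ^ (N + 2 * k) * (1 + (x - y) * b) ^ k) := by gcongr
    _ = 2 ^ (N + 2 * k) * C₀ * (E * Real.exp (freq θ * sqNorm w / 2)) *
        ((1 + y * s) ^ (N + 2 * k) * (1 + (x - y) * b) ^ k) := by ring
    _ ≤ 2 ^ (N + 2 * k) * C₀ * (Real.exp (freq θ * sqNorm z / 2) *
        Real.exp (-(freq θ * ((x - y) * b))) * Real.exp (-(freq θ / 2 * (y * s)))) *
        ((1 + y * s) ^ (N + 2 * k) * (1 + (x - y) * b) ^ k) := by gcongr
    _ = 2 ^ (N + 2 * k) * C₀ * ((1 + (x - y) * b) ^ k * Real.exp (-(freq θ * ((x - y) * b)))) *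
        ((1 + y * s) ^ (N + 2 * k) * Real.exp (-(freq θ / 2 * (y * s)))) *
        Real.exp (freq θ * sqNorm z / 2) := by ring
    _ ≤ 2 ^ (N + 2 * k) * C₀ * C₁ * C₂ * Real.exp (freq θ * sqNorm z / 2) := by gcongr

lemma hasDerivAt_conjDilation (θ x : ℝ) (v z : C2) {χ : C2 → ℂ} {D : Fin 2 → C2 → ℂ}
    (hD : ∀ z, HasFDerivAt χ (∑ i, D i z •
      ContinuousLinearMap.proj (R := ℂ) (φ := fun _ : Fin 2 => ℂ) i) z) (t : ℝ) :
    HasDerivAt (fun t => conjDilation θ x t v χ z)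
      ((x : ℂ) * ((freq θ : ℂ) * herm v z * conjDilation θ x t v χ z +
        ∑ i, (v i - z i) * conjDilation θ x t v (D i) z)) t := by
  have h0 : HasDerivAt (fun t : ℝ => ((t * x : ℝ) : ℂ)) (x : ℂ) t := by
    simpa using ((hasDerivAt_id t).mul_const x).ofReal_comp
  have h0' : HasDerivAt (fun t : ℝ => ((freq θ * (t * x) : ℝ) : ℂ)) ((freq θ : ℂ) * x) t := by
    simpa using (((hasDerivAt_id t).mul_const x).const_mul (freq θ)).ofReal_comp
  have h1 : HasDerivAt (fun t : ℝ => z + ((t * x : ℝ) : ℂ) • (v - z)) ((x : ℂ) • (v - z)) t :=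
    (h0.smul_const (v - z)).const_add z
  have h2 := ((hD (z + ((t * x : ℝ) : ℂ) • (v - z))).restrictScalars ℝ).comp_hasDerivAt t h1
  have h3 := ((h0'.mul_const (herm v z)).const_add
    (-((freq θ * x * sqNorm v : ℝ) : ℂ))).cexp
  refine (h3.mul h2).congr_deriv ?_
  simp [conjDilation, Fin.sum_univ_two]
  ring

/-- Comparison of `T_v⁻¹ R T_v χ` with its leading term `exp (-ωx|v|²) χ`. -/
lemma exists_conjDilation_sub_bound {θ : ℝ} (hθ : 0 < θ) {χ : C2 → ℂ}
    (hχ : χ ∈ heisenbergModule θ) (N k : ℕ) : ∃ C, ∀ (x : ℝ) (v z : C2), 0 ≤ x → x ≤ 1 →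
      ‖conjDilation θ x 1 v χ z - ((Real.exp (-(freq θ * x * sqNorm v)) : ℝ) : ℂ) * χ z‖ *
        bracket z ^ N * (1 + x * sqNorm v) ^ k ≤
        C * (x * √(bracket v)) * Real.exp (freq θ * sqNorm z / 2) := by
  have hω := freq_pos hθ
  obtain ⟨hr, D, hDr, hD⟩ := exists_rapidDecay_deriv hθ hχ
  obtain ⟨C, hC⟩ := exists_conjDilation_bound hθ hr (N + 1) k
  choose C' hC' using fun i => exists_conjDilation_bound hθ (hDr i) (N + 1) k
  refine ⟨freq θ * C + ∑ i, 2 * C' i, fun x v z hx0 hx1 => ?_⟩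
  have hJz := bracket_pos z
  have hxb := one_add_mul_sqNorm_pos hx0 v
  set W := bracket z ^ N * (1 + x * sqNorm v) ^ k with hW
  have hWpos : 0 < W := by positivity
  have hsv := one_le_sqrt_bracket v
  have hsz := one_le_sqrt_bracket z
  have hszJ := sqrt_bracket_le z
  -- the mean value inequality along the path from `t = 0` to `t = 1`
  have key := norm_image_sub_le_of_norm_deriv_le_segment_01'
    (f := fun t => conjDilation θ x t v χ z)
    (C := (freq θ * C + ∑ i, 2 * C' i) * (x * √(bracket v)) *
      Real.exp (freq θ * sqNorm z / 2) / W)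
    (fun t _ => (hasDerivAt_conjDilation θ x v z hD t).hasDerivWithinAt) (fun t ht => by
      rw [le_div_iff₀ hWpos]
      have b1 := hC x t v z hx0 hx1 ht.1 ht.2.le
      have b2 := fun i => hC' i x t v z hx0 hx1 ht.1 ht.2.le
      have n1 : ‖herm v z‖ ≤ √(bracket v) * bracket z :=
        (norm_herm_le_bracket v z).trans (by gcongr)
      have n2 : ∀ i, ‖v i - z i‖ ≤ 2 * √(bracket v) * bracket z := fun i => by
        have := norm_sub_le (v i) (z i)
        have h1 := norm_apply_le v i
        have h2 := norm_apply_le z i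
        nlinarith
      have nn : ‖(x : ℂ) * ((freq θ : ℂ) * herm v z * conjDilation θ x t v χ z +
          ∑ i, (v i - z i) * conjDilation θ x t v (D i) z)‖ ≤
          x * (freq θ * (√(bracket v) * bracket z) * ‖conjDilation θ x t v χ z‖ +
          ∑ i, (2 * √(bracket v) * bracket z) * ‖conjDilation θ x t v (D i) z‖) := by
        rw [norm_mul, Complex.norm_real, Real.norm_of_nonneg hx0]
        refine mul_le_mul_of_nonneg_left ((norm_add_le _ _).trans (add_le_add ?_ ?_)) hx0
        · rw [norm_mul, norm_mul, Complex.norm_real, Real.norm_of_nonneg hω.le]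
          gcongr
        · refine (norm_sum_le _ _).trans (Finset.sum_le_sum fun i _ => ?_)
          rw [norm_mul]
          exact mul_le_mul_of_nonneg_right (n2 i) (norm_nonneg _)
      refine (mul_le_mul_of_nonneg_right nn hWpos.le).trans ?_
      have e : x * (freq θ * (√(bracket v) * bracket z) * ‖conjDilation θ x t v χ z‖ +
          ∑ i, (2 * √(bracket v) * bracket z) * ‖conjDilation θ x t v (D i) z‖) * W =
          (x * √(bracket v)) * (freq θ * (‖conjDilation θ x t v χ z‖ * bracket z ^ (N + 1) *
            (1 + x * sqNorm v) ^ k) + ∑ i, 2 * (‖conjDilation θ x t v (D i) z‖ *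
              bracket z ^ (N + 1) * (1 + x * sqNorm v) ^ k)) := by
        simp only [Fin.sum_univ_two, hW]
        ring
      have e' : (freq θ * C + ∑ i, 2 * C' i) * (x * √(bracket v)) *
          Real.exp (freq θ * sqNorm z / 2) = (x * √(bracket v)) *
          (freq θ * (C * Real.exp (freq θ * sqNorm z / 2)) +
            ∑ i, 2 * (C' i * Real.exp (freq θ * sqNorm z / 2))) := by
        simp only [Fin.sum_univ_two]
        ring
      rw [e, e']
      refine mul_le_mul_of_nonneg_left (add_le_add ?_ (Finset.sum_le_sum fun i _ => ?_))
        (by positivity)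
      · exact mul_le_mul_of_nonneg_left b1 hω.le
      · exact mul_le_mul_of_nonneg_left (b2 i) zero_le_two)
  rw [le_div_iff₀ hWpos, conjDilation_zero] at key
  rw [mul_assoc]
  exact key

lemma heat_translation (θ μ₀ β : ℝ) (b : C2) (χ : C2 → ℂ) (z : C2) :
    heat θ μ₀ β (translation θ b χ) z =
      ((Real.exp (-((2 * freq θ + μ₀ ^ 2) * β)) : ℝ) : ℂ) *
        translation θ b (conjDilation θ (1 - Real.exp (-(2 * freq θ * β))) 1 b χ) z := by
  unfold heat translation conjDilation
  rw [mul_comm β]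
  congr 1
  rw [← mul_assoc, ← Complex.exp_add]
  congr 2
  · rw [herm_smul_right, herm_add_right, herm_self]
    push_cast
    ring
  · ext i
    simp
    ring

/-! ### Matrix elements -/

/-- The integrand of the Bargmann scalar product. -/
noncomputable def bargmannIntegrand (θ : ℝ) (φ χ : C2 → ℂ) (z : C2) : ℂ :=
  (((freq θ / Real.pi) ^ 2 * Real.exp (-(freq θ * sqNorm z)) : ℝ) : ℂ) * (conj (φ z) * χ z)

lemma bargmannInner_eq (θ : ℝ) (φ χ : C2 → ℂ) :
    bargmannInner θ φ χ = ∫ z, bargmannIntegrand θ φ χ z := rfl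

lemma norm_bargmannIntegrand (θ : ℝ) (φ χ : C2 → ℂ) (z : C2) :
    ‖bargmannIntegrand θ φ χ z‖ = (freq θ / Real.pi) ^ 2 *
      ((‖φ z‖ * Real.exp (-(freq θ * sqNorm z / 2))) *
        (‖χ z‖ * Real.exp (-(freq θ * sqNorm z / 2)))) := by
  unfold bargmannIntegrand
  rw [norm_mul, norm_mul, Complex.norm_real, Real.norm_of_nonneg (by positivity),
    RCLike.norm_conj, show -(freq θ * sqNorm z) = -(freq θ * sqNorm z / 2) +
      -(freq θ * sqNorm z / 2) by ring, Real.exp_add]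
  ring

lemma mul_exp_neg_le {a C u : ℝ} (h : a ≤ C * Real.exp u) : a * Real.exp (-u) ≤ C := by
  rw [Real.exp_neg, ← div_eq_mul_inv, div_le_iff₀ (Real.exp_pos _)]
  exact h

/-- If `φ` and `Ψ` decay, the matrix elements of `T_g` between them decay in `g`, by Peetre's
inequality. -/
lemma norm_bargmannIntegrand_translation_le {θ : ℝ} {φ Ψ : C2 → ℂ} {C C' : ℝ}
    {N : ℕ} (hφ : ∀ z, ‖φ z‖ * bracket z ^ (N + 4) ≤ C * Real.exp (freq θ * sqNorm z / 2))
    (hΨ : ∀ z, ‖Ψ z‖ * bracket z ^ N ≤ C' * Real.exp (freq θ * sqNorm z / 2)) (g z : C2) :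
    ‖bargmannIntegrand θ φ (translation θ g Ψ) z‖ * bracket g ^ N ≤
      (freq θ / Real.pi) ^ 2 * 2 ^ N * C * C' * (bracket z ^ 4)⁻¹ := by
  have hz := bracket_pos z
  have hzg := bracket_pos (z + g)
  have h1 := mul_exp_neg_le (hφ z)
  have h2 := mul_exp_neg_le (hΨ (z + g))
  have hC' : 0 ≤ C' := le_trans (by positivity) h2
  have hC : 0 ≤ C := le_trans (by positivity) h1
  have hJ : bracket g ≤ 2 * bracket z * bracket (z + g) := by
    have h := bracket_add_le (-z) (z + g)
    rwa [neg_add_cancel_left, bracket_neg] at h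
  rw [← div_eq_mul_inv, le_div_iff₀ (by positivity), norm_bargmannIntegrand, norm_translation]
  have e : ∀ p q : ℝ, Real.exp (freq θ * sqNorm z / 2) * (p * q) *
      Real.exp (-(freq θ * sqNorm z / 2)) = p * q := fun p q => by
    rw [mul_comm (Real.exp _), mul_assoc, ← Real.exp_add]; simp
  rw [e]
  set a := ‖φ z‖
  set b := ‖Ψ (z + g)‖
  set E := Real.exp (-(freq θ * sqNorm z / 2))
  set E' := Real.exp (-(freq θ * sqNorm (z + g) / 2))
  have ha : 0 ≤ a := norm_nonneg _
  have hb : 0 ≤ b := norm_nonneg _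
  have hE : 0 < E := Real.exp_pos _
  have hE' : 0 < E' := Real.exp_pos _
  have hg := bracket_pos g
  calc (freq θ / Real.pi) ^ 2 * (a * E * (b * E')) * bracket g ^ N * bracket z ^ 4
      ≤ (freq θ / Real.pi) ^ 2 * (a * E * (b * E')) * (2 * bracket z * bracket (z + g)) ^ N *
        bracket z ^ 4 := by gcongr
    _ = (freq θ / Real.pi) ^ 2 * 2 ^ N * (a * bracket z ^ (N + 4) * E) *
        (b * bracket (z + g) ^ N * E') := by ring
    _ ≤ (freq θ / Real.pi) ^ 2 * 2 ^ N * C * C' := by gcongr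

lemma continuous_bargmannIntegrand (θ : ℝ) {φ χ : C2 → ℂ} (hφ : Continuous φ)
    (hχ : Continuous χ) : Continuous (bargmannIntegrand θ φ χ) := by
  unfold bargmannIntegrand
  have := continuous_sqNorm
  have h := Complex.continuous_conj.comp hφ
  exact (Complex.continuous_ofReal.comp (by fun_prop)).mul (h.mul hχ)

lemma integrable_bargmannIntegrand_translation {θ : ℝ} {φ Ψ : C2 → ℂ} (hφ : RapidDecay θ φ)
    (hΨc : Continuous Ψ) {C' : ℝ}
    (hΨ : ∀ z, ‖Ψ z‖ ≤ C' * Real.exp (freq θ * sqNorm z / 2)) (g : C2) :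
    Integrable (bargmannIntegrand θ φ (translation θ g Ψ)) := by
  obtain ⟨C, hC⟩ := hφ.bound 4
  have h := norm_bargmannIntegrand_translation_le (N := 0) (C := C) (C' := C') (φ := φ) (Ψ := Ψ)
    hC (by simpa using hΨ) g
  simp only [pow_zero, mul_one] at h
  exact (integrable_inv_bracket_pow.const_mul _).mono'
    (continuous_bargmannIntegrand θ hφ.continuous
      (continuous_translation θ g hΨc)).aestronglyMeasurable (ae_of_all _ h)

lemma exists_bargmannInner_translation_bound {θ : ℝ} {φ : C2 → ℂ}
    (hφ : RapidDecay θ φ) (N : ℕ) : ∃ K, ∀ (Ψ : C2 → ℂ) (C' : ℝ) (g : C2),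
      (∀ z, ‖Ψ z‖ * bracket z ^ N ≤ C' * Real.exp (freq θ * sqNorm z / 2)) →
      ‖bargmannInner θ φ (translation θ g Ψ)‖ * bracket g ^ N ≤ K * C' := by
  obtain ⟨C, hC⟩ := hφ.bound (N + 4)
  refine ⟨(freq θ / Real.pi) ^ 2 * 2 ^ N * C * ∫ z, (bracket z ^ 4)⁻¹, fun Ψ C' g hΨ => ?_⟩
  have hg := pow_pos (bracket_pos g) N
  rw [← le_div_iff₀ hg]
  have e : (freq θ / Real.pi) ^ 2 * 2 ^ N * C * (∫ z, (bracket z ^ 4)⁻¹) * C' / bracket g ^ N =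
      ∫ z, (freq θ / Real.pi) ^ 2 * 2 ^ N * C * C' / bracket g ^ N * (bracket z ^ 4)⁻¹ := by
    rw [integral_const_mul]; ring
  rw [e]
  refine norm_integral_le_of_norm_le (integrable_inv_bracket_pow.const_mul _)
    (ae_of_all _ fun z => ?_)
  have h := norm_bargmannIntegrand_translation_le hC hΨ g z
  rw [← le_div_iff₀ hg] at h
  exact h.trans (le_of_eq (by ring))

lemma bargmannInner_const_mul (θ : ℝ) (φ χ : C2 → ℂ) (c : ℂ) :
    bargmannInner θ φ (fun z => c * χ z) = c * bargmannInner θ φ χ := by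
  unfold bargmannInner
  rw [← integral_const_mul]
  congr 1
  ext z
  ring

lemma bargmannInner_translation_translation (θ : ℝ) (φ Ψ : C2 → ℂ) (a b : C2) :
    bargmannInner θ φ (translation θ a (translation θ b Ψ)) =
      cocycle θ a b * bargmannInner θ φ (translation θ (a + b) Ψ) := by
  rw [← bargmannInner_const_mul]
  congr 1
  ext z
  exact translation_translation θ a b Ψ z

/-- The matrix element of `T_a R T_b`, with the dilation `R` by `1 - x`. -/
noncomputable def dilationAmplitude (θ : ℝ) (φ χ : C2 → ℂ) (a b : C2) (x : ℝ) : ℂ :=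
  bargmannInner θ φ (translation θ a (translation θ b (conjDilation θ x 1 b χ)))

lemma continuous_conjDilation (θ x t : ℝ) (v : C2) {χ : C2 → ℂ} (hχ : Continuous χ) :
    Continuous (conjDilation θ x t v χ) := by
  unfold conjDilation
  have h : Continuous fun z => herm v z := continuous_herm.comp (Continuous.prodMk_right v)
  fun_prop

lemma exists_dilationAmplitude_bound {θ : ℝ} (hθ : 0 < θ) {φ χ : C2 → ℂ}
    (hφ : RapidDecay θ φ) (hχ : RapidDecay θ χ) (N k : ℕ) :
    ∃ C, ∀ (a b : C2) (x : ℝ), 0 ≤ x → x ≤ 1 → ‖dilationAmplitude θ φ χ a b x‖ *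
      bracket (a + b) ^ N * (1 + x * sqNorm b) ^ k ≤ C := by
  obtain ⟨C, hC⟩ := exists_conjDilation_bound hθ hχ N k
  obtain ⟨K, hK⟩ := exists_bargmannInner_translation_bound hφ N
  refine ⟨K * C, fun a b x hx0 hx1 => ?_⟩
  have hxb := pow_pos (one_add_mul_sqNorm_pos hx0 b) k
  rw [dilationAmplitude, bargmannInner_translation_translation, norm_mul, norm_cocycle, one_mul,
    ← le_div_iff₀ hxb, mul_div_assoc]
  refine hK _ _ _ fun z => ?_
  rw [div_mul_eq_mul_div, le_div_iff₀ hxb]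
  exact hC x 1 b z hx0 hx1 zero_le_one le_rfl

lemma exists_dilationAmplitude_sub_bound {θ : ℝ} (hθ : 0 < θ) {φ χ : C2 → ℂ}
    (hφ : RapidDecay θ φ) (hχ : χ ∈ heisenbergModule θ) (N k : ℕ) :
    ∃ C, ∀ (a b : C2) (x : ℝ), 0 ≤ x → x ≤ 1 → ‖dilationAmplitude θ φ χ a b x -
      ((Real.exp (-(freq θ * x * sqNorm b)) : ℝ) : ℂ) *
        bargmannInner θ φ (translation θ a (translation θ b χ))‖ *
      bracket (a + b) ^ N * (1 + x * sqNorm b) ^ k ≤ C * (x * √(bracket b)) := by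
  obtain ⟨C, hC⟩ := exists_conjDilation_sub_bound hθ hχ N k
  obtain ⟨K, hK⟩ := exists_bargmannInner_translation_bound hφ N
  have hr := (exists_rapidDecay_deriv hθ hχ).1
  obtain ⟨C₀, hC₀⟩ := exists_conjDilation_bound hθ hr 0 0
  obtain ⟨C₁, hC₁⟩ := hr.bound 0
  simp only [pow_zero, mul_one] at hC₀ hC₁
  refine ⟨K * C, fun a b x hx0 hx1 => ?_⟩
  have hxb := pow_pos (one_add_mul_sqNorm_pos hx0 b) k
  set e : ℂ := ((Real.exp (-(freq θ * x * sqNorm b)) : ℝ) : ℂ) with he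
  have i1 := integrable_bargmannIntegrand_translation (θ := θ) hφ
    (continuous_conjDilation θ x 1 b hr.continuous)
    (fun z => hC₀ x 1 b z hx0 hx1 zero_le_one le_rfl) (a + b)
  have i2 := integrable_bargmannIntegrand_translation (θ := θ) hφ hr.continuous hC₁ (a + b)
  have hlin : dilationAmplitude θ φ χ a b x -
      e * bargmannInner θ φ (translation θ a (translation θ b χ)) =
      cocycle θ a b * bargmannInner θ φ (translation θ (a + b)
        fun z => conjDilation θ x 1 b χ z - e * χ z) := by
    rw [dilationAmplitude, bargmannInner_translation_translation,
      bargmannInner_translation_translation, mul_left_comm, ← mul_sub]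
    congr 1
    rw [bargmannInner_eq, bargmannInner_eq, bargmannInner_eq, ← integral_const_mul,
      ← integral_sub i1 (i2.const_mul e)]
    congr 1
    ext z
    simp only [bargmannIntegrand, translation]
    ring
  rw [hlin, norm_mul, norm_cocycle, one_mul, ← le_div_iff₀ hxb, mul_assoc, mul_div_assoc]
  refine hK _ _ _ fun z => ?_
  rw [div_mul_eq_mul_div, le_div_iff₀ hxb]
  exact hC x b z hx0 hx1

/-- The matrix element of `T_a H_ε⁻¹ T_b` as an integral over the proper time. -/
lemma bargmannInner_propagator {θ : ℝ} (hθ : 0 < θ) (μ₀ : ℝ) {φ χ : C2 → ℂ}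
    (hφ : RapidDecay θ φ) (hχ : RapidDecay θ χ) {ε : ℝ} (hε : 0 < ε) (a b : C2) :
    IntegrableOn (fun β : ℝ => ((Real.exp (-((2 * freq θ + μ₀ ^ 2) * β)) : ℝ) : ℂ) *
      dilationAmplitude θ φ χ a b (1 - Real.exp (-(2 * freq θ * β)))) (Set.Ioi ε) ∧
    bargmannInner θ φ (translation θ a (propagator θ μ₀ ε (translation θ b χ))) =
      ∫ β in Set.Ioi ε, ((Real.exp (-((2 * freq θ + μ₀ ^ 2) * β)) : ℝ) : ℂ) *
        dilationAmplitude θ φ χ a b (1 - Real.exp (-(2 * freq θ * β))) := by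
  have hω := freq_pos hθ
  have hM : 0 < 2 * freq θ + μ₀ ^ 2 := by positivity
  obtain ⟨C, hC⟩ := exists_conjDilation_bound hθ hχ 0 0
  simp only [pow_zero, mul_one] at hC
  obtain ⟨Cφ, hCφ⟩ := hφ.bound 4
  set M := 2 * freq θ + μ₀ ^ 2 with hMdef
  set X : ℝ → ℝ := fun β => 1 - Real.exp (-(2 * freq θ * β)) with hX
  have hX01 : ∀ β, 0 < β → 0 ≤ X β ∧ X β ≤ 1 := fun β hβ => by
    have h1 : Real.exp (-(2 * freq θ * β)) ≤ 1 := Real.exp_le_one_iff.2 (by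
      have : 0 ≤ 2 * freq θ * β := by positivity
      linarith)
    have h2 := Real.exp_pos (-(2 * freq θ * β))
    constructor <;> simp only [hX] <;> linarith
  set G : ℝ → C2 → ℂ := fun β z => ((Real.exp (-(M * β)) : ℝ) : ℂ) * bargmannIntegrand θ φ
    (translation θ a (translation θ b (conjDilation θ (X β) 1 b χ))) z with hG
  have hGc : Continuous (Function.uncurry G) := by
    have c1 := hφ.continuous
    have c2 := hχ.continuous
    have c3 : Continuous fun z => herm a z := continuous_herm.comp (Continuous.prodMk_right a)
    have c4 : Continuous fun z => herm b z := continuous_herm.comp (Continuous.prodMk_right b)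
    have c5 := continuous_sqNorm
    have c6 : Continuous fun z => conj (φ z) := Complex.continuous_conj.comp c1
    simp only [hG, hX, Function.uncurry_def, bargmannIntegrand, translation, conjDilation]
    fun_prop
  have hbound : ∀ β, 0 < β → ∀ z, ‖G β z‖ ≤ Real.exp (-(M * β)) *
      ((freq θ / Real.pi) ^ 2 * 2 ^ 0 * Cφ * C * (bracket z ^ 4)⁻¹) := by
    intro β hβ z
    have hn : ‖bargmannIntegrand θ φ
        (translation θ a (translation θ b (conjDilation θ (X β) 1 b χ))) z‖ =
        ‖bargmannIntegrand θ φ (translation θ (a + b) (conjDilation θ (X β) 1 b χ)) z‖ := by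
      rw [norm_bargmannIntegrand, norm_bargmannIntegrand, translation_translation, norm_mul,
        norm_cocycle, one_mul]
    have h := norm_bargmannIntegrand_translation_le (θ := θ) (N := 0) (C := Cφ) (C' := C) (φ := φ)
      (Ψ := conjDilation θ (X β) 1 b χ) hCφ
      (fun z => by
        simpa using hC (X β) 1 b z (hX01 β hβ).1 (hX01 β hβ).2 zero_le_one le_rfl) (a + b) z
    rw [pow_zero, mul_one] at h
    simp only [hG]
    rw [norm_mul, Complex.norm_real, Real.norm_of_nonneg (Real.exp_pos _).le, hn]
    exact mul_le_mul_of_nonneg_left h (Real.exp_pos _).le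
  have hexp : IntegrableOn (fun β : ℝ => Real.exp (-(M * β))) (Set.Ioi ε) := by
    simpa only [neg_mul] using exp_neg_integrableOn_Ioi ε hM
  have hint : Integrable (Function.uncurry G)
      ((volume.restrict (Set.Ioi ε)).prod (volume : Measure C2)) := by
    have hdom := hexp.integrable.mul_prod (integrable_inv_bracket_pow.const_mul
      ((freq θ / Real.pi) ^ 2 * 2 ^ 0 * Cφ * C))
    refine hdom.mono' hGc.aestronglyMeasurable ?_
    have hae : ∀ᵐ p ∂((volume.restrict (Set.Ioi ε)).prod (volume : Measure C2)),
        p.1 ∈ Set.Ioi ε :=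
      Measure.quasiMeasurePreserving_fst.ae (ae_restrict_mem measurableSet_Ioi)
    filter_upwards [hae] with p hp
    exact hbound p.1 (hε.trans hp) p.2
  have hamp : ∀ β, ∫ z, G β z = ((Real.exp (-(M * β)) : ℝ) : ℂ) *
      dilationAmplitude θ φ χ a b (X β) := fun β => by
    simp only [hG]
    rw [integral_const_mul, dilationAmplitude, bargmannInner_eq]
  constructor
  · change IntegrableOn (fun β : ℝ => ((Real.exp (-(M * β)) : ℝ) : ℂ) *
      dilationAmplitude θ φ χ a b (X β)) _ _
    have := hint.integral_prod_left
    simp only [Function.uncurry_apply_pair, hamp] at this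
    exact this
  · change _ = ∫ β in Set.Ioi ε, ((Real.exp (-(M * β)) : ℝ) : ℂ) *
      dilationAmplitude θ φ χ a b (X β)
    simp only [← hamp]
    rw [integral_integral_swap hint, bargmannInner_eq]
    congr 1
    ext z
    simp only [bargmannIntegrand, hG]
    have hpt : translation θ a (propagator θ μ₀ ε (translation θ b χ)) z =
        ∫ β in Set.Ioi ε, ((Real.exp (-(M * β)) : ℝ) : ℂ) *
          translation θ a (translation θ b (conjDilation θ (X β) 1 b χ)) z := by
      simp only [translation, propagator]
      rw [← integral_const_mul]
      congr 1
      ext β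
      rw [heat_translation]
      simp only [translation, hX, hMdef]
      ring
    rw [hpt, ← integral_const_mul, ← integral_const_mul]
    congr 1
    ext β
    ring

/-! ### Sums over the lattice -/

lemma hasSum_prod_mul {𝕜 α β : Type*} [RCLike 𝕜] {f : α → 𝕜} {g : β → 𝕜} {s t : 𝕜}
    (hf : HasSum f s) (hg : HasSum g t) : HasSum (fun p : α × β => f p.1 * g p.2) (s * t) :=
  hf.mul hg (summable_mul_of_summable_norm hf.summable.norm hg.summable.norm)

lemma hasSum_fin_two_mul {𝕜 α : Type*} [RCLike 𝕜] {f g : α → 𝕜} {s t : 𝕜} (hf : HasSum f s)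
    (hg : HasSum g t) : HasSum (fun n : Fin 2 → α => f (n 0) * g (n 1)) (s * t) := by
  rw [← (finTwoArrowEquiv α).symm.hasSum_iff]
  exact hasSum_prod_mul hf hg

/-- A product of functions of the four integer coordinates of the lattice is summed coordinate by
coordinate. -/
lemma hasSum_mode {f : ℤ → ℝ} {s : ℝ} (hf : HasSum f s) :
    HasSum (fun γ : Mode => f (γ.1 0) * f (γ.1 1) * (f (γ.2 0) * f (γ.2 1))) (s ^ 4) := by
  have h := hasSum_prod_mul (hasSum_fin_two_mul hf hf) (hasSum_fin_two_mul hf hf)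
  rwa [show s * s * (s * s) = s ^ 4 by ring] at h

lemma summable_nat_inv_one_add_sq {a : ℝ} (ha : 0 < a) :
    Summable (fun n : ℕ => (1 + a ^ 2 * ((n : ℝ) + 1) ^ 2)⁻¹) ∧
      ∑' n : ℕ, (1 + a ^ 2 * ((n : ℝ) + 1) ^ 2)⁻¹ ≤ 2 / a := by
  -- the sum telescopes after `1 + a²(n+1)² ≥ (1 + a(n+1))² / 2 ≥ (1 + a(n+1)) (1 + an) / 2`
  have hle : ∀ n : ℕ, (1 + a ^ 2 * ((n : ℝ) + 1) ^ 2)⁻¹ ≤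
      2 / a * (1 + a * (n : ℝ))⁻¹ - 2 / a * (1 + a * ((n + 1 : ℕ) : ℝ))⁻¹ := by
    intro n
    have hn : (0 : ℝ) ≤ n := Nat.cast_nonneg n
    have e : 2 / a * (1 + a * (n : ℝ))⁻¹ - 2 / a * (1 + a * ((n + 1 : ℕ) : ℝ))⁻¹ =
        2 / ((1 + a * n) * (1 + a * (n + 1))) := by
      push_cast
      field_simp
      ring
    rw [e, inv_eq_one_div, div_le_div_iff₀ (by positivity) (by positivity)]
    nlinarith [sq_nonneg (1 - a * ((n : ℝ) + 1)), mul_nonneg ha.le hn]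
  have hsum : ∀ m : ℕ, ∑ n ∈ Finset.range m, (1 + a ^ 2 * ((n : ℝ) + 1) ^ 2)⁻¹ ≤ 2 / a := by
    intro m
    refine (Finset.sum_le_sum fun n _ => hle n).trans ?_
    rw [Finset.sum_range_sub' (fun n : ℕ => 2 / a * (1 + a * (n : ℝ))⁻¹)]
    have : 0 ≤ 2 / a * (1 + a * (m : ℝ))⁻¹ := by positivity
    simpa using this
  have h0 : ∀ n : ℕ, 0 ≤ (1 + a ^ 2 * ((n : ℝ) + 1) ^ 2)⁻¹ := fun n => by positivity
  exact ⟨summable_of_sum_range_le h0 hsum, Real.tsum_le_of_sum_range_le h0 hsum⟩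

lemma exists_hasSum_int_inv_one_add_sq {X : ℝ} (hX : 0 < X) :
    ∃ S, HasSum (fun n : ℤ => (1 + X * (n : ℝ) ^ 2)⁻¹) S ∧ S ≤ 1 + 4 / √X := by
  obtain ⟨hs, hle⟩ := summable_nat_inv_one_add_sq (Real.sqrt_pos.2 hX)
  rw [Real.sq_sqrt hX.le] at hs hle
  have h := HasSum.of_add_one_of_neg_add_one (f := fun n : ℤ => (1 + X * (n : ℝ) ^ 2)⁻¹)
    (by simpa using hs.hasSum) (by
      have e : ∀ n : ℕ, (1 + X * ((-((n : ℤ) + 1) : ℤ) : ℝ) ^ 2)⁻¹ =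
          (1 + X * ((n : ℝ) + 1) ^ 2)⁻¹ := fun n => by push_cast; rw [neg_sq]
      simpa only [e] using hs.hasSum)
  refine ⟨_, h, ?_⟩
  have e : 4 / √X = 2 / √X + 2 / √X := by ring
  simp only [Int.cast_zero]
  rw [e]
  norm_num
  linarith

lemma sqNorm_latticePoint (θ : ℝ) (γ : Mode) : sqNorm (latticePoint θ γ) =
    θ ^ 2 / 2 * ((γ.1 0 : ℝ) ^ 2 + (γ.1 1 : ℝ) ^ 2 + ((γ.2 0 : ℝ) ^ 2 + (γ.2 1 : ℝ) ^ 2)) := by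
  have h2 : √2 * √2 = 2 := Real.mul_self_sqrt zero_le_two
  have e : ∀ i, Complex.normSq (latticePoint θ γ i) =
      θ ^ 2 / 2 * ((γ.1 i : ℝ) ^ 2 + (γ.2 i : ℝ) ^ 2) := by
    intro i
    unfold latticePoint
    rw [Complex.normSq_mul, Complex.normSq_ofReal, div_mul_div_comm, h2, ← pow_two]
    congr 1
    rw [Complex.normSq_apply]
    simp
    ring
  simp only [sqNorm, Fin.sum_univ_two, e]
  ring

lemma latticePoint_add (θ : ℝ) (γ δ : Mode) :
    latticePoint θ (γ + δ) = latticePoint θ γ + latticePoint θ δ := by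
  ext i
  simp [latticePoint]
  ring

lemma latticePoint_neg (θ : ℝ) (γ : Mode) : latticePoint θ (-γ) = -latticePoint θ γ := by
  ext i
  simp [latticePoint]
  ring

/-- Splits a weight on the lattice into weights in the single coordinates. -/
lemma prod_one_add_le {a b c d : ℝ} (ha : 0 ≤ a) (hb : 0 ≤ b) (hc : 0 ≤ c) (hd : 0 ≤ d) :
    (1 + a) * (1 + b) * ((1 + c) * (1 + d)) ≤ (1 + a + b + c + d) ^ 4 := by
  set P := 1 + a + b + c + d with hP
  have h1 : 1 + a ≤ P := by linarith
  have h2 : 1 + b ≤ P := by linarith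
  have h3 : 1 + c ≤ P := by linarith
  have h4 : 1 + d ≤ P := by linarith
  have h0 : 0 ≤ P := by linarith
  calc (1 + a) * (1 + b) * ((1 + c) * (1 + d)) ≤ P * P * (P * P) := by gcongr
    _ = P ^ 4 := by ring

/-- The sum `∑_γ (1 + X|γ|²)⁻⁴` over the four-dimensional lattice is of order `X⁻²`. -/
lemma exists_tsum_inv_one_add_sqNorm_le {θ : ℝ} (hθ : 0 < θ) : ∃ C, ∀ X : ℝ, 0 < X → X ≤ 2 →
    Summable (fun γ : Mode => ((1 + X * sqNorm (latticePoint θ γ)) ^ 4)⁻¹) ∧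
      ∑' γ : Mode, ((1 + X * sqNorm (latticePoint θ γ)) ^ 4)⁻¹ ≤ C * (X ^ 2)⁻¹ := by
  set c := θ ^ 2 / 2 with hc
  have hc0 : 0 < c := by positivity
  refine ⟨(√2 + 4 / √c) ^ 4, fun X hX hX2 => ?_⟩
  obtain ⟨S, hS, hSle⟩ := exists_hasSum_int_inv_one_add_sq (mul_pos hX hc0)
  have h0 : ∀ n : ℤ, 0 ≤ (1 + X * c * (n : ℝ) ^ 2)⁻¹ := fun n => by positivity
  have hS0 : 0 ≤ S := hS.nonneg h0
  have hm := hasSum_mode hS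
  have hle : ∀ γ : Mode, ((1 + X * sqNorm (latticePoint θ γ)) ^ 4)⁻¹ ≤
      (1 + X * c * (γ.1 0 : ℝ) ^ 2)⁻¹ * (1 + X * c * (γ.1 1 : ℝ) ^ 2)⁻¹ *
      ((1 + X * c * (γ.2 0 : ℝ) ^ 2)⁻¹ * (1 + X * c * (γ.2 1 : ℝ) ^ 2)⁻¹) := by
    intro γ
    rw [sqNorm_latticePoint, ← hc, ← mul_inv, ← mul_inv, ← mul_inv]
    have hp : ∀ n : ℤ, 0 ≤ X * c * (n : ℝ) ^ 2 := fun n => by positivity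
    have e : 1 + X * (c * ((γ.1 0 : ℝ) ^ 2 + (γ.1 1 : ℝ) ^ 2 +
      ((γ.2 0 : ℝ) ^ 2 + (γ.2 1 : ℝ) ^ 2))) = 1 + X * c * (γ.1 0 : ℝ) ^ 2 +
      X * c * (γ.1 1 : ℝ) ^ 2 + X * c * (γ.2 0 : ℝ) ^ 2 + X * c * (γ.2 1 : ℝ) ^ 2 := by ring
    rw [e]
    have p1 := hp (γ.1 0)
    have p2 := hp (γ.1 1)
    have p3 := hp (γ.2 0)
    have p4 := hp (γ.2 1)
    refine inv_anti₀ (by positivity) ?_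
    exact prod_one_add_le p1 p2 p3 p4
  have hs : Summable (fun γ : Mode => ((1 + X * sqNorm (latticePoint θ γ)) ^ 4)⁻¹) :=
    Summable.of_nonneg_of_le (fun γ => inv_nonneg.2 (pow_nonneg
      (one_add_mul_sqNorm_pos hX.le _).le 4)) hle hm.summable
  refine ⟨hs, (hs.tsum_le_tsum hle hm.summable).trans ?_⟩
  rw [hm.tsum_eq]
  have hsX : 0 < √X := Real.sqrt_pos.2 hX
  have h1 : S ≤ (√2 + 4 / √c) / √X := by
    refine hSle.trans ?_
    rw [Real.sqrt_mul hX.le, add_div]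
    refine add_le_add ?_ (le_of_eq (by field_simp))
    rw [le_div_iff₀ hsX, one_mul]
    exact Real.sqrt_le_sqrt hX2
  calc S ^ 4 ≤ ((√2 + 4 / √c) / √X) ^ 4 := pow_le_pow_left₀ hS0 h1 4
    _ = (√2 + 4 / √c) ^ 4 * (((√X) ^ 2) ^ 2)⁻¹ := by rw [div_pow]; ring
    _ = _ := by rw [Real.sq_sqrt hX.le]

lemma summable_inv_bracket_latticePoint {θ : ℝ} (hθ : 0 < θ) :
    Summable fun γ : Mode => (bracket (latticePoint θ γ) ^ 4)⁻¹ := by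
  obtain ⟨C, hC⟩ := exists_tsum_inv_one_add_sqNorm_le hθ
  simpa [bracket] using (hC 1 one_pos one_le_two).1

/-- Jacobi's inversion formula shows that the theta series differs from `a^{-1/2}` by a bounded
amount. -/
lemma exists_hasSum_theta {a : ℝ} (ha : 0 < a) :
    ∃ S, HasSum (fun n : ℤ => Real.exp (-(Real.pi * a * (n : ℝ) ^ 2))) S ∧
      1 / √a ≤ S ∧ S ≤ 1 / √a + 4 := by
  have hle : ∀ {b : ℝ}, 0 < b → ∀ n : ℤ,
      Real.exp (-(b * (n : ℝ) ^ 2)) ≤ (1 + b * (n : ℝ) ^ 2)⁻¹ := by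
    intro b hb n
    rw [Real.exp_neg]
    have := Real.add_one_le_exp (b * (n : ℝ) ^ 2)
    exact inv_anti₀ (by positivity) (by linarith)
  have hs : ∀ {b : ℝ}, 0 < b → Summable fun n : ℤ => Real.exp (-(b * (n : ℝ) ^ 2)) := by
    intro b hb
    obtain ⟨T, hT, -⟩ := exists_hasSum_int_inv_one_add_sq hb
    exact Summable.of_nonneg_of_le (fun n => (Real.exp_pos _).le) (hle hb) hT.summable
  have hpa : 0 < Real.pi * a := by positivity
  have hpa' : 0 < Real.pi / a := by positivity
  refine ⟨_, (hs hpa).hasSum, ?_⟩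
  have hJ := Real.tsum_exp_neg_mul_int_sq ha
  simp only [neg_mul, neg_div, ← Real.sqrt_eq_rpow] at hJ
  rw [hJ]
  obtain ⟨T, hT, hTle⟩ := exists_hasSum_int_inv_one_add_sq hpa'
  have hsa : 0 < √a := Real.sqrt_pos.2 ha
  constructor
  · refine le_mul_of_one_le_right (by positivity) ?_
    have := (hs hpa').le_tsum 0 fun n _ => (Real.exp_pos _).le
    simpa using this
  · have h1 : ∑' n : ℤ, Real.exp (-(Real.pi / a * (n : ℝ) ^ 2)) ≤ 1 + 4 / √(Real.pi / a) :=
      ((hs hpa').tsum_le_tsum (hle hpa') hT.summable).trans (hT.tsum_eq.trans_le hTle)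
    have h2 : 4 / √(Real.pi / a) ≤ 4 * √a := by
      rw [Real.sqrt_div Real.pi_pos.le, div_div_eq_mul_div]
      refine div_le_self (by positivity) ?_
      rw [Real.one_le_sqrt]
      linarith [Real.pi_gt_three]
    calc 1 / √a * ∑' n : ℤ, Real.exp (-(Real.pi / a * (n : ℝ) ^ 2))
        ≤ 1 / √a * (1 + 4 * √a) := by gcongr; linarith
      _ = 1 / √a + 4 := by field_simp

/-- The Gaussian sum over the lattice, to leading order `1/(θX)²` with an error `O(X^{-3/2})`. -/
lemma exists_hasSum_gaussian {θ : ℝ} (hθ : 0 < θ) : ∃ C, ∀ X : ℝ, 0 < X → X ≤ 2 →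
    ∃ S, HasSum (fun γ : Mode => Real.exp (-(freq θ * X * sqNorm (latticePoint θ γ)))) S ∧
      |S - ((θ * X) ^ 2)⁻¹| ≤ C * (X * √X)⁻¹ := by
  set K := 1 + 4 * √(2 * θ) with hK
  have hK1 : 1 ≤ K := by
    have := Real.sqrt_nonneg (2 * θ)
    rw [hK]; linarith
  refine ⟨16 * K ^ 3 * (θ * √θ)⁻¹, fun X hX hX2 => ?_⟩
  have ha : 0 < θ * X := by positivity
  obtain ⟨T, hT, h1, h2⟩ := exists_hasSum_theta ha
  have hm := hasSum_mode hT
  refine ⟨T ^ 4, ?_, ?_⟩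
  · convert hm using 2 with γ
    rw [← Real.exp_add, ← Real.exp_add, ← Real.exp_add, sqNorm_latticePoint]
    congr 1
    unfold freq
    field_simp
    ring
  · have hsa : 0 < √(θ * X) := Real.sqrt_pos.2 ha
    set u := 1 / √(θ * X) with hu
    have hu0 : 0 < u := by positivity
    have hu4 : ((θ * X) ^ 2)⁻¹ = u ^ 4 := by
      rw [hu, div_pow, one_pow, show (√(θ * X)) ^ 4 = ((√(θ * X)) ^ 2) ^ 2 by ring,
        Real.sq_sqrt ha.le, one_div]
    have hTK : T ≤ K * u := by
      have h3 : 1 ≤ √(2 * θ) * u := by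
        rw [hu, mul_one_div, one_le_div hsa]
        exact Real.sqrt_le_sqrt (by nlinarith)
      rw [hK]
      nlinarith
    have huK : u ≤ K * u := le_mul_of_one_le_left hu0.le hK1
    have hT0 : 0 ≤ T := hu0.le.trans h1
    have h4 : u ^ 3 = (θ * √θ)⁻¹ * (X * √X)⁻¹ := by
      rw [hu, Real.sqrt_mul hθ.le, div_pow, one_pow, ← mul_inv, one_div]
      congr 1
      calc (√θ * √X) ^ 3 = (√θ) ^ 2 * √θ * ((√X) ^ 2 * √X) := by ring
        _ = _ := by rw [Real.sq_sqrt hθ.le, Real.sq_sqrt hX.le]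
    rw [hu4, abs_of_nonneg (sub_nonneg.2 (pow_le_pow_left₀ hu0.le h1 4))]
    have hKu : 0 ≤ K * u := hu0.le.trans huK
    calc T ^ 4 - u ^ 4 = (T - u) * (T ^ 3 + T ^ 2 * u + T * u ^ 2 + u ^ 3) := by ring
      _ ≤ 4 * ((K * u) ^ 3 + (K * u) ^ 2 * (K * u) + (K * u) * (K * u) ^ 2 + (K * u) ^ 3) := by
          have : T - u ≤ 4 := by linarith
          gcongr
      _ = 16 * K ^ 3 * u ^ 3 := by ring
      _ = 16 * K ^ 3 * (θ * √θ)⁻¹ * (X * √X)⁻¹ := by rw [h4]; ring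

/-! ### Logarithmic divergence of proper time integrals -/

/-- The weight `1 + s^{-3/4}`, integrable at the origin. Singularities up to `(s+t)^{-3/2}` in
two proper times are dominated by a product of two such weights. -/
noncomputable def singularWeight (s : ℝ) : ℝ := 1 + s ^ (-(3 / 4) : ℝ)

lemma one_le_singularWeight {s : ℝ} (hs : 0 < s) : 1 ≤ singularWeight s := by
  have := Real.rpow_nonneg hs.le (-(3 / 4) : ℝ)
  unfold singularWeight; linarith

lemma one_le_singularWeight_mul {s t : ℝ} (hs : 0 < s) (ht : 0 < t) :
    1 ≤ singularWeight s * singularWeight t :=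
  one_le_mul_of_one_le_of_one_le (one_le_singularWeight hs) (one_le_singularWeight ht)

lemma one_add_inv_mul_sqrt_le {s t : ℝ} (hs : 0 < s) (ht : 0 < t) :
    1 + ((s + t) * √(s + t))⁻¹ ≤ singularWeight s * singularWeight t := by
  have hu : 0 < s + t := by positivity
  have h1 : ((s + t) * √(s + t))⁻¹ = (s + t) ^ (-(3 / 4) : ℝ) * (s + t) ^ (-(3 / 4) : ℝ) := by
    rw [← Real.rpow_add hu, Real.sqrt_eq_rpow]
    nth_rewrite 1 [← Real.rpow_one (s + t)]
    rw [← Real.rpow_add hu, ← Real.rpow_neg hu.le]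
    norm_num
  have h2 : (s + t) ^ (-(3 / 4) : ℝ) ≤ s ^ (-(3 / 4) : ℝ) :=
    Real.rpow_le_rpow_of_nonpos hs (by linarith) (by norm_num)
  have h3 : (s + t) ^ (-(3 / 4) : ℝ) ≤ t ^ (-(3 / 4) : ℝ) :=
    Real.rpow_le_rpow_of_nonpos ht (by linarith) (by norm_num)
  have h4 := Real.rpow_pos_of_pos hu (-(3 / 4) : ℝ)
  have h5 := mul_le_mul h2 h3 h4.le (h4.le.trans h2)
  have h6 := Real.rpow_pos_of_pos hs (-(3 / 4) : ℝ)
  have h7 := Real.rpow_pos_of_pos ht (-(3 / 4) : ℝ)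
  rw [h1]
  unfold singularWeight
  nlinarith

lemma inv_add_le_singularWeight {s t : ℝ} (hs : 0 < s) (ht : 0 < t) :
    (s + t)⁻¹ ≤ singularWeight s * singularWeight t := by
  refine le_trans ?_ (one_add_inv_mul_sqrt_le hs ht)
  have hu : 0 < s + t := by positivity
  rcases le_total 1 (s + t) with h | h
  · have h1 := inv_le_one_of_one_le₀ h
    have h2 : 0 ≤ ((s + t) * √(s + t))⁻¹ := by positivity
    linarith
  · have h1 : (s + t)⁻¹ ≤ ((s + t) * √(s + t))⁻¹ := by
      refine inv_anti₀ (by positivity) (mul_le_of_le_one_right hu.le ?_)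
      exact Real.sqrt_le_one.2 h
    linarith

lemma integrableOn_exp_mul_singularWeight {M : ℝ} (hM : 0 < M) :
    IntegrableOn (fun s => Real.exp (-(M * s)) * singularWeight s) (Set.Ioi 0) := by
  have h1 : IntegrableOn (fun s => Real.exp (-(M * s))) (Set.Ioi 0) := by
    simpa only [neg_mul] using exp_neg_integrableOn_Ioi 0 hM
  have h2 := integrableOn_rpow_mul_exp_neg_mul_rpow (p := 1) (s := -(3 / 4)) (b := M)
    (by norm_num) one_pos hM
  simp only [Real.rpow_one] at h2
  refine (h1.add h2).congr_fun (fun s _ => ?_) measurableSet_Ioi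
  simp only [singularWeight, Pi.add_apply]
  ring_nf

lemma continuousOn_inv_add_sq {ε : ℝ} (hε : 0 < ε) :
    ContinuousOn (fun z : ℝ × ℝ => (((z.1 + z.2) ^ 2)⁻¹ : ℝ)) (Set.Icc ε 1 ×ˢ Set.Icc ε 1) := by
  refine ContinuousOn.inv₀ (by fun_prop) fun z hz => ?_
  have h1 := hz.1.1
  have h2 := hz.2.1
  have : 0 < z.1 + z.2 := by linarith
  positivity

lemma integrableOn_inv_add_sq {ε : ℝ} (hε : 0 < ε) :
    IntegrableOn (fun z : ℝ × ℝ => (((z.1 + z.2) ^ 2)⁻¹ : ℝ)) (Set.Ioc ε 1 ×ˢ Set.Ioc ε 1) :=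
  ((continuousOn_inv_add_sq hε).integrableOn_compact (isCompact_Icc.prod isCompact_Icc)).mono_set
    (Set.prod_mono Set.Ioc_subset_Icc_self Set.Ioc_subset_Icc_self)

lemma setIntegral_inv_add_sq {ε : ℝ} (hε : 0 < ε) (hε1 : ε < 1) :
    ∫ z in Set.Ioc ε 1 ×ˢ Set.Ioc ε 1, (((z.1 + z.2) ^ 2)⁻¹ : ℝ) =
      Real.log (1 / ε) + (2 * Real.log (1 + ε) - 2 * Real.log 2) := by
  have hI := integrableOn_inv_add_sq hε
  rw [Measure.volume_eq_prod] at hI ⊢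
  rw [setIntegral_prod _ hI]
  have h1 : ∀ s ∈ Set.Ioc ε 1, ∫ t in Set.Ioc ε 1, (((s + t) ^ 2)⁻¹ : ℝ) =
      (s + ε)⁻¹ - (s + 1)⁻¹ := by
    intro s hs
    rw [← intervalIntegral.integral_of_le hε1.le]
    have hpos : ∀ t ∈ Set.uIcc ε 1, 0 < s + t := fun t ht => by
      rw [Set.uIcc_of_le hε1.le] at ht
      linarith [hs.1, ht.1]
    rw [intervalIntegral.integral_eq_sub_of_hasDerivAt (f := fun t => -(s + t)⁻¹)]
    · ring
    · intro t ht
      have h := (((hasDerivAt_id t).const_add s).inv (hpos t ht).ne').neg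
      refine h.congr_deriv ?_
      simp [div_eq_mul_inv]
    · refine ContinuousOn.intervalIntegrable (ContinuousOn.inv₀ (by fun_prop) fun t ht => ?_)
      exact (pow_pos (hpos t ht) 2).ne'
  rw [setIntegral_congr_fun measurableSet_Ioc h1, ← intervalIntegral.integral_of_le hε1.le]
  have hpos : ∀ c, 0 < c → ∀ s ∈ Set.uIcc ε 1, 0 < s + c := fun c hc s hs => by
    rw [Set.uIcc_of_le hε1.le] at hs
    linarith [hs.1]
  rw [intervalIntegral.integral_eq_sub_of_hasDerivAt
    (f := fun s => Real.log (s + ε) - Real.log (s + 1))]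
  · have e2 : Real.log (ε + ε) = Real.log 2 + Real.log ε := by
      rw [← two_mul, Real.log_mul two_ne_zero hε.ne']
    rw [e2, one_div, Real.log_inv, show (1 : ℝ) + 1 = 2 by norm_num, add_comm ε 1]
    ring
  · intro s hs
    have ha := ((hasDerivAt_id s).add_const ε).log (hpos ε hε s hs).ne'
    have hb := ((hasDerivAt_id s).add_const 1).log (hpos 1 one_pos s hs).ne'
    exact (ha.sub hb).congr_deriv (by simp)
  · refine ContinuousOn.intervalIntegrable (ContinuousOn.sub (ContinuousOn.inv₀ (by fun_prop)
      fun s hs => (hpos ε hε s hs).ne') (ContinuousOn.inv₀ (by fun_prop)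
      fun s hs => (hpos 1 one_pos s hs).ne'))

/-- The comparison function with a purely logarithmic divergence: `(s+t)⁻²` cut off at `1`. -/
noncomputable def logKernel : ℝ × ℝ → ℝ :=
  (Set.Ioc 0 1 ×ˢ Set.Ioc 0 1).indicator fun z => ((z.1 + z.2) ^ 2)⁻¹

lemma logKernel_ae {ε : ℝ} (hε : 0 < ε) :
    (fun z => logKernel z) =ᵐ[volume.restrict (Set.Ioi ε ×ˢ Set.Ioi ε)]
      (Set.Ioc ε 1 ×ˢ Set.Ioc ε 1).indicator fun z : ℝ × ℝ => ((z.1 + z.2) ^ 2)⁻¹ := by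
  filter_upwards [ae_restrict_mem (measurableSet_Ioi.prod measurableSet_Ioi)] with z hz
  have h1 : ε < z.1 := hz.1
  have h2 : ε < z.2 := hz.2
  unfold logKernel
  by_cases h : z.1 ≤ 1 ∧ z.2 ≤ 1
  · rw [Set.indicator_of_mem, Set.indicator_of_mem]
    · exact ⟨⟨h1, h.1⟩, ⟨h2, h.2⟩⟩
    · exact ⟨⟨hε.trans h1, h.1⟩, ⟨hε.trans h2, h.2⟩⟩
  · rw [Set.indicator_of_notMem, Set.indicator_of_notMem]
    · exact fun hz' => h ⟨hz'.1.2, hz'.2.2⟩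
    · exact fun hz' => h ⟨hz'.1.2, hz'.2.2⟩

lemma Ioc_prod_inter_Ioi_prod (ε : ℝ) :
    (Set.Ioi ε ×ˢ Set.Ioi ε) ∩ (Set.Ioc ε 1 ×ˢ Set.Ioc ε 1) = Set.Ioc ε 1 ×ˢ Set.Ioc ε 1 :=
  Set.inter_eq_right.2 (Set.prod_mono Set.Ioc_subset_Ioi_self Set.Ioc_subset_Ioi_self)

lemma integrableOn_logKernel {ε : ℝ} (hε : 0 < ε) :
    IntegrableOn logKernel (Set.Ioi ε ×ˢ Set.Ioi ε) := by
  have hms : MeasurableSet (Set.Ioc ε 1 ×ˢ Set.Ioc ε 1) := measurableSet_Ioc.prod measurableSet_Ioc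
  refine Integrable.congr ?_ (logKernel_ae hε).symm
  rw [integrable_indicator_iff hms, IntegrableOn, Measure.restrict_restrict hms, Set.inter_comm,
    Ioc_prod_inter_Ioi_prod]
  exact integrableOn_inv_add_sq hε

lemma setIntegral_logKernel {ε : ℝ} (hε : 0 < ε) (hε1 : ε < 1) :
    ∫ z in Set.Ioi ε ×ˢ Set.Ioi ε, logKernel z =
      Real.log (1 / ε) + (2 * Real.log (1 + ε) - 2 * Real.log 2) := by
  rw [integral_congr_ae (logKernel_ae hε),
    setIntegral_indicator (measurableSet_Ioc.prod measurableSet_Ioc), Ioc_prod_inter_Ioi_prod,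
    setIntegral_inv_add_sq hε hε1]

lemma measurable_logKernel : Measurable logKernel :=
  Measurable.indicator (by fun_prop) (measurableSet_Ioc.prod measurableSet_Ioc)

/-- Cutting off `exp (-M(s+t)) / (s+t)²` at `s, t ≤ 1` instead of by the mass costs an integrable
function. -/
lemma abs_exp_mul_sub_logKernel_le {M : ℝ} (hM : 0 < M) {s t : ℝ} (hs : 0 < s) (ht : 0 < t) :
    |Real.exp (-(M * (s + t))) * ((s + t) ^ 2)⁻¹ - logKernel (s, t)| ≤
      (M * Real.exp (2 * M) + 1) *
        (Real.exp (-(M * (s + t))) * (singularWeight s * singularWeight t)) := by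
  have hw := one_le_singularWeight_mul hs ht
  have hu : 0 < s + t := by positivity
  have hE := Real.exp_pos (-(M * (s + t)))
  have hEw : 0 ≤ Real.exp (-(M * (s + t))) * (singularWeight s * singularWeight t) := by positivity
  by_cases h : s ≤ 1 ∧ t ≤ 1
  · have hk : logKernel (s, t) = ((s + t) ^ 2)⁻¹ :=
      Set.indicator_of_mem (show (s, t) ∈ Set.Ioc (0 : ℝ) 1 ×ˢ Set.Ioc (0 : ℝ) 1 from
        ⟨⟨hs, h.1⟩, ⟨ht, h.2⟩⟩) _
    have h1 : |Real.exp (-(M * (s + t))) - 1| ≤ M * (s + t) := by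
      have h2 := Real.add_one_le_exp (-(M * (s + t)))
      have h3 : Real.exp (-(M * (s + t))) ≤ 1 := Real.exp_le_one_iff.2 (by
        have : 0 ≤ M * (s + t) := by positivity
        linarith)
      rw [abs_of_nonpos (by linarith)]
      linarith
    have h4 : 1 ≤ Real.exp (2 * M) * Real.exp (-(M * (s + t))) := by
      rw [← Real.exp_add]
      refine Real.one_le_exp ?_
      nlinarith [h.1, h.2]
    rw [hk, show Real.exp (-(M * (s + t))) * ((s + t) ^ 2)⁻¹ - ((s + t) ^ 2)⁻¹ =
      (Real.exp (-(M * (s + t))) - 1) * ((s + t) ^ 2)⁻¹ by ring, abs_mul,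
      abs_of_pos (show 0 < ((s + t) ^ 2)⁻¹ by positivity)]
    calc |Real.exp (-(M * (s + t))) - 1| * ((s + t) ^ 2)⁻¹
        ≤ M * (s + t) * ((s + t) ^ 2)⁻¹ := by gcongr
      _ = M * 1 * (s + t)⁻¹ := by field_simp
      _ ≤ M * (Real.exp (2 * M) * Real.exp (-(M * (s + t)))) *
          (singularWeight s * singularWeight t) := by
          have := inv_add_le_singularWeight hs ht
          gcongr
      _ = M * Real.exp (2 * M) *
          (Real.exp (-(M * (s + t))) * (singularWeight s * singularWeight t)) := by ring
      _ ≤ _ := by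
          rw [add_mul, one_mul]
          linarith
  · have hk : logKernel (s, t) = 0 :=
      Set.indicator_of_notMem (fun hz => h ⟨hz.1.2, hz.2.2⟩) _
    have hu1 : 1 ≤ s + t := by
      by_contra hlt
      exact h ⟨by linarith, by linarith⟩
    rw [hk, sub_zero, abs_of_pos (by positivity)]
    calc Real.exp (-(M * (s + t))) * ((s + t) ^ 2)⁻¹
        ≤ Real.exp (-(M * (s + t))) * (singularWeight s * singularWeight t) := by
          gcongr
          exact (inv_le_one_of_one_le₀ (one_le_pow₀ hu1)).trans hw
      _ ≤ _ := by
          rw [add_mul, one_mul]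
          have : 0 ≤ M * Real.exp (2 * M) := by positivity
          nlinarith

lemma aecover_Ioi_prod :
    AECover ((volume : Measure (ℝ × ℝ)).restrict (Set.Ioi 0 ×ˢ Set.Ioi 0)) (𝓝[>] (0 : ℝ))
      fun ε => Set.Ioi ε ×ˢ Set.Ioi ε where
  ae_eventually_mem := by
    filter_upwards [ae_restrict_mem (measurableSet_Ioi.prod measurableSet_Ioi)] with z hz
    filter_upwards [nhdsWithin_le_nhds (Iio_mem_nhds (show (0 : ℝ) < z.1 from hz.1)),
      nhdsWithin_le_nhds (Iio_mem_nhds (show (0 : ℝ) < z.2 from hz.2))] with ε h1 h2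
    exact ⟨h1, h2⟩
  measurableSet _ := measurableSet_Ioi.prod measurableSet_Ioi

/-- A series of proper time integrals, damped by `exp (-M(s+t))` at infinity, whose integrand sums
to `Q/(s+t)²` up to an integrable function, diverges like `Q ln (1/ε)` when cut off at
`s, t > ε`. -/
theorem tendsto_tsum_integral_sub_log {ι : Type*} [Countable ι] {M : ℝ} (hM : 0 < M)
    {m : ι → ℝ × ℝ → ℂ} (hm : ∀ p, Measurable (m p))
    (hsum : ∀ ε : ℝ, 0 < ε → ∃ u : ι → ℝ, Summable u ∧
      ∀ p s t, ε < s → ε < t → ‖m p (s, t)‖ ≤ u p)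
    {Q : ℂ} {C : ℝ} (hlead : ∀ s t, 0 < s → 0 < t →
      ‖∑' p, m p (s, t) - Q * (((s + t) ^ 2)⁻¹ : ℝ)‖ ≤ C * (singularWeight s * singularWeight t)) :
    (∀ ε : ℝ, 0 < ε → Summable fun p => ∫ z in Set.Ioi ε ×ˢ Set.Ioi ε,
      ((Real.exp (-(M * (z.1 + z.2))) : ℝ) : ℂ) * m p z) ∧
    ∃ c : ℂ, Tendsto (fun ε : ℝ => (∑' p, ∫ z in Set.Ioi ε ×ˢ Set.Ioi ε,
      ((Real.exp (-(M * (z.1 + z.2))) : ℝ) : ℂ) * m p z) - Q * (Real.log (1 / ε) : ℂ))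
      (𝓝[>] 0) (𝓝 c) := by
  have hmE : Measurable fun z : ℝ × ℝ => ((Real.exp (-(M * (z.1 + z.2))) : ℝ) : ℂ) := by fun_prop
  have hprod : ∀ {f : ℝ → ℝ} {ε : ℝ}, IntegrableOn f (Set.Ioi ε) →
      IntegrableOn (fun z : ℝ × ℝ => f z.1 * f z.2) (Set.Ioi ε ×ˢ Set.Ioi ε) := by
    intro f ε hf
    rw [IntegrableOn, Measure.volume_eq_prod, ← Measure.prod_restrict]
    exact hf.integrable.mul_prod hf.integrable
  set F : ℝ × ℝ → ℂ := fun z => ((Real.exp (-(M * (z.1 + z.2))) : ℝ) : ℂ) * ∑' p, m p z with hF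
  have hHS : ∀ ε : ℝ, 0 < ε → HasSum (fun p => ∫ z in Set.Ioi ε ×ˢ Set.Ioi ε,
      ((Real.exp (-(M * (z.1 + z.2))) : ℝ) : ℂ) * m p z) (∫ z in Set.Ioi ε ×ˢ Set.Ioi ε, F z) := by
    intro ε hε
    obtain ⟨u, hu, hmu⟩ := hsum ε hε
    have hexp : IntegrableOn (fun z : ℝ × ℝ => Real.exp (-(M * (z.1 + z.2))))
        (Set.Ioi ε ×ˢ Set.Ioi ε) := by
      have h := hprod (f := fun s => Real.exp (-(M * s))) (ε := ε)
        (by simpa only [neg_mul] using exp_neg_integrableOn_Ioi ε hM)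
      refine h.congr_fun (fun z _ => ?_) (measurableSet_Ioi.prod measurableSet_Ioi)
      simp only
      rw [← Real.exp_add]
      ring_nf
    have hb : ∀ p, ∀ᵐ z ∂((volume : Measure (ℝ × ℝ)).restrict (Set.Ioi ε ×ˢ Set.Ioi ε)),
        ‖((Real.exp (-(M * (z.1 + z.2))) : ℝ) : ℂ) * m p z‖ ≤
          u p * Real.exp (-(M * (z.1 + z.2))) := by
      intro p
      filter_upwards [ae_restrict_mem (measurableSet_Ioi.prod measurableSet_Ioi)] with z hz
      rw [norm_mul, Complex.norm_real, Real.norm_of_nonneg (Real.exp_pos _).le, mul_comm]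
      exact mul_le_mul_of_nonneg_right (hmu p z.1 z.2 hz.1 hz.2) (Real.exp_pos _).le
    have hi : ∀ p, Integrable (fun z => ((Real.exp (-(M * (z.1 + z.2))) : ℝ) : ℂ) * m p z)
        ((volume : Measure (ℝ × ℝ)).restrict (Set.Ioi ε ×ˢ Set.Ioi ε)) := fun p =>
      (hexp.integrable.const_mul (u p)).mono' (hmE.mul (hm p)).aestronglyMeasurable (hb p)
    have h := hasSum_integral_of_summable_integral_norm hi (Summable.of_nonneg_of_le
      (fun p => integral_nonneg fun z => norm_nonneg _)
      (fun p => integral_mono_ae (hi p).norm (hexp.integrable.const_mul (u p)) (hb p))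
      (by simp only [integral_const_mul]; exact hu.mul_right _))
    simpa only [tsum_mul_left] using h
  refine ⟨fun ε hε => (hHS ε hε).summable, ?_⟩
  -- up to `Q * logKernel`, the summed integrand is integrable down to the origin
  set μ := (volume : Measure (ℝ × ℝ)).restrict (Set.Ioi 0 ×ˢ Set.Ioi 0) with hμ
  have hFm : AEStronglyMeasurable F μ := by
    refine hmE.aestronglyMeasurable.mul ?_
    refine aestronglyMeasurable_of_tendsto_ae (u := (atTop : Filter (Finset ι)))
      (f := fun S z => ∑ p ∈ S, m p z)
      (fun S => (Finset.measurable_fun_sum S fun p _ => hm p).aestronglyMeasurable) ?_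
    filter_upwards [ae_restrict_mem (measurableSet_Ioi.prod measurableSet_Ioi)] with z hz
    have h1 : (0 : ℝ) < z.1 := hz.1
    have h2 : (0 : ℝ) < z.2 := hz.2
    obtain ⟨u, hu, hmu⟩ := hsum (min z.1 z.2 / 2) (half_pos (lt_min h1 h2))
    refine (Summable.of_norm_bounded hu fun p => hmu p z.1 z.2 ?_ ?_).hasSum
    · exact (half_lt_self (lt_min h1 h2)).trans_le (min_le_left _ _)
    · exact (half_lt_self (lt_min h1 h2)).trans_le (min_le_right _ _)
  have hD : Integrable (fun z => F z - Q * (logKernel z : ℂ)) μ := by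
    refine ((hprod (integrableOn_exp_mul_singularWeight hM)).integrable.const_mul
      (C + ‖Q‖ * (M * Real.exp (2 * M) + 1))).mono' (hFm.sub
      ((Complex.measurable_ofReal.comp measurable_logKernel).const_mul Q).aestronglyMeasurable) ?_
    filter_upwards [ae_restrict_mem (measurableSet_Ioi.prod measurableSet_Ioi)] with z hz
    obtain ⟨s, t⟩ := z
    have hs : (0 : ℝ) < s := hz.1
    have ht : (0 : ℝ) < t := hz.2
    set E := Real.exp (-(M * (s + t))) with hE
    have hE0 : 0 < E := Real.exp_pos _
    have e1 : F (s, t) - Q * (logKernel (s, t) : ℂ) =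
        (E : ℂ) * (∑' p, m p (s, t) - Q * (((s + t) ^ 2)⁻¹ : ℝ)) +
        Q * ((E * ((s + t) ^ 2)⁻¹ - logKernel (s, t) : ℝ) : ℂ) := by
      simp only [hF, ← hE]
      push_cast
      ring
    have e2 : Real.exp (-(M * s)) * singularWeight s * (Real.exp (-(M * t)) * singularWeight t) =
        E * (singularWeight s * singularWeight t) := by
      rw [hE, show -(M * (s + t)) = -(M * s) + -(M * t) by ring, Real.exp_add]
      ring
    rw [e1]
    simp only [e2]
    refine (norm_add_le _ _).trans ?_
    rw [norm_mul, norm_mul, Complex.norm_real, Complex.norm_real, Real.norm_of_nonneg hE0.le,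
      Real.norm_eq_abs, add_mul]
    have h1 := mul_le_mul_of_nonneg_left (hlead s t hs ht) hE0.le
    have h2 := mul_le_mul_of_nonneg_left (abs_exp_mul_sub_logKernel_le hM hs ht) (norm_nonneg Q)
    rw [← hE] at h2
    refine add_le_add (h1.trans (le_of_eq (by ring))) (h2.trans (le_of_eq (by ring)))
  -- the integrals over the truncated domains converge to the full one
  have hlim := aecover_Ioi_prod.integral_tendsto_of_countably_generated hD
  have hlog : Tendsto (fun ε : ℝ => Q * ((2 * Real.log (1 + ε) - 2 * Real.log 2 : ℝ) : ℂ))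
      (𝓝[>] 0) (𝓝 (Q * ((2 * Real.log (1 + 0) - 2 * Real.log 2 : ℝ) : ℂ))) := by
    refine Tendsto.const_mul Q ((Complex.continuous_ofReal.tendsto _).comp ?_)
    refine Tendsto.sub_const (Tendsto.const_mul 2 (tendsto_nhdsWithin_of_tendsto_nhds ?_)) _
    exact ((continuous_const.add continuous_id).tendsto 0).log (by norm_num)
  refine ⟨_, (hlim.add hlog).congr' ?_⟩
  filter_upwards [self_mem_nhdsWithin, nhdsWithin_le_nhds (Iio_mem_nhds (zero_lt_one' ℝ))]
    with ε hε hε1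
  have hε0 : (0 : ℝ) < ε := hε
  have hsub : Set.Ioi ε ×ˢ Set.Ioi ε ⊆ Set.Ioi (0 : ℝ) ×ˢ Set.Ioi (0 : ℝ) :=
    Set.prod_mono (Set.Ioi_subset_Ioi hε0.le) (Set.Ioi_subset_Ioi hε0.le)
  rw [(hHS ε hε0).tsum_eq, Measure.restrict_restrict (measurableSet_Ioi.prod measurableSet_Ioi),
    Set.inter_eq_left.2 hsub]
  have hDε : IntegrableOn (fun z => F z - Q * (logKernel z : ℂ)) (Set.Ioi ε ×ˢ Set.Ioi ε) :=
    IntegrableOn.mono_set hD hsub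
  have hKε : IntegrableOn (fun z => Q * (logKernel z : ℂ)) (Set.Ioi ε ×ˢ Set.Ioi ε) :=
    (integrableOn_logKernel hε0).integrable.ofReal.const_mul Q
  have hFε : ∫ z in Set.Ioi ε ×ˢ Set.Ioi ε, F z =
      (∫ z in Set.Ioi ε ×ˢ Set.Ioi ε, (F z - Q * (logKernel z : ℂ))) +
        ∫ z in Set.Ioi ε ×ˢ Set.Ioi ε, Q * (logKernel z : ℂ) := by
    rw [← integral_add hDε hKε]
    simp
  rw [hFε, integral_const_mul, integral_complex_ofReal, setIntegral_logKernel hε0 hε1]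
  push_cast
  ring

/-! ### The trace around the bubble -/

/-- The multiplier in `T_{-v₁} R_r T_{v₂} R_s φ (z) = loopWeight z * φ (loopPoint z)`, where `R_r`
is the dilation by `r`. -/
noncomputable def loopWeight (θ : ℝ) (v₁ v₂ : C2) (r : ℝ) (z : C2) : ℂ :=
  Complex.exp (-((freq θ / 2 * (sqNorm v₁ + sqNorm v₂) : ℝ) : ℂ) + (freq θ : ℂ) * r * herm v₂ v₁ +
    (freq θ : ℂ) * herm (v₁ - (r : ℂ) • v₂) z)

/-- The point in `T_{-v₁} R_r T_{v₂} R_s φ (z) = loopWeight z * φ (loopPoint z)`. -/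
noncomputable def loopPoint (v₁ v₂ : C2) (r s : ℝ) (z : C2) : C2 :=
  ((r * s : ℝ) : ℂ) • z + (s : ℂ) • (v₂ - (r : ℂ) • v₁)

lemma herm_smul_left (t : ℝ) (v z : C2) : herm ((t : ℂ) • v) z = t * herm v z := by
  simp [herm, mul_add]
  ring

lemma bubbleLoop_apply (θ μ₀ ε : ℝ) (γ₁ γ₂ : Mode) (φ : C2 → ℂ) (z : C2) :
    bubbleLoop θ μ₀ ε γ₁ γ₂ φ z = ∫ s in Set.Ioi ε, ∫ t in Set.Ioi ε,
      ((Real.exp (-((2 * freq θ + μ₀ ^ 2) * (s + t))) : ℝ) : ℂ) *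
        (loopWeight θ (latticePoint θ γ₁) (latticePoint θ γ₂) (Real.exp (-(2 * freq θ * s))) z *
          φ (loopPoint (latticePoint θ γ₁) (latticePoint θ γ₂) (Real.exp (-(2 * freq θ * s)))
            (Real.exp (-(2 * freq θ * t))) z)) := by
  unfold bubbleLoop U
  rw [latticePoint_neg]
  set v₁ := latticePoint θ γ₁
  set v₂ := latticePoint θ γ₂
  simp only [translation, propagator, heat]
  rw [← integral_const_mul]
  congr 1
  ext s
  rw [← mul_assoc, ← mul_assoc, ← integral_const_mul]
  congr 1
  ext t
  set r := Real.exp (-(2 * freq θ * s))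
  set r' := Real.exp (-(2 * freq θ * t))
  have hp : (r' : ℂ) • ((r : ℂ) • (z + -v₁) + v₂) = loopPoint v₁ v₂ r r' z := by
    ext i
    simp [loopPoint]
    ring
  have hE : Real.exp (-((2 * freq θ + μ₀ ^ 2) * (s + t))) =
      Real.exp (-(s * (2 * freq θ + μ₀ ^ 2))) * Real.exp (-(t * (2 * freq θ + μ₀ ^ 2))) := by
    rw [← Real.exp_add]
    ring_nf
  have hW : loopWeight θ v₁ v₂ r z =
      Complex.exp (-((freq θ * sqNorm (-v₁) / 2 : ℝ) : ℂ) - (freq θ : ℂ) * herm (-v₁) z) *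
      Complex.exp (-((freq θ * sqNorm v₂ / 2 : ℝ) : ℂ) -
        (freq θ : ℂ) * herm v₂ ((r : ℂ) • (z + -v₁))) := by
    unfold loopWeight
    rw [← Complex.exp_add]
    congr 1
    rw [sqNorm_neg, herm_neg_left, herm_smul_right, herm_add_right, herm_neg_right, herm_sub_left,
      herm_smul_left]
    push_cast
    ring
  rw [hp, hE, hW]
  push_cast
  ring

/-- The reproducing kernel of the Bargmann space as a sum over the orthonormal basis. -/
lemma hasSum_monomialBasis {θ : ℝ} (hθ : 0 < θ) (z w : C2) :
    HasSum (fun n : Fin 2 → ℕ => conj (monomialBasis θ n z) * monomialBasis θ n w)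
      (Complex.exp ((freq θ : ℂ) * herm z w)) := by
  have hω := freq_pos hθ
  have h : ∀ i, HasSum (fun n : ℕ => ((freq θ : ℂ) * (conj (z i) * w i)) ^ n / (n.factorial : ℂ))
      (Complex.exp ((freq θ : ℂ) * (conj (z i) * w i))) := fun i => by
    rw [Complex.exp_eq_exp_ℂ]
    exact NormedSpace.expSeries_div_hasSum_exp _
  have h2 := hasSum_fin_two_mul (h 0) (h 1)
  rw [← Complex.exp_add] at h2
  have hsq : ∀ k : ℕ, ((√(freq θ ^ k / k.factorial) : ℝ) : ℂ) *
      ((√(freq θ ^ k / k.factorial) : ℝ) : ℂ) = (freq θ : ℂ) ^ k / (k.factorial : ℂ) := fun k => by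
    rw [← Complex.ofReal_mul, Real.mul_self_sqrt (by positivity)]
    push_cast
    ring
  have hterm : ∀ n : Fin 2 → ℕ, conj (monomialBasis θ n z) * monomialBasis θ n w =
      ((freq θ : ℂ) * (conj (z 0) * w 0)) ^ n 0 / ((n 0).factorial : ℂ) *
        (((freq θ : ℂ) * (conj (z 1) * w 1)) ^ n 1 / ((n 1).factorial : ℂ)) := fun n => by
    simp only [monomialBasis, Fin.prod_univ_two, map_mul, map_pow, Complex.conj_ofReal]
    have e0 := hsq (n 0)
    have e1 := hsq (n 1)
    rw [mul_pow, mul_pow, mul_pow, mul_pow, mul_div_right_comm, mul_div_right_comm, ← e0, ← e1]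
    ring
  have hsum : (freq θ : ℂ) * herm z w =
      (freq θ : ℂ) * (conj (z 0) * w 0) + (freq θ : ℂ) * (conj (z 1) * w 1) := by
    simp only [herm, Fin.sum_univ_two]
    ring
  simpa only [hterm, hsum] using h2

lemma norm_monomialBasis {θ : ℝ} (n : Fin 2 → ℕ) (z : C2) :
    (‖monomialBasis θ n z‖ : ℂ) = monomialBasis θ n fun i => (‖z i‖ : ℂ) := by
  simp only [monomialBasis, Fin.prod_univ_two, norm_mul, norm_pow, Complex.norm_real,
    Real.norm_of_nonneg (Real.sqrt_nonneg _)]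
  push_cast
  ring

/-- The moduli of the basis functions are their values at the moduli of the coordinates, so the
reproducing kernel also sums them. -/
lemma hasSum_norm_monomialBasis {θ : ℝ} (hθ : 0 < θ) (z w : C2) :
    HasSum (fun n : Fin 2 → ℕ => ‖monomialBasis θ n z‖ * ‖monomialBasis θ n w‖)
      (Real.exp (freq θ * ∑ i, ‖z i‖ * ‖w i‖)) := by
  rw [← Complex.hasSum_ofReal]
  have h := hasSum_monomialBasis hθ (fun i => (‖z i‖ : ℂ)) (fun i => (‖w i‖ : ℂ))
  simp only [← norm_monomialBasis, Complex.conj_ofReal] at h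
  convert h using 1
  · ext n
    push_cast
    rfl
  · simp [herm]

lemma continuous_monomialBasis (θ : ℝ) (n : Fin 2 → ℕ) : Continuous (monomialBasis θ n) := by
  unfold monomialBasis
  fun_prop

/-- The Gaussian integral over `ℂ` with independent sources for `z` and its conjugate. -/
lemma integral_gaussian_complex {A : ℝ} (hA : 0 < A) (b d : ℂ) :
    ∫ z : ℂ, Complex.exp (-((A * Complex.normSq z : ℝ) : ℂ) + b * z + d * conj z) =
      (Real.pi / A : ℂ) * Complex.exp (b * d / A) := by
  have h1 : ∀ c : ℂ, ∫ x : ℝ, Complex.exp (-(A : ℂ) * x ^ 2 + c * x + 0) =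
      (Real.pi / -(-(A : ℂ))) ^ (1 / 2 : ℂ) * Complex.exp (0 - c ^ 2 / (4 * -(A : ℂ))) := fun c =>
    integral_cexp_quadratic (by simpa using hA) c 0
  rw [← Complex.volume_preserving_equiv_real_prod.symm.integral_comp
    Complex.measurableEquivRealProd.symm.measurableEmbedding]
  have e : ∀ p : ℝ × ℝ, Complex.exp (-((A * Complex.normSq
      (Complex.measurableEquivRealProd.symm p) : ℝ) : ℂ) +
      b * Complex.measurableEquivRealProd.symm p +
      d * conj (Complex.measurableEquivRealProd.symm p)) =
      Complex.exp (-(A : ℂ) * p.1 ^ 2 + (b + d) * p.1 + 0) *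
        Complex.exp (-(A : ℂ) * p.2 ^ 2 + ((b - d) * Complex.I) * p.2 + 0) := by
    intro p
    have hz : Complex.measurableEquivRealProd.symm p = (p.1 : ℂ) + (p.2 : ℂ) * Complex.I := by
      apply Complex.ext <;> simp [Complex.measurableEquivRealProd_symm_apply]
    rw [← Complex.exp_add, hz]
    congr 1
    simp only [map_add, map_mul, Complex.conj_ofReal, Complex.conj_I, Complex.normSq_add_mul_I]
    push_cast
    ring
  simp only [e]
  rw [Measure.volume_eq_prod, integral_prod_mul (fun x : ℝ => Complex.exp
    (-(A : ℂ) * x ^ 2 + (b + d) * x + 0)) (fun x : ℝ => Complex.exp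
    (-(A : ℂ) * x ^ 2 + ((b - d) * Complex.I) * x + 0)), h1, h1, mul_mul_mul_comm,
    ← Complex.exp_add, neg_neg]
  have hA' : (A : ℂ) ≠ 0 := by exact_mod_cast hA.ne'
  have hpa : (Real.pi / A : ℂ) ≠ 0 := div_ne_zero (by exact_mod_cast Real.pi_ne_zero) hA'
  congr 1
  · rw [← Complex.cpow_add _ _ hpa]
    norm_num
  · congr 1
    have hI : Complex.I ^ 2 = -1 := Complex.I_sq
    field_simp
    linear_combination ((b - d) ^ 2) * hI

lemma integral_gaussian_C2 {A : ℝ} (hA : 0 < A) (b d : Fin 2 → ℂ) :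
    ∫ z : C2, Complex.exp (∑ i, (-((A * Complex.normSq (z i) : ℝ) : ℂ) + b i * z i +
      d i * conj (z i))) = (Real.pi / A : ℂ) ^ 2 * Complex.exp ((∑ i, b i * d i) / A) := by
  simp only [Complex.exp_sum]
  rw [integral_fintype_prod_volume_eq_prod (fun i (z : ℂ) =>
    Complex.exp (-((A * Complex.normSq z : ℝ) : ℂ) + b i * z + d i * conj z))]
  rw [Fin.prod_univ_two, integral_gaussian_complex hA, integral_gaussian_complex hA,
    Fin.sum_univ_two, add_div, Complex.exp_add]
  ring

/-- The trace of `T_{-v₁} R_r T_{v₂} R_s`, where `R_r` is the dilation by `r`. -/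
noncomputable def loopTrace (θ : ℝ) (v₁ v₂ : C2) (r s : ℝ) : ℂ :=
  ((((1 - r * s) ^ 2)⁻¹ : ℝ) : ℂ) * Complex.exp (-((freq θ / 2 * (sqNorm v₁ + sqNorm v₂) : ℝ) : ℂ) +
    (freq θ : ℂ) * r * herm v₂ v₁ +
    (freq θ : ℂ) * s * herm (v₁ - (r : ℂ) • v₂) (v₂ - (r : ℂ) • v₁) / ((1 - r * s : ℝ) : ℂ))

/-- The trace as the integral of the operator kernel over the diagonal. -/
lemma integral_loop_eq_loopTrace {θ : ℝ} (hθ : 0 < θ) (v₁ v₂ : C2) {r s : ℝ} (hrs : r * s < 1) :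
    ∫ z : C2, (((freq θ / Real.pi) ^ 2 * Real.exp (-(freq θ * sqNorm z)) : ℝ) : ℂ) *
      (loopWeight θ v₁ v₂ r z * Complex.exp ((freq θ : ℂ) * herm z (loopPoint v₁ v₂ r s z))) =
      loopTrace θ v₁ v₂ r s := by
  have hω := freq_pos hθ
  have hq : 0 < 1 - r * s := by linarith
  have hA : 0 < freq θ * (1 - r * s) := by positivity
  have e : ∀ z : C2, (((freq θ / Real.pi) ^ 2 * Real.exp (-(freq θ * sqNorm z)) : ℝ) : ℂ) *
      (loopWeight θ v₁ v₂ r z * Complex.exp ((freq θ : ℂ) * herm z (loopPoint v₁ v₂ r s z))) =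
      (((freq θ / Real.pi) ^ 2 : ℝ) : ℂ) * Complex.exp
        (-((freq θ / 2 * (sqNorm v₁ + sqNorm v₂) : ℝ) : ℂ) + (freq θ : ℂ) * r * herm v₂ v₁) *
      Complex.exp (∑ i, (-((freq θ * (1 - r * s) * Complex.normSq (z i) : ℝ) : ℂ) +
        ((freq θ : ℂ) * conj ((v₁ - (r : ℂ) • v₂) i)) * z i +
        ((freq θ : ℂ) * s * (v₂ - (r : ℂ) • v₁) i) * conj (z i))) := by
    intro z
    unfold loopWeight
    rw [Complex.ofReal_mul, Complex.ofReal_exp]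
    simp only [mul_assoc, ← Complex.exp_add]
    congr 2
    rw [loopPoint, herm_add_right, herm_smul_right, herm_smul_right, herm_self]
    simp only [herm, sqNorm, Fin.sum_univ_two]
    push_cast
    ring
  simp only [e]
  rw [integral_const_mul, integral_gaussian_C2 hA, loopTrace]
  have hω' : (freq θ : ℂ) ≠ 0 := by exact_mod_cast hω.ne'
  have hπ : (Real.pi : ℂ) ≠ 0 := by exact_mod_cast Real.pi_ne_zero
  have hq' : (1 - (r : ℂ) * s) ≠ 0 := by exact_mod_cast hq.ne'
  rw [mul_mul_mul_comm, ← Complex.exp_add]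
  congr 1
  · push_cast
    field_simp
  · congr 2
    simp only [herm, Fin.sum_univ_two]
    push_cast
    field_simp

/-- The integrand of the trace, with the reproducing kernel replaced by the sum of the moduli of its
terms, is integrable uniformly in the dilations by at most `ρ < 1`. -/
lemma exists_loop_bound {θ : ℝ} (hθ : 0 < θ) (v₁ v₂ : C2) {ρ : ℝ} (hρ1 : ρ < 1) :
    ∃ C, ∀ (r s : ℝ) (z : C2), 0 ≤ r → r ≤ ρ → 0 ≤ s → s ≤ ρ →
      (freq θ / Real.pi) ^ 2 * Real.exp (-(freq θ * sqNorm z)) * ‖loopWeight θ v₁ v₂ r z‖ *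
        Real.exp (freq θ * ∑ i, ‖z i‖ * ‖loopPoint v₁ v₂ r s z i‖) ≤ C * (bracket z ^ 4)⁻¹ := by
  have hω := freq_pos hθ
  set V := ∑ i, (‖v₁ i‖ + ‖v₂ i‖) with hV
  have hV0 : 0 ≤ V := Finset.sum_nonneg fun i _ => by positivity
  have hVi : ∀ i, ‖v₁ i‖ + ‖v₂ i‖ ≤ V := fun i =>
    Finset.single_le_sum (f := fun i => ‖v₁ i‖ + ‖v₂ i‖) (fun i _ => by positivity)
      (Finset.mem_univ i)
  set δ := (1 - ρ) / 2 with hδ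
  have hδ0 : 0 < δ := by rw [hδ]; linarith
  obtain ⟨C, hC0, hC⟩ := exists_one_add_pow_mul_exp_neg_le 4 (mul_pos hω hδ0)
  refine ⟨(freq θ / Real.pi) ^ 2 * Real.exp (freq θ * ‖herm v₂ v₁‖ + 2 * (freq θ * (V ^ 2 / δ))) *
    C, fun r s z hr0 hr hs0 hs => ?_⟩
  have hr1 : r ≤ 1 := hr.trans hρ1.le
  have hs1 : s ≤ 1 := hs.trans hρ1.le
  have hsub : ∀ (a b : C2) i, ‖(a - (r : ℂ) • b) i‖ ≤ ‖a i‖ + ‖b i‖ := fun a b i => by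
    refine (norm_sub_le _ _).trans (add_le_add le_rfl ?_)
    simp only [Pi.smul_apply, smul_eq_mul, norm_mul, Complex.norm_real, Real.norm_of_nonneg hr0]
    exact mul_le_of_le_one_left (norm_nonneg _) hr1
  have hw : ∀ i, ‖loopPoint v₁ v₂ r s z i‖ ≤ ρ * ‖z i‖ + V := fun i => by
    refine (norm_add_le _ _).trans (add_le_add ?_ ?_)
    · simp only [Pi.smul_apply, smul_eq_mul, norm_mul, Complex.norm_real,
        Real.norm_of_nonneg (mul_nonneg hr0 hs0)]
      refine mul_le_mul_of_nonneg_right ?_ (norm_nonneg _)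
      exact (mul_le_of_le_one_left hs0 hr1).trans hs
    · simp only [Pi.smul_apply, smul_eq_mul, norm_mul, Complex.norm_real,
        Real.norm_of_nonneg hs0]
      refine (mul_le_of_le_one_left (norm_nonneg _) hs1).trans ((hsub _ _ i).trans ?_)
      linarith [hVi i]
  have hh : (herm (v₁ - (r : ℂ) • v₂) z).re ≤ ∑ i, V * ‖z i‖ := by
    refine (Complex.re_le_norm _).trans ((norm_sum_le _ _).trans
      (Finset.sum_le_sum fun i _ => ?_))
    rw [norm_mul, RCLike.norm_conj]
    exact mul_le_mul_of_nonneg_right ((hsub _ _ i).trans (hVi i)) (norm_nonneg _)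
  have hh2 : r * (herm v₂ v₁).re ≤ ‖herm v₂ v₁‖ := by
    have h1 := Complex.abs_re_le_norm (herm v₂ v₁)
    have h2 : r * (herm v₂ v₁).re ≤ r * |(herm v₂ v₁).re| :=
      mul_le_mul_of_nonneg_left (le_abs_self _) hr0
    exact h2.trans ((mul_le_of_le_one_left (abs_nonneg _) hr1).trans h1)
  have hK : ‖loopWeight θ v₁ v₂ r z‖ ≤
      Real.exp (freq θ * ‖herm v₂ v₁‖ + freq θ * ∑ i, V * ‖z i‖) := by
    unfold loopWeight
    rw [Complex.norm_exp]
    apply Real.exp_le_exp.2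
    have e : (-((freq θ / 2 * (sqNorm v₁ + sqNorm v₂) : ℝ) : ℂ) + (freq θ : ℂ) * r * herm v₂ v₁ +
        (freq θ : ℂ) * herm (v₁ - (r : ℂ) • v₂) z).re = -(freq θ / 2 * (sqNorm v₁ + sqNorm v₂)) +
        freq θ * (r * (herm v₂ v₁).re) + freq θ * (herm (v₁ - (r : ℂ) • v₂) z).re := by
      rw [Complex.add_re, Complex.add_re, Complex.neg_re, Complex.ofReal_re, mul_assoc,
        Complex.re_ofReal_mul, Complex.re_ofReal_mul, Complex.re_ofReal_mul]
    rw [e]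
    have h1 := mul_le_mul_of_nonneg_left hh hω.le
    have h2 := mul_le_mul_of_nonneg_left hh2 hω.le
    have h3 : 0 ≤ freq θ / 2 * (sqNorm v₁ + sqNorm v₂) := by
      have := sqNorm_nonneg v₁
      have := sqNorm_nonneg v₂
      positivity
    linarith
  -- completing the square absorbs the terms linear in `‖z i‖` into half of the Gaussian
  have hexp : -(freq θ * sqNorm z) + (freq θ * ‖herm v₂ v₁‖ + freq θ * ∑ i, V * ‖z i‖) +
      freq θ * ∑ i, ‖z i‖ * ‖loopPoint v₁ v₂ r s z i‖ ≤
      (freq θ * ‖herm v₂ v₁‖ + 2 * (freq θ * (V ^ 2 / δ))) + -(freq θ * δ * sqNorm z) := by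
    have h1 : ∀ i, V * ‖z i‖ + ‖z i‖ * ‖loopPoint v₁ v₂ r s z i‖ ≤
        V ^ 2 / δ + (1 - δ) * ‖z i‖ ^ 2 := fun i => by
      have h2 := mul_le_mul_of_nonneg_left (hw i) (norm_nonneg (z i))
      have h3 : 0 ≤ (V - δ * ‖z i‖) ^ 2 / δ := by positivity
      have h4 : (V - δ * ‖z i‖) ^ 2 / δ = V ^ 2 / δ - 2 * V * ‖z i‖ + δ * ‖z i‖ ^ 2 := by
        field_simp
        ring
      have h5 : ρ = 1 - 2 * δ := by rw [hδ]; ring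
      rw [h5] at h2
      nlinarith
    have h6 := mul_le_mul_of_nonneg_left (add_le_add (h1 0) (h1 1)) hω.le
    simp only [sqNorm, Fin.sum_univ_two, Complex.normSq_eq_norm_sq]
    nlinarith
  have hJ := hC (sqNorm z) (sqNorm_nonneg z)
  have hz := bracket_pos z
  rw [← div_eq_mul_inv, le_div_iff₀ (by positivity)]
  calc (freq θ / Real.pi) ^ 2 * Real.exp (-(freq θ * sqNorm z)) * ‖loopWeight θ v₁ v₂ r z‖ *
        Real.exp (freq θ * ∑ i, ‖z i‖ * ‖loopPoint v₁ v₂ r s z i‖) * bracket z ^ 4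
      ≤ (freq θ / Real.pi) ^ 2 * Real.exp (-(freq θ * sqNorm z)) *
        Real.exp (freq θ * ‖herm v₂ v₁‖ + freq θ * ∑ i, V * ‖z i‖) *
        Real.exp (freq θ * ∑ i, ‖z i‖ * ‖loopPoint v₁ v₂ r s z i‖) * bracket z ^ 4 := by gcongr
    _ = (freq θ / Real.pi) ^ 2 * Real.exp (-(freq θ * sqNorm z) +
        (freq θ * ‖herm v₂ v₁‖ + freq θ * ∑ i, V * ‖z i‖) +
        freq θ * ∑ i, ‖z i‖ * ‖loopPoint v₁ v₂ r s z i‖) * bracket z ^ 4 := by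
        simp only [Real.exp_add]; ring
    _ ≤ (freq θ / Real.pi) ^ 2 * Real.exp ((freq θ * ‖herm v₂ v₁‖ + 2 * (freq θ * (V ^ 2 / δ))) +
        -(freq θ * δ * sqNorm z)) * bracket z ^ 4 := by gcongr
    _ = (freq θ / Real.pi) ^ 2 * Real.exp (freq θ * ‖herm v₂ v₁‖ + 2 * (freq θ * (V ^ 2 / δ))) *
        (bracket z ^ 4 * Real.exp (-(freq θ * δ * sqNorm z))) := by
        rw [Real.exp_add]; ring
    _ ≤ _ := by
        refine mul_le_mul_of_nonneg_left ?_ (by positivity)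
        exact hJ

/-- The operator trace around the bubble converges absolutely, and equals the proper time integral
of `loopTrace`. -/
lemma hasSum_bubbleLoop {θ : ℝ} (hθ : 0 < θ) (μ₀ : ℝ) {ε : ℝ} (hε : 0 < ε) (γ₁ γ₂ : Mode) :
    HasSum (fun n => bargmannInner θ (monomialBasis θ n)
        (bubbleLoop θ μ₀ ε γ₁ γ₂ (monomialBasis θ n)))
      (∫ p in Set.Ioi ε ×ˢ Set.Ioi ε,
        ((Real.exp (-((2 * freq θ + μ₀ ^ 2) * (p.1 + p.2))) : ℝ) : ℂ) *
          loopTrace θ (latticePoint θ γ₁) (latticePoint θ γ₂) (Real.exp (-(2 * freq θ * p.1)))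
            (Real.exp (-(2 * freq θ * p.2)))) := by
  have hω := freq_pos hθ
  have hM : 0 < 2 * freq θ + μ₀ ^ 2 := by positivity
  set M := 2 * freq θ + μ₀ ^ 2 with hMdef
  set v₁ := latticePoint θ γ₁
  set v₂ := latticePoint θ γ₂
  set R : ℝ → ℝ := fun s => Real.exp (-(2 * freq θ * s)) with hR
  have hRlt : ∀ {s : ℝ}, 0 < s → R s < 1 := fun {s} hs => by
    simp only [hR]
    rw [Real.exp_lt_one_iff]
    have : 0 < 2 * freq θ * s := by positivity
    linarith
  have hRle : ∀ {s : ℝ}, ε < s → R s ≤ R ε := fun {s} hs => by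
    simp only [hR]
    apply Real.exp_le_exp.2
    nlinarith
  have hR0 : ∀ s, 0 ≤ R s := fun s => (Real.exp_pos _).le
  obtain ⟨C, hC⟩ := exists_loop_bound hθ v₁ v₂ (hRlt hε)
  set ν := (volume : Measure (ℝ × ℝ)).restrict (Set.Ioi ε ×ˢ Set.Ioi ε) with hν
  have hνprod : ν = (volume.restrict (Set.Ioi ε)).prod (volume.restrict (Set.Ioi ε)) := by
    rw [hν, Measure.volume_eq_prod, Measure.prod_restrict]
  set w : (ℝ × ℝ) × C2 → ℂ := fun x => ((Real.exp (-(M * (x.1.1 + x.1.2))) : ℝ) : ℂ) *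
    ((((freq θ / Real.pi) ^ 2 * Real.exp (-(freq θ * sqNorm x.2)) : ℝ) : ℂ) *
      loopWeight θ v₁ v₂ (R x.1.1) x.2) with hw
  set y : (ℝ × ℝ) × C2 → C2 := fun x => loopPoint v₁ v₂ (R x.1.1) (R x.1.2) x.2 with hy
  have hwc : Continuous w := by
    have c1 := continuous_sqNorm
    have c3 : ∀ a : C2, Continuous fun z => herm a z := fun a =>
      continuous_herm.comp (Continuous.prodMk_right a)
    have c4 := c3 v₁
    have c5 := c3 v₂
    simp only [hw, hR, loopWeight, herm_sub_left, herm_smul_left]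
    fun_prop
  have hyc : Continuous y := by
    simp only [hy, hR, loopPoint]
    fun_prop
  -- `F n`, integrated over proper times and phase space, is the `n`th diagonal matrix element
  set F : (Fin 2 → ℕ) → (ℝ × ℝ) × C2 → ℂ := fun n x =>
    w x * (conj (monomialBasis θ n x.2) * monomialBasis θ n (y x)) with hF
  have hFc : ∀ n, Continuous (F n) := fun n => by
    have c1 := continuous_monomialBasis θ n
    have c2 : Continuous fun z => conj (monomialBasis θ n z) := Complex.continuous_conj.comp c1
    simp only [hF]
    fun_prop
  have hae : ∀ᵐ x ∂(ν.prod (volume : Measure C2)), x.1 ∈ Set.Ioi ε ×ˢ Set.Ioi ε :=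
    Measure.quasiMeasurePreserving_fst.ae
      (ae_restrict_mem (measurableSet_Ioi.prod measurableSet_Ioi))
  have hnF : ∀ n x, ‖F n x‖ = ‖w x‖ * (‖monomialBasis θ n x.2‖ * ‖monomialBasis θ n (y x)‖) :=
    fun n x => by simp only [hF, norm_mul, RCLike.norm_conj]
  have hsumF : ∀ x, HasSum (fun n => ‖F n x‖)
      (‖w x‖ * Real.exp (freq θ * ∑ i, ‖x.2 i‖ * ‖y x i‖)) := fun x => by
    simp only [hnF]
    exact (hasSum_norm_monomialBasis hθ x.2 (y x)).mul_left _
  have hexp : Integrable (fun p : ℝ × ℝ => Real.exp (-(M * (p.1 + p.2)))) ν := by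
    have h1 : IntegrableOn (fun s => Real.exp (-(M * s))) (Set.Ioi ε) := by
      simpa only [neg_mul] using exp_neg_integrableOn_Ioi ε hM
    rw [hνprod]
    refine (h1.integrable.mul_prod h1.integrable).congr (ae_of_all _ fun p => ?_)
    simp only
    rw [← Real.exp_add]
    ring_nf
  have hdom : Integrable (fun x => ∑' n, ‖F n x‖) (ν.prod (volume : Measure C2)) := by
    simp only [(hsumF _).tsum_eq]
    refine (hexp.mul_prod (integrable_inv_bracket_pow.const_mul C)).mono'
      (Continuous.aestronglyMeasurable ?_) ?_
    · fun_prop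
    · filter_upwards [hae] with x hx
      have h1 : ε < x.1.1 := hx.1
      have h2 : ε < x.1.2 := hx.2
      rw [Real.norm_of_nonneg (by positivity)]
      simp only [hw, norm_mul, Complex.norm_real, Real.norm_of_nonneg (Real.exp_pos _).le,
        Real.norm_of_nonneg (sq_nonneg (freq θ / Real.pi)), Complex.ofReal_mul]
      rw [mul_assoc]
      refine mul_le_mul_of_nonneg_left ?_ (Real.exp_pos _).le
      exact hC _ _ x.2 (hR0 _) (hRle h1) (hR0 _) (hRle h2)
  have hFi : ∀ n, Integrable (F n) (ν.prod (volume : Measure C2)) := fun n =>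
    hdom.mono' (hFc n).aestronglyMeasurable (ae_of_all _ fun x =>
      (hsumF x).summable.le_tsum n fun _ _ => norm_nonneg _)
  -- the sum over `n` produces the reproducing kernel
  set f : (ℝ × ℝ) × C2 → ℂ := fun x => w x * Complex.exp ((freq θ : ℂ) * herm x.2 (y x)) with hf
  have hfsum : ∀ x, HasSum (fun n => F n x) (f x) := fun x =>
    (hasSum_monomialBasis hθ x.2 (y x)).mul_left (w x)
  have hfi : Integrable f (ν.prod (volume : Measure C2)) := by
    have c : Continuous fun x => herm x.2 (y x) :=
      continuous_herm.comp (continuous_snd.prodMk hyc)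
    refine hdom.mono' (Continuous.aestronglyMeasurable (by simp only [hf]; fun_prop))
      (ae_of_all _ fun x => ?_)
    rw [← (hfsum x).tsum_eq]
    exact norm_tsum_le_tsum_norm (hsumF x).summable
  have main := hasSum_integral_of_dominated_convergence (μ := ν.prod (volume : Measure C2))
    (F := F) (f := f) (fun n x => ‖F n x‖) (fun n => (hFc n).aestronglyMeasurable)
    (fun n => ae_of_all _ fun x => le_rfl) (ae_of_all _ fun x => (hsumF x).summable) hdom
    (ae_of_all _ hfsum)
  have hf_int : ∫ x, f x ∂(ν.prod (volume : Measure C2)) =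
      ∫ p in Set.Ioi ε ×ˢ Set.Ioi ε, ((Real.exp (-(M * (p.1 + p.2))) : ℝ) : ℂ) *
        loopTrace θ v₁ v₂ (R p.1) (R p.2) := by
    rw [integral_prod f hfi]
    refine setIntegral_congr_fun (measurableSet_Ioi.prod measurableSet_Ioi) fun p hp => ?_
    have h1 : ε < p.1 := hp.1
    have h2 : ε < p.2 := hp.2
    have hq : R p.1 * R p.2 < 1 :=
      mul_lt_one_of_nonneg_of_lt_one_left (hR0 _) (hRlt (hε.trans h1)) (hRlt (hε.trans h2)).le
    simp only [← integral_loop_eq_loopTrace hθ v₁ v₂ hq, hf, hw, hy]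
    rw [← integral_const_mul]
    congr 1
    ext z
    ring
  have hF_int : ∀ n, ∫ x, F n x ∂(ν.prod (volume : Measure C2)) =
      bargmannInner θ (monomialBasis θ n) (bubbleLoop θ μ₀ ε γ₁ γ₂ (monomialBasis θ n)) := by
    intro n
    rw [integral_prod_symm _ (hFi n), bargmannInner]
    refine integral_congr_ae ?_
    filter_upwards [(hFi n).prod_left_ae] with z hz
    rw [hνprod] at hz ⊢
    rw [integral_prod _ hz, bubbleLoop_apply, ← integral_const_mul, ← integral_const_mul]
    congr 1
    ext s
    rw [← integral_const_mul, ← integral_const_mul]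
    congr 1
    ext t
    simp only [hF, hw, hy]
    ring
  rw [← hf_int]
  simpa only [hF_int] using main

/-! ### The quartic trace -/

lemma exists_bargmannInner_U_bound {θ : ℝ} {φ χ : C2 → ℂ} (hφ : RapidDecay θ φ)
    (hχ : RapidDecay θ χ) (N : ℕ) : ∃ C, 0 ≤ C ∧ ∀ γ : Mode,
      ‖bargmannInner θ φ (U θ γ χ)‖ * bracket (latticePoint θ γ) ^ N ≤ C := by
  obtain ⟨K, hK⟩ := exists_bargmannInner_translation_bound hφ N
  obtain ⟨C, hC⟩ := hχ.bound N
  have h := fun γ => hK χ C (latticePoint θ γ) hC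
  exact ⟨K * C, le_trans (mul_nonneg (norm_nonneg _)
    (pow_nonneg (bracket_pos _).le N)) (h 0), h⟩

lemma summable_bargmannInner_U_mul {θ : ℝ} (hθ : 0 < θ) {φ χ : C2 → ℂ} (hφ : RapidDecay θ φ)
    (hχ : RapidDecay θ χ) (N : ℕ) : Summable fun γ : Mode =>
      ‖bargmannInner θ φ (U θ γ χ)‖ * bracket (latticePoint θ γ) ^ N := by
  obtain ⟨C, -, hC⟩ := exists_bargmannInner_U_bound hφ hχ (N + 4)
  refine Summable.of_nonneg_of_le (fun γ => mul_nonneg (norm_nonneg _)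
    (pow_nonneg (bracket_pos _).le N)) (fun γ => ?_)
    ((summable_inv_bracket_latticePoint hθ).mul_left C)
  rw [← div_eq_mul_inv, le_div_iff₀ (pow_pos (bracket_pos _) 4), mul_assoc, ← pow_add]
  exact hC γ

/-- The trace `Tr [(φ₁, φ₂) (φ₃, φ₄)]` as a sum over the lattice; the phase of the product is
trivial for opposite momenta. -/
lemma quarticTrace_eq (θ : ℝ) (φ₁ φ₂ φ₃ φ₄ : C2 → ℂ) : quarticTrace θ φ₁ φ₂ φ₃ φ₄ =
    ∑' γ : Mode, bargmannInner θ φ₁ (U θ γ φ₂) * bargmannInner θ φ₃ (U θ (-γ) φ₄) := by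
  rw [← (Equiv.neg Mode).tsum_eq, quarticTrace, torusTrace, torusMul]
  refine tsum_congr fun γ => ?_
  have h : torusForm θ γ (0 - γ) = 0 := by
    simp [torusForm]
    right
    ring
  rw [h]
  simp [modulePairing]

/-! ### Comparison of `1 - e^{-u}` with the proper time `u` -/

lemma one_sub_exp_neg_pos {u : ℝ} (hu : 0 < u) : 0 < 1 - Real.exp (-u) := by
  have : Real.exp (-u) < 1 := by rw [Real.exp_lt_one_iff]; linarith
  linarith

lemma one_sub_exp_neg_le (u : ℝ) : 1 - Real.exp (-u) ≤ u := by
  have := Real.add_one_le_exp (-u)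
  linarith

lemma inv_le_one_add_inv {u X : ℝ} (hu : 0 < u) (hX : 1 - Real.exp (-u) ≤ X) :
    X⁻¹ ≤ 1 + u⁻¹ := by
  have h1 := one_sub_exp_neg_pos hu
  refine (inv_anti₀ h1 hX).trans ?_
  have h2 : Real.exp (-u) * (1 + u) ≤ 1 := by
    rw [Real.exp_neg, ← div_eq_inv_mul, div_le_one (Real.exp_pos _), add_comm]
    exact Real.add_one_le_exp u
  have h3 : 1 + u⁻¹ = (1 + u) / u := by field_simp; ring
  rw [h3, inv_eq_one_div, div_le_div_iff₀ h1 hu]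
  nlinarith

lemma abs_inv_sq_sub_inv_sq_le {u X : ℝ} (hu : 0 < u) (hX : 1 - Real.exp (-u) ≤ X)
    (hXu : X ≤ u) : |(X ^ 2)⁻¹ - (u ^ 2)⁻¹| ≤ 1 + 2 * u⁻¹ := by
  have hX0 : 0 < X := (one_sub_exp_neg_pos hu).trans_le hX
  have h1 := inv_le_one_add_inv hu hX
  have h2 : u⁻¹ ≤ X⁻¹ := inv_anti₀ hX0 hXu
  have h3 : 0 < u⁻¹ := by positivity
  rw [← inv_pow, ← inv_pow, abs_of_nonneg (by nlinarith)]
  nlinarith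

lemma inv_mul_sqrt_le {u X : ℝ} (hu : 0 < u) (hX : 1 - Real.exp (-u) ≤ X) :
    (X * √X)⁻¹ ≤ 4 * (1 + (u * √u)⁻¹) := by
  have hX0 : 0 < X := (one_sub_exp_neg_pos hu).trans_le hX
  have h1 := inv_le_one_add_inv hu hX
  have h2 : 0 ≤ (u * √u)⁻¹ := by positivity
  -- `(v/2)^{3/2} ≥ v^{3/2}/4`, applied with `v = min 1 u`
  have key : ∀ v, 0 < v → v / 2 ≤ X → (X * √X)⁻¹ ≤ 4 * (v * √v)⁻¹ := by
    intro v hv hvX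
    have h3 : √v / 2 ≤ √X := by
      refine le_trans ?_ (Real.sqrt_le_sqrt hvX)
      apply Real.le_sqrt_of_sq_le
      rw [div_pow, Real.sq_sqrt hv.le]
      linarith
    have h4 : v / 2 * (√v / 2) ≤ X * √X := mul_le_mul hvX h3 (by positivity) hX0.le
    refine (inv_anti₀ (by positivity) h4).trans (le_of_eq ?_)
    field_simp
    norm_num
  rcases le_total u 1 with h | h
  · have h5 : u / 2 ≤ X := by
      have h6 : X⁻¹ ≤ (u / 2)⁻¹ := by
        have : 1 ≤ u⁻¹ := (one_le_inv₀ hu).2 h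
        rw [inv_div, div_eq_mul_inv]
        linarith
      exact (inv_le_inv₀ hX0 (by positivity)).1 h6
    have := key u hu h5
    linarith
  · have h5 : 1 / 2 ≤ X := by
      have h6 : X⁻¹ ≤ (1 / 2)⁻¹ := by
        have : u⁻¹ ≤ 1 := inv_le_one_of_one_le₀ h
        norm_num
        linarith
      exact (inv_le_inv₀ hX0 (by positivity)).1 h6
    have := key 1 one_pos h5
    simp only [Real.sqrt_one, mul_one, inv_one] at this
    linarith

/-! ### The bubble graph -/

/-- The trace with modulus and phase separated: the modulus decays in both momenta and, on a shorter
scale, in their difference. -/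
lemma loopTrace_eq (θ : ℝ) (v₁ v₂ : C2) {r s : ℝ} (hrs : r * s < 1) : loopTrace θ v₁ v₂ r s =
    ((((1 - r * s) ^ 2)⁻¹ : ℝ) : ℂ) * Complex.exp
      (-((freq θ / 2 * ((1 - r) * (1 - s) / (1 - r * s) * (sqNorm v₁ + sqNorm v₂) +
        (r + s) / (1 - r * s) * sqNorm (v₁ - v₂)) : ℝ) : ℂ) +
        ((freq θ * ((r - s) / (1 - r * s)) * (herm v₂ v₁).im : ℝ) : ℂ) * Complex.I) := by
  have hq : (1 - (r : ℂ) * s) ≠ 0 := by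
    have : 1 - r * s ≠ 0 := by linarith
    exact_mod_cast this
  unfold loopTrace
  congr 2
  have h1 : herm v₂ v₁ = ((herm v₂ v₁).re : ℂ) + ((herm v₂ v₁).im : ℂ) * Complex.I :=
    (Complex.re_add_im _).symm
  have h2 : herm v₁ v₂ = ((herm v₂ v₁).re : ℂ) - ((herm v₂ v₁).im : ℂ) * Complex.I := by
    rw [← conj_herm]
    apply Complex.ext <;> simp
  rw [sqNorm_sub, herm_re_comm v₁ v₂, herm_sub_left, herm_sub_right, herm_sub_right,
    herm_smul_left, herm_smul_left, herm_smul_right, herm_smul_right, herm_self, herm_self, h2]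
  set h := herm v₂ v₁
  rw [h1]
  push_cast
  simp only [Complex.add_re, Complex.add_im, Complex.ofReal_re, Complex.ofReal_im,
    Complex.re_ofReal_mul, Complex.im_ofReal_mul, Complex.I_re, Complex.I_im, mul_zero, add_zero,
    mul_one, zero_add]
  field_simp
  ring

lemma norm_loopTrace (θ : ℝ) (v₁ v₂ : C2) {r s : ℝ} (hrs : r * s < 1) :
    ‖loopTrace θ v₁ v₂ r s‖ = ((1 - r * s) ^ 2)⁻¹ * Real.exp
      (-(freq θ / 2 * ((1 - r) * (1 - s) / (1 - r * s) * (sqNorm v₁ + sqNorm v₂) +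
        (r + s) / (1 - r * s) * sqNorm (v₁ - v₂)))) := by
  rw [loopTrace_eq θ v₁ v₂ hrs, norm_mul, Complex.norm_real, Real.norm_of_nonneg (by positivity),
    Complex.norm_exp, Complex.add_re, Complex.re_ofReal_mul, Complex.I_re, mul_zero, add_zero,
    Complex.neg_re, Complex.ofReal_re]

lemma norm_loopTrace_le {θ : ℝ} (hθ : 0 < θ) (v₁ v₂ : C2) {r s : ℝ} (hr0 : 0 ≤ r) (hr1 : r < 1)
    (hs0 : 0 ≤ s) (hs1 : s < 1) : ‖loopTrace θ v₁ v₂ r s‖ ≤ ((1 - r * s) ^ 2)⁻¹ := by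
  have hrs : r * s < 1 := mul_lt_one_of_nonneg_of_lt_one_left hr0 hr1 hs1.le
  have hω := freq_pos hθ
  have h0 : 0 < 1 - r * s := by linarith
  have h1 : 0 ≤ 1 - r := by linarith
  have h2 : 0 ≤ 1 - s := by linarith
  have h3 := sqNorm_nonneg v₁
  have h4 := sqNorm_nonneg v₂
  have h5 := sqNorm_nonneg (v₁ - v₂)
  rw [norm_loopTrace θ v₁ v₂ hrs]
  refine mul_le_of_le_one_right (by positivity) (Real.exp_le_one_iff.2 (neg_nonpos.2 ?_))
  positivity

/-- Distinct lattice momenta suppress the trace at short proper time. -/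
lemma exists_norm_loopTrace_le {θ : ℝ} (hθ : 0 < θ) {d : ℝ} (hd : 0 < d) : ∃ C, 0 ≤ C ∧
    ∀ (v₁ v₂ : C2) (r s : ℝ), 0 ≤ r → r < 1 → 0 ≤ s → s < 1 → d ≤ sqNorm (v₁ - v₂) →
      ‖loopTrace θ v₁ v₂ r s‖ ≤ C := by
  have hω := freq_pos hθ
  obtain ⟨C, hC0, hC⟩ := exists_one_add_pow_mul_exp_neg_le 2 (mul_pos hω hd)
  refine ⟨C, hC0, fun v₁ v₂ r s hr0 hr1 hs0 hs1 hdv => ?_⟩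
  have hrs : r * s < 1 := mul_lt_one_of_nonneg_of_lt_one_left hr0 hr1 hs1.le
  have h0 : 0 < 1 - r * s := by linarith
  have h1 : 0 ≤ 1 - r := by linarith
  have h2 : 0 ≤ 1 - s := by linarith
  have h3 := sqNorm_nonneg v₁
  have h4 := sqNorm_nonneg v₂
  have hq0 : 0 ≤ r * s := mul_nonneg hr0 hs0
  rw [norm_loopTrace θ v₁ v₂ hrs]
  -- in terms of `u`, the prefactor is `(1 + u)²` and the Gaussian at most `exp (-ωdu)`
  set u := r * s / (1 - r * s) with hu
  have hu0 : 0 ≤ u := by positivity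
  have e1 : ((1 - r * s) ^ 2)⁻¹ = (1 + u) ^ 2 := by
    rw [hu]; field_simp; ring
  rw [e1]
  refine le_trans (mul_le_mul_of_nonneg_left (Real.exp_le_exp.2 ?_) (by positivity)) (hC u hu0)
  have h5 : 2 * (r * s) ≤ r + s := by nlinarith
  have h6 : 2 * u ≤ (r + s) / (1 - r * s) := by
    rw [hu, mul_div_assoc']
    exact div_le_div_of_nonneg_right h5 h0.le
  have h7 : 2 * u * d ≤ (r + s) / (1 - r * s) * sqNorm (v₁ - v₂) :=
    mul_le_mul h6 hdv hd.le (by positivity)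
  have h8 : 0 ≤ (1 - r) * (1 - s) / (1 - r * s) * (sqNorm v₁ + sqNorm v₂) := by positivity
  have h9 := mul_le_mul_of_nonneg_left (add_le_add h8 h7) (half_pos hω).le
  linarith

/-- At equal momenta the trace is `(1 - rs)⁻²` up to a weaker singularity. -/
lemma norm_loopTrace_self_sub_le {θ : ℝ} (hθ : 0 < θ) (v : C2) {r s : ℝ} (hr0 : 0 ≤ r)
    (hr1 : r < 1) (hs0 : 0 ≤ s) (hs1 : s < 1) :
    ‖loopTrace θ v v r s - ((((1 - r * s) ^ 2)⁻¹ : ℝ) : ℂ)‖ ≤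
      freq θ * sqNorm v * (1 - r * s)⁻¹ := by
  have hω := freq_pos hθ
  have hrs : r * s < 1 := mul_lt_one_of_nonneg_of_lt_one_left hr0 hr1 hs1.le
  have h0 : 0 < 1 - r * s := by linarith
  have h1 : 0 ≤ 1 - r := by linarith
  have h2 : 0 ≤ 1 - s := by linarith
  have h3 := sqNorm_nonneg v
  set y := freq θ * sqNorm v * ((1 - r) * (1 - s) / (1 - r * s)) with hy
  have hy0 : 0 ≤ y := by positivity
  have e : loopTrace θ v v r s = ((((1 - r * s) ^ 2)⁻¹ * Real.exp (-y) : ℝ) : ℂ) := by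
    rw [loopTrace_eq θ v v hrs, sub_self, sqNorm_zero, herm_self, Complex.ofReal_im, mul_zero,
      mul_zero, Complex.ofReal_zero, zero_mul, add_zero, ← Complex.ofReal_neg, ← Complex.ofReal_exp,
      ← Complex.ofReal_mul, hy]
    congr 3
    ring
  rw [e, ← Complex.ofReal_sub, Complex.norm_real, Real.norm_eq_abs,
    show ((1 - r * s) ^ 2)⁻¹ * Real.exp (-y) - ((1 - r * s) ^ 2)⁻¹ =
      -(((1 - r * s) ^ 2)⁻¹ * (1 - Real.exp (-y))) by ring, abs_neg, abs_of_nonneg]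
  · have h4 : y ≤ freq θ * sqNorm v * (1 - r * s) := by
      rw [hy]
      refine mul_le_mul_of_nonneg_left ?_ (by positivity)
      rw [div_le_iff₀ h0]
      refine mul_le_mul ?_ ?_ h2 h0.le <;> nlinarith
    calc ((1 - r * s) ^ 2)⁻¹ * (1 - Real.exp (-y))
        ≤ ((1 - r * s) ^ 2)⁻¹ * (freq θ * sqNorm v * (1 - r * s)) := by
          refine mul_le_mul_of_nonneg_left ((one_sub_exp_neg_le y).trans h4) (by positivity)
      _ = _ := by field_simp
  · have : Real.exp (-y) ≤ 1 := Real.exp_le_one_iff.2 (neg_nonpos.2 hy0)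
    exact mul_nonneg (by positivity) (by linarith)

lemma le_sqNorm_latticePoint_sub {θ : ℝ} {γ δ : Mode} (h : γ ≠ δ) :
    θ ^ 2 / 2 ≤ sqNorm (latticePoint θ γ - latticePoint θ δ) := by
  have e : latticePoint θ γ - latticePoint θ δ = latticePoint θ (γ - δ) := by
    rw [sub_eq_add_neg, sub_eq_add_neg, latticePoint_add, latticePoint_neg]
  have h0 : γ - δ ≠ 0 := sub_ne_zero.2 h
  rw [e, sqNorm_latticePoint]
  refine le_mul_of_one_le_right (by positivity) ?_
  set η := γ - δ
  have hsq : ∀ n : ℤ, n ≠ 0 → (1 : ℝ) ≤ (n : ℝ) ^ 2 := fun n hn => by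
    have : (1 : ℤ) ≤ n ^ 2 := by
      have := sq_pos_of_ne_zero hn
      omega
    exact_mod_cast this
  have p1 := sq_nonneg (η.1 0 : ℝ)
  have p2 := sq_nonneg (η.1 1 : ℝ)
  have p3 := sq_nonneg (η.2 0 : ℝ)
  have p4 := sq_nonneg (η.2 1 : ℝ)
  by_contra hlt
  apply h0
  have z1 : η.1 0 = 0 := by
    by_contra hn; have := hsq _ hn; linarith
  have z2 : η.1 1 = 0 := by
    by_contra hn; have := hsq _ hn; linarith
  have z3 : η.2 0 = 0 := by
    by_contra hn; have := hsq _ hn; linarith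
  have z4 : η.2 1 = 0 := by
    by_contra hn; have := hsq _ hn; linarith
  ext i <;> fin_cases i <;> assumption

/-- The bubble graph: its lattice sum converges absolutely, and only the terms with equal momenta
contribute to the logarithmic divergence. -/
theorem bubble_asymptotics {θ : ℝ} (hθ : 0 < θ) (μ₀ lam : ℝ) {φ₁ φ₂ φ₃ φ₄ : C2 → ℂ}
    (h₁ : RapidDecay θ φ₁) (h₂ : RapidDecay θ φ₂) (h₃ : RapidDecay θ φ₃) (h₄ : RapidDecay θ φ₄) :
    (∀ ε : ℝ, 0 < ε → Summable (bubbleTerm θ μ₀ lam ε φ₁ φ₂ φ₃ φ₄)) ∧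
    ∃ a : ℂ, Tendsto (fun ε : ℝ => bubbleGraph θ μ₀ lam ε φ₁ φ₂ φ₃ φ₄ -
      ((-(lam ^ 2 / (8 * freq θ ^ 2)) : ℝ) : ℂ) *
        quarticTrace θ φ₁ φ₂ φ₃ φ₄ * (Real.log (1 / ε) : ℂ)) (𝓝[>] 0) (𝓝 a) := by
  have hω := freq_pos hθ
  have hM : 0 < 2 * freq θ + μ₀ ^ 2 := by positivity
  -- `a` and `b` are the couplings to the external fields, and `R s` is the dilation after time `s`
  set a : Mode → ℂ := fun γ => bargmannInner θ φ₁ (U θ γ φ₂) with ha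
  set b : Mode → ℂ := fun γ => bargmannInner θ φ₃ (U θ (-γ) φ₄) with hb
  set v : Mode → C2 := latticePoint θ with hv
  set R : ℝ → ℝ := fun s => Real.exp (-(2 * freq θ * s)) with hR
  have hR0 : ∀ s, 0 ≤ R s := fun s => (Real.exp_pos _).le
  have hR1 : ∀ {s}, 0 < s → R s < 1 := fun {s} hs => by
    simp only [hR]
    rw [Real.exp_lt_one_iff]
    have : 0 < 2 * freq θ * s := by positivity
    linarith
  have hRR : ∀ s t, R s * R t = Real.exp (-(2 * freq θ * (s + t))) := fun s t => by
    simp only [hR]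
    rw [← Real.exp_add]
    ring_nf
  have hAsum : Summable fun γ => ‖a γ‖ * bracket (v γ) := by
    simpa only [pow_one] using summable_bargmannInner_U_mul hθ h₁ h₂ 1
  have hBsum : Summable fun γ => ‖b γ‖ := by
    have h := summable_bargmannInner_U_mul hθ h₃ h₄ 0
    simp only [pow_zero, mul_one] at h
    exact (Equiv.neg Mode).summable_iff.2 h
  have hABsum : Summable fun p : Mode × Mode => ‖a p.1‖ * bracket (v p.1) * ‖b p.2‖ :=
    (hasSum_prod_mul hAsum.hasSum hBsum.hasSum).summable
  have hnab : ∀ p : Mode × Mode, ‖a p.1 * b p.2‖ ≤ ‖a p.1‖ * bracket (v p.1) * ‖b p.2‖ := by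
    intro p
    rw [norm_mul]
    refine mul_le_mul_of_nonneg_right ?_ (norm_nonneg _)
    exact le_mul_of_one_le_right (norm_nonneg _) (one_le_bracket _)
  set S := ∑' p : Mode × Mode, ‖a p.1‖ * bracket (v p.1) * ‖b p.2‖ with hS
  have hS0 : 0 ≤ S := tsum_nonneg fun p => mul_nonneg (mul_nonneg (norm_nonneg _)
    (bracket_pos _).le) (norm_nonneg _)
  set Q₀ := quarticTrace θ φ₁ φ₂ φ₃ φ₄ with hQ₀
  have hQsum : HasSum (fun γ => a γ * b γ) Q₀ := by
    have hs : Summable fun γ => a γ * b γ := by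
      refine Summable.of_norm_bounded (hABsum.comp_injective
        (i := fun γ : Mode => ((γ, γ) : Mode × Mode)) fun x y h => (Prod.ext_iff.1 h).1) fun γ => ?_
      exact hnab (γ, γ)
    have := hs.hasSum
    rwa [hQ₀, quarticTrace_eq]
  set m : Mode × Mode → ℝ × ℝ → ℂ := fun p z =>
    a p.1 * b p.2 * loopTrace θ (v p.1) (v p.2) (R z.1) (R z.2) with hm
  obtain ⟨C, hC0, hC⟩ := exists_norm_loopTrace_le hθ (show 0 < θ ^ 2 / 2 by positivity)
  have hterm : ∀ ε, 0 < ε → ∀ p, bubbleTerm θ μ₀ lam ε φ₁ φ₂ φ₃ φ₄ p =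
      (-(4 / (Nat.factorial 2 : ℂ)) * ((lam / 2 : ℝ) : ℂ) ^ 2) *
        ∫ z in Set.Ioi ε ×ˢ Set.Ioi ε,
          ((Real.exp (-((2 * freq θ + μ₀ ^ 2) * (z.1 + z.2))) : ℝ) : ℂ) * m p z := by
    intro ε hε p
    unfold bubbleTerm
    rw [operatorTrace, (hasSum_bubbleLoop hθ μ₀ hε p.1 p.2).tsum_eq]
    congr 1
    simp only [hm, ha, hb, hv, hR]
    rw [← integral_const_mul]
    congr 1
    ext z
    ring
  have hmeas : ∀ p, Measurable (m p) := fun p => by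
    simp only [hm, loopTrace, herm_sub_left, herm_sub_right, herm_smul_left, herm_smul_right, hR]
    fun_prop
  have hmsum : ∀ ε : ℝ, 0 < ε → ∃ u : Mode × Mode → ℝ, Summable u ∧
      ∀ p s t, ε < s → ε < t → ‖m p (s, t)‖ ≤ u p := by
    intro ε hε
    refine ⟨fun p => ‖a p.1‖ * bracket (v p.1) * ‖b p.2‖ * ((1 - R ε) ^ 2)⁻¹,
      hABsum.mul_right _, fun p s t hs ht => ?_⟩
    simp only [hm]
    rw [norm_mul]
    refine mul_le_mul (hnab p) ?_ (norm_nonneg _) (mul_nonneg (mul_nonneg (norm_nonneg _)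
      (bracket_pos _).le) (norm_nonneg _))
    refine (norm_loopTrace_le hθ _ _ (hR0 s) (hR1 (hε.trans hs)) (hR0 t)
      (hR1 (hε.trans ht))).trans ?_
    have h1 : 0 < 1 - R ε := by linarith [hR1 hε]
    have h2 : R s * R t ≤ R ε := by
      rw [hRR]
      apply Real.exp_le_exp.2
      nlinarith
    exact inv_anti₀ (by positivity) (pow_le_pow_left₀ h1.le (by linarith) 2)
  have hlead : ∀ s t : ℝ, 0 < s → 0 < t →
      ‖∑' p, m p (s, t) - (Q₀ * (((4 * freq θ ^ 2)⁻¹ : ℝ) : ℂ)) * (((s + t) ^ 2)⁻¹ : ℝ)‖ ≤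
        (S * (C + freq θ * (1 + (2 * freq θ)⁻¹)) + ‖Q₀‖ * (1 + 2 * (2 * freq θ)⁻¹)) *
          (singularWeight s * singularWeight t) := by
    intro s t hs ht
    set W := singularWeight s * singularWeight t with hW
    have hW1 : 1 ≤ W := one_le_singularWeight_mul hs ht
    have hWi : (s + t)⁻¹ ≤ W := inv_add_le_singularWeight hs ht
    have hst : 0 < s + t := by positivity
    set u := 2 * freq θ * (s + t) with hu
    have hu0 : 0 < u := by positivity
    have huW : u⁻¹ ≤ (2 * freq θ)⁻¹ * W := by
      rw [hu, mul_inv]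
      exact mul_le_mul_of_nonneg_left hWi (by positivity)
    set e := 1 - R s * R t with he
    have he' : e = 1 - Real.exp (-u) := by rw [he, hRR]
    have he0 : 0 < e := by rw [he']; exact one_sub_exp_neg_pos hu0
    have heinv : e⁻¹ ≤ (1 + (2 * freq θ)⁻¹) * W := by
      have := inv_le_one_add_inv hu0 he'.symm.le
      linarith
    have hes : |(e ^ 2)⁻¹ - (u ^ 2)⁻¹| ≤ (1 + 2 * (2 * freq θ)⁻¹) * W := by
      have := abs_inv_sq_sub_inv_sq_le hu0 he'.symm.le (he'.trans_le (one_sub_exp_neg_le u))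
      linarith
    -- the diagonal part of the sum
    set d : Mode × Mode → ℂ := fun p => if p.1 = p.2 then a p.1 * b p.2 * (((e ^ 2)⁻¹ : ℝ) : ℂ)
      else 0 with hd
    have hdsum : HasSum d (Q₀ * (((e ^ 2)⁻¹ : ℝ) : ℂ)) := by
      have hinj : Function.Injective fun γ : Mode => ((γ, γ) : Mode × Mode) :=
        fun x y h => (Prod.ext_iff.1 h).1
      rw [← hinj.hasSum_iff]
      · have : d ∘ (fun γ : Mode => ((γ, γ) : Mode × Mode)) =
            fun γ => a γ * b γ * (((e ^ 2)⁻¹ : ℝ) : ℂ) := by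
          ext γ; simp [hd]
        rw [this]
        exact hQsum.mul_right _
      · intro p hp
        simp only [hd]
        rw [if_neg]
        intro h
        exact hp ⟨p.1, Prod.ext rfl h⟩
    have hdiff : ∀ p, ‖m p (s, t) - d p‖ ≤
        ‖a p.1‖ * bracket (v p.1) * ‖b p.2‖ * (C + freq θ * e⁻¹) := by
      intro p
      by_cases h : p.1 = p.2
      · simp only [hm, hd]
        rw [if_pos h, ← mul_sub, norm_mul, norm_mul, ← h]
        have h1 := norm_loopTrace_self_sub_le hθ (v p.1) (hR0 s) (hR1 hs) (hR0 t) (hR1 ht)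
        have h2 : freq θ * sqNorm (v p.1) * e⁻¹ ≤ bracket (v p.1) * (C + freq θ * e⁻¹) := by
          have h3 : sqNorm (v p.1) ≤ bracket (v p.1) := by unfold bracket; linarith
          have h4 := mul_le_mul_of_nonneg_right h3 (show 0 ≤ freq θ * e⁻¹ by positivity)
          have h5 := mul_nonneg (bracket_pos (v p.1)).le hC0
          nlinarith
        have h6 := mul_le_mul_of_nonneg_left (h1.trans h2)
          (mul_nonneg (norm_nonneg (a p.1)) (norm_nonneg (b p.1)))
        exact h6.trans (le_of_eq (by ring))
      · simp only [hm, hd]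
        rw [if_neg h, sub_zero, norm_mul]
        have h1 := hC (v p.1) (v p.2) (R s) (R t) (hR0 s) (hR1 hs) (hR0 t) (hR1 ht)
          (le_sqNorm_latticePoint_sub h)
        refine mul_le_mul (hnab p) (h1.trans ?_) (norm_nonneg _) (mul_nonneg
          (mul_nonneg (norm_nonneg _) (bracket_pos _).le) (norm_nonneg _))
        have : 0 ≤ freq θ * e⁻¹ := by positivity
        linarith
    have hdsummable : Summable fun p => m p (s, t) - d p :=
      Summable.of_norm_bounded (hABsum.mul_right _) hdiff
    have hms : HasSum (fun p => m p (s, t))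
        ((∑' p, (m p (s, t) - d p)) + Q₀ * (((e ^ 2)⁻¹ : ℝ) : ℂ)) := by
      simpa using hdsummable.hasSum.add hdsum
    have hbd : ‖∑' p, (m p (s, t) - d p)‖ ≤ S * (C + freq θ * e⁻¹) := by
      refine tsum_of_norm_bounded ?_ hdiff
      exact hABsum.hasSum.mul_right _
    have hQe : Q₀ * (((4 * freq θ ^ 2)⁻¹ : ℝ) : ℂ) * (((s + t) ^ 2)⁻¹ : ℝ) =
        Q₀ * (((u ^ 2)⁻¹ : ℝ) : ℂ) := by
      rw [mul_assoc, ← Complex.ofReal_mul, ← mul_inv, hu,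
        show 4 * freq θ ^ 2 * (s + t) ^ 2 = (2 * freq θ * (s + t)) ^ 2 by ring]
    rw [hms.tsum_eq, hQe, add_sub_assoc, ← mul_sub, ← Complex.ofReal_sub]
    refine (norm_add_le _ _).trans ?_
    rw [norm_mul, Complex.norm_real, Real.norm_eq_abs]
    have h1 : S * (C + freq θ * e⁻¹) ≤ S * (C + freq θ * (1 + (2 * freq θ)⁻¹)) * W := by
      rw [mul_assoc]
      refine mul_le_mul_of_nonneg_left ?_ hS0
      have h2 := mul_le_mul_of_nonneg_left heinv hω.le
      have h3 := mul_le_mul_of_nonneg_left hW1 hC0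
      linarith
    have h4 := mul_le_mul_of_nonneg_left hes (norm_nonneg Q₀)
    linarith
  obtain ⟨hs, c, hc⟩ := tendsto_tsum_integral_sub_log hM hmeas hmsum hlead
  set κ : ℂ := -(4 / (Nat.factorial 2 : ℂ)) * ((lam / 2 : ℝ) : ℂ) ^ 2 with hκ
  refine ⟨fun ε hε => ?_, κ * c, ?_⟩
  · rw [show bubbleTerm θ μ₀ lam ε φ₁ φ₂ φ₃ φ₄ = _ from funext (hterm ε hε)]
    exact (hs ε hε).mul_left κ
  · refine (hc.const_mul κ).congr' ?_
    filter_upwards [self_mem_nhdsWithin] with ε hε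
    rw [bubbleGraph, tsum_congr (hterm ε hε), tsum_mul_left, mul_sub]
    congr 1
    have hω' : (freq θ : ℂ) ≠ 0 := by exact_mod_cast hω.ne'
    rw [hκ]
    push_cast [Nat.factorial]
    field_simp
    ring

/-! ### The ladder graph -/

lemma measurable_dilationAmplitude (θ : ℝ) {φ χ : C2 → ℂ} (hφ : Continuous φ)
    (hχ : Continuous χ) (a b : C2) : Measurable (dilationAmplitude θ φ χ a b) := by
  have h : Continuous (Function.uncurry fun (x : ℝ) (z : C2) => bargmannIntegrand θ φ
      (translation θ a (translation θ b (conjDilation θ x 1 b χ))) z) := by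
    have c3 : Continuous fun z => herm a z := continuous_herm.comp (Continuous.prodMk_right a)
    have c4 : Continuous fun z => herm b z := continuous_herm.comp (Continuous.prodMk_right b)
    have c5 := continuous_sqNorm
    have c6 : Continuous fun z => conj (φ z) := Complex.continuous_conj.comp hφ
    simp only [Function.uncurry_def, bargmannIntegrand, translation, conjDilation]
    fun_prop
  exact h.stronglyMeasurable.integral_prod_right.measurable

lemma dilationAmplitude_zero (θ : ℝ) (φ χ : C2 → ℂ) (a b : C2) :
    dilationAmplitude θ φ χ a b 0 = bargmannInner θ φ (translation θ a (translation θ b χ)) := by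
  have : conjDilation θ 0 1 b χ = χ := by
    ext z
    simp [conjDilation]
  rw [dilationAmplitude, this]

lemma abs_exp_neg_sub_exp_neg_le (p q : ℝ) :
    |Real.exp (-p) - Real.exp (-q)| ≤ |p - q| * (Real.exp (-p) + Real.exp (-q)) := by
  have key : ∀ p q : ℝ, p ≤ q →
      |Real.exp (-p) - Real.exp (-q)| ≤ |p - q| * (Real.exp (-p) + Real.exp (-q)) := by
    intro p q h
    have h1 : Real.exp (-q) = Real.exp (-p) * Real.exp (-(q - p)) := by
      rw [← Real.exp_add]; ring_nf
    have h2 := Real.add_one_le_exp (-(q - p))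
    have h3 := Real.exp_pos (-p)
    have h4 := Real.exp_pos (-q)
    have h5 : Real.exp (-q) ≤ Real.exp (-p) := Real.exp_le_exp.2 (by linarith)
    rw [abs_of_nonneg (by linarith), abs_of_nonpos (by linarith)]
    have h6 := mul_le_mul_of_nonneg_left h2 h3.le
    have h7 := mul_nonneg (sub_nonneg.2 h) h4.le
    nlinarith
  rcases le_total p q with h | h
  · exact key p q h
  · rw [abs_sub_comm, abs_sub_comm p q, add_comm]
    exact key q p h

/-- A form of Peetre's inequality; here and below `v` and `w` are nearly opposite momenta, and
`1 + |v + w|²` measures the deviation. -/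
lemma sqrt_bracket_le_add (v w : C2) :
    √(bracket v) ≤ 2 * bracket (v + w) * √(bracket w) := by
  have h1 : bracket v ≤ 2 * bracket (v + w) * bracket w := by
    have := bracket_add_le (v + w) (-w)
    rwa [add_neg_cancel_right, bracket_neg] at this
  have h2 := one_le_bracket (v + w)
  have h3 := bracket_pos w
  rw [Real.sqrt_le_left (by positivity), mul_pow, Real.sq_sqrt h3.le]
  refine h1.trans (mul_le_mul_of_nonneg_right ?_ h3.le)
  nlinarith

lemma abs_sqNorm_sub_sqNorm_le (v w : C2) :
    |sqNorm v - sqNorm w| ≤ 3 * bracket (v + w) * √(bracket w) := by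
  have h1 : sqNorm v = sqNorm (v + w) - 2 * (herm (v + w) w).re + sqNorm w := by
    rw [← sqNorm_sub, add_sub_cancel_right]
  have h2 := (Complex.abs_re_le_norm _).trans (norm_herm_le_bracket (v + w) w)
  have h3 := one_le_sqrt_bracket w
  have h4 := sqrt_bracket_le (v + w)
  have h5 := sqNorm_nonneg (v + w)
  have h6 : sqNorm (v + w) ≤ bracket (v + w) * √(bracket w) := by
    have : sqNorm (v + w) ≤ bracket (v + w) := by unfold bracket; linarith
    exact this.trans (le_mul_of_one_le_right (bracket_pos _).le h3)
  have h7 := mul_le_mul_of_nonneg_right h4 (Real.sqrt_nonneg (bracket w))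
  have h8 := abs_le.1 (h2.trans h7)
  rw [h1, abs_le]
  constructor <;> linarith [h8.1, h8.2]

lemma one_add_mul_sqNorm_le_add {y : ℝ} (hy0 : 0 ≤ y) (hy1 : y ≤ 1) (v w : C2) :
    1 + y * sqNorm w ≤ 2 * (1 + y * sqNorm v) * bracket (v + w) := by
  have h := one_add_mul_sqNorm_add_le hy0 (-v) (v + w)
  rw [neg_add_cancel_left, sqNorm_neg] at h
  refine h.trans (mul_le_mul_of_nonneg_left (one_add_mul_sqNorm_le_bracket hy1 _) ?_)
  have := one_add_mul_sqNorm_pos hy0 v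
  positivity

lemma one_add_add_mul_sqNorm_le {x y : ℝ} (hx : 0 ≤ x) (hy : 0 ≤ y) (w : C2) :
    1 + (x + y) * sqNorm w ≤ (1 + x * sqNorm w) * (1 + y * sqNorm w) := by
  have h := mul_nonneg (mul_nonneg hx (sqNorm_nonneg w)) (mul_nonneg hy (sqNorm_nonneg w))
  nlinarith

/-- The product of the two propagators of the ladder graph, between momenta `v` and `w`. -/
noncomputable def ladderAmplitude (θ : ℝ) (φ₁ φ₂ φ₃ φ₄ : C2 → ℂ) (v w : C2) (x y : ℝ) : ℂ :=
  dilationAmplitude θ φ₁ φ₂ v w x * dilationAmplitude θ φ₃ φ₄ (-w) (-v) y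

/-- Exchanges a weight in `v` for a weight in `w`, at the cost of powers of `J`. -/
lemma pow_mul_le_of_weight {P J Wv Ww C : ℝ} (N k : ℕ) (hP : 0 ≤ P) (hJ : 0 ≤ J)
    (hWw : 0 ≤ Ww) (h : Ww ≤ 2 * Wv * J) (hC : P * J ^ (N + k) * Wv ^ k ≤ C) :
    P * J ^ N * Ww ^ k ≤ 2 ^ k * C := by
  calc P * J ^ N * Ww ^ k ≤ P * J ^ N * (2 * Wv * J) ^ k := by gcongr
    _ = 2 ^ k * (P * J ^ (N + k) * Wv ^ k) := by ring
    _ ≤ _ := by gcongr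

lemma bracket_neg_add_neg (v w : C2) : bracket (-w + -v) = bracket (v + w) := by
  rw [← neg_add_rev, bracket_neg]

lemma exists_ladderAmplitude_bound {θ : ℝ} (hθ : 0 < θ) {φ₁ φ₂ φ₃ φ₄ : C2 → ℂ}
    (h₁ : RapidDecay θ φ₁) (h₂ : RapidDecay θ φ₂) (h₃ : RapidDecay θ φ₃) (h₄ : RapidDecay θ φ₄) :
    ∃ C, ∀ (v w : C2) (x y : ℝ), 0 ≤ x → x ≤ 1 → 0 ≤ y → y ≤ 1 →
      ‖ladderAmplitude θ φ₁ φ₂ φ₃ φ₄ v w x y‖ * bracket (v + w) ^ 4 *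
        (1 + (x + y) * sqNorm w) ^ 4 ≤ C := by
  obtain ⟨C₁, hC₁⟩ := exists_dilationAmplitude_bound hθ h₁ h₂ 4 4
  obtain ⟨C₂, hC₂⟩ := exists_dilationAmplitude_bound hθ h₃ h₄ (0 + 4) 4
  refine ⟨C₁ * (2 ^ 4 * C₂), fun v w x y hx0 hx1 hy0 hy1 => ?_⟩
  have hJ := bracket_pos (v + w)
  have hP := one_add_mul_sqNorm_pos hx0 w
  have hQ := one_add_mul_sqNorm_pos hy0 w
  have hA := hC₁ v w x hx0 hx1
  have hB := hC₂ (-w) (-v) y hy0 hy1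
  rw [bracket_neg_add_neg, sqNorm_neg] at hB
  have hB' := pow_mul_le_of_weight 0 4 (norm_nonneg _) hJ.le hQ.le
    (one_add_mul_sqNorm_le_add hy0 hy1 v w) hB
  rw [pow_zero, mul_one] at hB'
  have h := mul_le_mul hA hB' (by positivity) (le_trans (by positivity) hA)
  refine le_trans ?_ h
  have hX : 0 ≤ 1 + (x + y) * sqNorm w := (one_add_mul_sqNorm_pos (add_nonneg hx0 hy0) w).le
  have hPQ := pow_le_pow_left₀ hX (one_add_add_mul_sqNorm_le hx0 hy0 w) 4
  rw [ladderAmplitude, norm_mul]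
  refine (mul_le_mul_of_nonneg_left hPQ (by positivity)).trans (le_of_eq ?_)
  ring

set_option maxHeartbeats 1000000 in
/-- At short proper time the two propagators multiply the external fields by a Gaussian in the
exchanged momentum. Both conjugated dilations are replaced by their Gaussian factors, and then `|v|`
is replaced by `|w|`, at the cost of powers of `|v + w|`, which the external fields absorb. -/
lemma exists_ladderAmplitude_sub_bound {θ : ℝ} (hθ : 0 < θ) {φ₁ φ₂ φ₃ φ₄ : C2 → ℂ}
    (h₁ : RapidDecay θ φ₁) (h₂ : φ₂ ∈ heisenbergModule θ) (h₃ : RapidDecay θ φ₃)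
    (h₄ : φ₄ ∈ heisenbergModule θ) :
    ∃ C, ∀ (v w : C2) (x y : ℝ), 0 ≤ x → x ≤ 1 → 0 ≤ y → y ≤ 1 →
      ‖ladderAmplitude θ φ₁ φ₂ φ₃ φ₄ v w x y -
        ((Real.exp (-(freq θ * (x + y) * sqNorm w)) : ℝ) : ℂ) *
          (bargmannInner θ φ₁ (translation θ (v + w) φ₂) *
            bargmannInner θ φ₃ (translation θ (-(v + w)) φ₄))‖ * bracket (v + w) ^ 4 *
        (1 + (x + y) * sqNorm w) ^ 4 ≤ C * √(x + y) := by
  have hω := freq_pos hθ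
  have h₂' := (exists_rapidDecay_deriv hθ h₂).1
  have h₄' := (exists_rapidDecay_deriv hθ h₄).1
  obtain ⟨C₁, hC₁⟩ := exists_dilationAmplitude_sub_bound hθ h₁ h₂ 4 5
  obtain ⟨C₂, hC₂⟩ := exists_dilationAmplitude_bound hθ h₃ h₄' (0 + 5) 5
  obtain ⟨C₃, hC₃⟩ := exists_dilationAmplitude_bound hθ h₁ h₂' 10 0
  obtain ⟨C₄, hC₄⟩ := exists_dilationAmplitude_sub_bound hθ h₃ h₄ (1 + 5) 5
  obtain ⟨C₅, hC₅0, hC₅⟩ := exists_one_add_pow_mul_exp_neg_le 5 hω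
  have hs1 : 0 < 1 * √(bracket 0) := mul_pos one_pos (Real.sqrt_pos.2 (bracket_pos 0))
  have hC₁0 : 0 ≤ C₁ := by
    refine nonneg_of_mul_nonneg_left (le_trans ?_ (hC₁ 0 0 1 zero_le_one le_rfl)) hs1
    have := bracket_pos (0 + 0)
    have := one_add_mul_sqNorm_pos zero_le_one (0 : C2)
    positivity
  have hC₄0 : 0 ≤ C₄ := by
    refine nonneg_of_mul_nonneg_left (le_trans ?_ (hC₄ 0 0 1 zero_le_one le_rfl)) hs1
    have := bracket_pos (0 + 0)
    have := one_add_mul_sqNorm_pos zero_le_one (0 : C2)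
    positivity
  refine ⟨(C₁ * (2 ^ 5 * C₂) + C₃ * C₅ * (2 ^ 5 * (C₄ * 2)) +
    C₃ * C₂ * C₅ * (freq θ * 3 * (C₅ + 2 ^ 5 * C₅))) * 2, fun v w x y hx0 hx1 hy0 hy1 => ?_⟩
  set J := bracket (v + w) with hJdef
  have hJ : 0 < J := bracket_pos _
  have hJ1 : 1 ≤ J := one_le_bracket _
  set s := √(bracket w) with hs
  have hs0 : 0 ≤ s := Real.sqrt_nonneg _
  set P := 1 + x * sqNorm w with hPdef
  set Q := 1 + y * sqNorm w with hQdef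
  set V := 1 + y * sqNorm v with hVdef
  have hP : 0 < P := one_add_mul_sqNorm_pos hx0 w
  have hQ : 0 < Q := one_add_mul_sqNorm_pos hy0 w
  have hV : 0 < V := one_add_mul_sqNorm_pos hy0 v
  have hQV : Q ≤ 2 * V * J := one_add_mul_sqNorm_le_add hy0 hy1 v w
  set A := dilationAmplitude θ φ₁ φ₂ v w x with hA
  set B := dilationAmplitude θ φ₃ φ₄ (-w) (-v) y with hB
  set α := bargmannInner θ φ₁ (translation θ v (translation θ w φ₂)) with hα
  set β := bargmannInner θ φ₃ (translation θ (-w) (translation θ (-v) φ₄)) with hβ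
  -- the phases on the two open lines cancel
  have hαβ : bargmannInner θ φ₁ (translation θ (v + w) φ₂) *
      bargmannInner θ φ₃ (translation θ (-(v + w)) φ₄) = α * β := by
    rw [hα, hβ, bargmannInner_translation_translation, bargmannInner_translation_translation,
      ← neg_add_rev]
    linear_combination -(bargmannInner θ φ₁ (translation θ (v + w) φ₂) *
      bargmannInner θ φ₃ (translation θ (-(v + w)) φ₄)) * cocycle_neg_neg_mul θ v w
  set ex := Real.exp (-(freq θ * x * sqNorm w)) with hex
  set ev := Real.exp (-(freq θ * y * sqNorm v)) with hev
  set ew := Real.exp (-(freq θ * y * sqNorm w)) with hew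
  have hexp : Real.exp (-(freq θ * (x + y) * sqNorm w)) = ex * ew := by
    rw [hex, hew, ← Real.exp_add]; ring_nf
  have hex0 : 0 < ex := Real.exp_pos _
  have hev0 : 0 < ev := Real.exp_pos _
  have hew0 : 0 < ew := Real.exp_pos _
  -- the decay of the single factors
  have b1 : ‖A - ex * α‖ * J ^ 4 * P ^ 5 ≤ C₁ * (x * s) := hC₁ v w x hx0 hx1
  have b2 : ‖B‖ * Q ^ 5 ≤ 2 ^ 5 * C₂ := by
    have h := hC₂ (-w) (-v) y hy0 hy1
    rw [bracket_neg_add_neg, sqNorm_neg] at h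
    have h' := pow_mul_le_of_weight 0 5 (norm_nonneg _) hJ.le hQ.le hQV h
    rwa [pow_zero, mul_one] at h'
  have b3 : ‖α‖ * J ^ 10 ≤ C₃ := by
    have h := hC₃ v w 0 le_rfl zero_le_one
    rwa [dilationAmplitude_zero, pow_zero, mul_one] at h
  have b2' : ‖β‖ ≤ C₂ := by
    have h := hC₂ (-w) (-v) 0 le_rfl zero_le_one
    rw [dilationAmplitude_zero, zero_mul, add_zero, one_pow, mul_one, bracket_neg_add_neg] at h
    exact (le_mul_of_one_le_right (norm_nonneg _) (one_le_pow₀ hJ1)).trans h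
  have b4 : ‖B - ev * β‖ * Q ^ 5 ≤ 2 ^ 5 * (C₄ * 2) * (y * s) := by
    have h := hC₄ (-w) (-v) y hy0 hy1
    rw [bracket_neg_add_neg, sqNorm_neg, bracket_neg] at h
    have h5 : ‖B - ev * β‖ * J ^ (0 + 5) * V ^ 5 * J ≤ C₄ * 2 * (y * s) * J := by
      calc ‖B - ev * β‖ * J ^ (0 + 5) * V ^ 5 * J
          = ‖B - ev * β‖ * J ^ (1 + 5) * V ^ 5 := by ring
        _ ≤ C₄ * (y * √(bracket v)) := h
        _ ≤ C₄ * (y * (2 * J * s)) := by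
            gcongr
            exact sqrt_bracket_le_add v w
        _ = _ := by ring
    have h' := le_of_mul_le_mul_right h5 hJ
    have h6 := pow_mul_le_of_weight 0 5 (norm_nonneg _) hJ.le hQ.le hQV h'
    rw [pow_zero, mul_one] at h6
    linarith
  have b5 : ex * P ^ 5 ≤ C₅ := by
    have h := hC₅ (x * sqNorm w) (mul_nonneg hx0 (sqNorm_nonneg w))
    rw [← mul_assoc] at h
    linarith
  have b6 : ew * Q ^ 5 ≤ C₅ := by
    have h := hC₅ (y * sqNorm w) (mul_nonneg hy0 (sqNorm_nonneg w))
    rw [← mul_assoc] at h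
    linarith
  have b7 : ev * Q ^ 5 ≤ J ^ 5 * (2 ^ 5 * C₅) := by
    have h := hC₅ (y * sqNorm v) (mul_nonneg hy0 (sqNorm_nonneg v))
    rw [← mul_assoc] at h
    calc ev * Q ^ 5 ≤ ev * (2 * V * J) ^ 5 := by gcongr
      _ = J ^ 5 * (2 ^ 5 * (V ^ 5 * ev)) := by ring
      _ ≤ _ := by gcongr
  have b8 : |ev - ew| * Q ^ 5 ≤ J ^ 6 * (freq θ * 3 * (C₅ + 2 ^ 5 * C₅) * (y * s)) := by
    have h := abs_exp_neg_sub_exp_neg_le (freq θ * y * sqNorm v) (freq θ * y * sqNorm w)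
    rw [← mul_sub, abs_mul, abs_of_nonneg (by positivity : 0 ≤ freq θ * y)] at h
    have h2 := mul_le_mul_of_nonneg_left (abs_sqNorm_sub_sqNorm_le v w)
      (by positivity : 0 ≤ freq θ * y)
    have h3 : (ev + ew) * Q ^ 5 ≤ J ^ 5 * (C₅ + 2 ^ 5 * C₅) := by
      have : C₅ ≤ J ^ 5 * C₅ := le_mul_of_one_le_left hC₅0 (one_le_pow₀ hJ1)
      linarith
    calc |ev - ew| * Q ^ 5 ≤ freq θ * y * (3 * J * s) * (ev + ew) * Q ^ 5 := by
          gcongr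
          exact h.trans (mul_le_mul_of_nonneg_right h2 (by positivity))
      _ = freq θ * y * (3 * J * s) * ((ev + ew) * Q ^ 5) := by ring
      _ ≤ freq θ * y * (3 * J * s) * (J ^ 5 * (C₅ + 2 ^ 5 * C₅)) := by gcongr
      _ = _ := by ring
  have hC₂0 : 0 ≤ C₂ := (norm_nonneg _).trans b2'
  have hC₃0 : 0 ≤ C₃ := le_trans (by positivity) b3
  set X := x + y with hX
  have hX0 : 0 ≤ X := add_nonneg hx0 hy0
  set K := 1 + X * sqNorm w with hK
  have hK0 : 0 < K := one_add_mul_sqNorm_pos hX0 w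
  have hKPQ : K ≤ P * Q := one_add_add_mul_sqNorm_le hx0 hy0 w
  have t1 : ‖A - ex * α‖ * ‖B‖ * J ^ 4 * K ^ 5 ≤ C₁ * (x * s) * (2 ^ 5 * C₂) := by
    calc ‖A - ex * α‖ * ‖B‖ * J ^ 4 * K ^ 5 ≤ ‖A - ex * α‖ * ‖B‖ * J ^ 4 * (P * Q) ^ 5 := by gcongr
      _ = (‖A - ex * α‖ * J ^ 4 * P ^ 5) * (‖B‖ * Q ^ 5) := by ring
      _ ≤ _ := mul_le_mul b1 b2 (by positivity) (le_trans (by positivity) b1)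
  have hα4 : ‖α‖ * J ^ 4 ≤ C₃ := by
    refine le_trans ?_ b3
    exact mul_le_mul_of_nonneg_left (pow_le_pow_right₀ hJ1 (by norm_num)) (norm_nonneg _)
  have t2 : ex * ‖α‖ * ‖B - ev * β‖ * J ^ 4 * K ^ 5 ≤
      C₃ * C₅ * (2 ^ 5 * (C₄ * 2) * (y * s)) := by
    calc ex * ‖α‖ * ‖B - ev * β‖ * J ^ 4 * K ^ 5
        ≤ ex * ‖α‖ * ‖B - ev * β‖ * J ^ 4 * (P * Q) ^ 5 := by gcongr
      _ = (‖α‖ * J ^ 4) * (ex * P ^ 5) * (‖B - ev * β‖ * Q ^ 5) := by ring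
      _ ≤ _ := mul_le_mul (mul_le_mul hα4 b5 (by positivity) hC₃0) b4 (by positivity)
        (by positivity)
  have t3 : ‖α‖ * ‖β‖ * ex * |ev - ew| * J ^ 4 * K ^ 5 ≤
      C₃ * C₂ * C₅ * (freq θ * 3 * (C₅ + 2 ^ 5 * C₅) * (y * s)) := by
    calc ‖α‖ * ‖β‖ * ex * |ev - ew| * J ^ 4 * K ^ 5
        ≤ ‖α‖ * ‖β‖ * ex * |ev - ew| * J ^ 4 * (P * Q) ^ 5 := by gcongr
      _ = ‖α‖ * J ^ 4 * ‖β‖ * (ex * P ^ 5) * (|ev - ew| * Q ^ 5) := by ring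
      _ ≤ ‖α‖ * J ^ 4 * C₂ * C₅ * (J ^ 6 * (freq θ * 3 * (C₅ + 2 ^ 5 * C₅) * (y * s))) := by
          gcongr
      _ = ‖α‖ * J ^ 10 * (C₂ * C₅ * (freq θ * 3 * (C₅ + 2 ^ 5 * C₅) * (y * s))) := by ring
      _ ≤ C₃ * (C₂ * C₅ * (freq θ * 3 * (C₅ + 2 ^ 5 * C₅) * (y * s))) := by gcongr
      _ = _ := by ring
  -- the factors are replaced by their leading terms one after the other
  have hdec : ‖ladderAmplitude θ φ₁ φ₂ φ₃ φ₄ v w x y - ((ex * ew : ℝ) : ℂ) * (α * β)‖ ≤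
      ‖A - ex * α‖ * ‖B‖ + ex * ‖α‖ * ‖B - ev * β‖ + ‖α‖ * ‖β‖ * ex * |ev - ew| := by
    have e : ladderAmplitude θ φ₁ φ₂ φ₃ φ₄ v w x y - ((ex * ew : ℝ) : ℂ) * (α * β) =
        (A - ex * α) * B + ex * α * (B - ev * β) + α * β * ex * ((ev - ew : ℝ) : ℂ) := by
      rw [ladderAmplitude]
      push_cast
      ring
    rw [e]
    refine (norm_add₃_le).trans (le_of_eq ?_)
    simp only [norm_mul, Complex.norm_real, Real.norm_eq_abs, abs_of_pos hex0]
  -- one factor `K` is traded for the growth of `s` in `w`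
  have hsX : X * s ≤ 2 * √X * K := by
    have h1 : X * s = √X * √(X * bracket w) := by
      rw [Real.sqrt_mul hX0, ← mul_assoc, Real.mul_self_sqrt hX0]
    have h2 : √(X * bracket w) ≤ 2 * K := by
      rw [Real.sqrt_le_left (by positivity)]
      have h3 : X * bracket w ≤ 2 + X * sqNorm w := by
        unfold bracket; linarith
      have h4 := mul_nonneg hX0 (sqNorm_nonneg w)
      nlinarith
    rw [h1]
    have := mul_le_mul_of_nonneg_left h2 (Real.sqrt_nonneg X)
    linarith
  rw [hαβ, hexp]
  set N := ‖ladderAmplitude θ φ₁ φ₂ φ₃ φ₄ v w x y - ((ex * ew : ℝ) : ℂ) * (α * β)‖ with hN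
  set D₁ := C₁ * (2 ^ 5 * C₂) with hD₁
  set D₂ := C₃ * C₅ * (2 ^ 5 * (C₄ * 2)) with hD₂
  set D₃ := C₃ * C₂ * C₅ * (freq θ * 3 * (C₅ + 2 ^ 5 * C₅)) with hD₃
  have hD₁0 : 0 ≤ D₁ := by positivity
  have hD₂0 : 0 ≤ D₂ := by positivity
  have hD₃0 : 0 ≤ D₃ := by positivity
  have hfin : N * J ^ 4 * K ^ 5 ≤ (D₁ + D₂ + D₃) * (X * s) := by
    have h1 : N * J ^ 4 * K ^ 5 ≤ (‖A - ex * α‖ * ‖B‖ + ex * ‖α‖ * ‖B - ev * β‖ +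
        ‖α‖ * ‖β‖ * ex * |ev - ew|) * J ^ 4 * K ^ 5 := by gcongr
    have hxX : x * s ≤ X * s := by gcongr; linarith
    have hyX : y * s ≤ X * s := by gcongr; linarith
    have g1 := mul_le_mul_of_nonneg_left hxX hD₁0
    have g2 := mul_le_mul_of_nonneg_left hyX hD₂0
    have g3 := mul_le_mul_of_nonneg_left hyX hD₃0
    linarith
  have hlast : N * J ^ 4 * K ^ 4 * K ≤ (D₁ + D₂ + D₃) * 2 * √X * K := by
    have h1 := mul_le_mul_of_nonneg_left hsX (by positivity : 0 ≤ D₁ + D₂ + D₃)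
    calc N * J ^ 4 * K ^ 4 * K = N * J ^ 4 * K ^ 5 := by ring
      _ ≤ _ := hfin.trans (h1.trans (le_of_eq (by ring)))
  exact le_of_mul_le_mul_right hlast hK0

/-- The pairs of momenta of the ladder graph, parametrized by their sum and the second momentum. -/
def modeShear : Mode × Mode ≃ Mode × Mode where
  toFun p := (p.1 + p.2, p.2)
  invFun p := (p.1 - p.2, p.2)
  left_inv p := by simp
  right_inv p := by simp

/-- The ladder graph: its lattice sum converges absolutely. At short proper time the sum over the
exchanged momentum, at fixed sum of the two momenta, becomes a Gaussian sum over the lattice, whose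
leading behaviour carries the inverse covolume of the lattice and thus the factor `1/θ²`. -/
theorem ladder_asymptotics {θ : ℝ} (hθ : 0 < θ) (μ₀ lam : ℝ) {φ₁ φ₂ φ₃ φ₄ : C2 → ℂ}
    (h₁ : RapidDecay θ φ₁) (h₂ : φ₂ ∈ heisenbergModule θ) (h₃ : RapidDecay θ φ₃)
    (h₄ : φ₄ ∈ heisenbergModule θ) :
    (∀ ε : ℝ, 0 < ε → Summable (ladderTerm θ μ₀ lam ε φ₁ φ₂ φ₃ φ₄)) ∧
    ∃ b : ℂ, Tendsto (fun ε : ℝ => ladderGraph θ μ₀ lam ε φ₁ φ₂ φ₃ φ₄ -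
      ((-(lam ^ 2 / (8 * freq θ ^ 2)) * (1 / θ ^ 2) : ℝ) : ℂ) *
        quarticTrace θ φ₁ φ₂ φ₃ φ₄ * (Real.log (1 / ε) : ℂ)) (𝓝[>] 0) (𝓝 b) := by
  have hω := freq_pos hθ
  have hM : 0 < 2 * freq θ + μ₀ ^ 2 := by positivity
  have h₂' := (exists_rapidDecay_deriv hθ h₂).1
  have h₄' := (exists_rapidDecay_deriv hθ h₄).1
  set v : Mode → C2 := latticePoint θ with hv
  -- the propagator after time `s` is the dilation by `1 - R s`
  set R : ℝ → ℝ := fun s => 1 - Real.exp (-(2 * freq θ * s)) with hR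
  have hR0 : ∀ {s}, 0 < s → 0 < R s := fun {s} hs => one_sub_exp_neg_pos (by positivity)
  have hR1 : ∀ s, R s ≤ 1 := fun s => by
    have := Real.exp_pos (-(2 * freq θ * s))
    simp only [hR]
    linarith
  set m : Mode × Mode → ℝ × ℝ → ℂ := fun p z =>
    ladderAmplitude θ φ₁ φ₂ φ₃ φ₄ (v p.1) (v p.2) (R z.1) (R z.2) with hm
  set q : Mode → ℂ := fun γ => bargmannInner θ φ₁ (U θ γ φ₂) * bargmannInner θ φ₃ (U θ (-γ) φ₄)
    with hq
  set Q₀ := quarticTrace θ φ₁ φ₂ φ₃ φ₄ with hQ₀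
  have hJsum : Summable fun γ => (bracket (v γ) ^ 4)⁻¹ := summable_inv_bracket_latticePoint hθ
  have hQsum : HasSum q Q₀ := by
    have hs : Summable q := by
      obtain ⟨C₁, hC₁0, hC₁⟩ := exists_bargmannInner_U_bound h₁ h₂' 4
      obtain ⟨C₃, -, hC₃⟩ := exists_bargmannInner_U_bound h₃ h₄' 0
      refine Summable.of_norm_bounded (hJsum.mul_right (C₁ * C₃)) fun γ => ?_
      have hJ := pow_pos (bracket_pos (v γ)) 4
      have h3 := hC₃ (-γ)
      rw [pow_zero, mul_one] at h3
      rw [← div_eq_inv_mul, le_div_iff₀ hJ, hq, norm_mul, mul_right_comm]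
      exact mul_le_mul (hC₁ γ) h3 (norm_nonneg _) hC₁0
    have := hs.hasSum
    rwa [hQ₀, quarticTrace_eq]
  obtain ⟨C, hC⟩ := exists_ladderAmplitude_bound hθ h₁ h₂' h₃ h₄'
  obtain ⟨D, hD⟩ := exists_ladderAmplitude_sub_bound hθ h₁ h₂ h₃ h₄
  obtain ⟨L, hL⟩ := exists_tsum_inv_one_add_sqNorm_le hθ
  obtain ⟨G, hG⟩ := exists_hasSum_gaussian hθ
  have hsumJK : ∀ X : ℝ, 0 < X → X ≤ 2 → HasSum (fun p : Mode × Mode =>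
      (bracket (v (p.1 + p.2)) ^ 4)⁻¹ * ((1 + X * sqNorm (v p.2)) ^ 4)⁻¹)
      ((∑' γ, (bracket (v γ) ^ 4)⁻¹) * ∑' γ, ((1 + X * sqNorm (v γ)) ^ 4)⁻¹) := by
    intro X hX hX2
    exact modeShear.hasSum_iff.2 (hasSum_prod_mul hJsum.hasSum (hL X hX hX2).1.hasSum)
  have hterm : ∀ ε, 0 < ε → ∀ p, ladderTerm θ μ₀ lam ε φ₁ φ₂ φ₃ φ₄ p =
      (-(4 / (Nat.factorial 2 : ℂ)) * ((lam / 2 : ℝ) : ℂ) ^ 2) *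
        ∫ z in Set.Ioi ε ×ˢ Set.Ioi ε,
          ((Real.exp (-((2 * freq θ + μ₀ ^ 2) * (z.1 + z.2))) : ℝ) : ℂ) * m p z := by
    intro ε hε p
    unfold ladderTerm
    congr 1
    simp only [U, latticePoint_neg]
    rw [(bargmannInner_propagator hθ μ₀ h₁ h₂' hε _ _).2,
      (bargmannInner_propagator hθ μ₀ h₃ h₄' hε _ _).2, Measure.volume_eq_prod,
      ← setIntegral_prod_mul]
    congr 1
    ext z
    simp only [hm, ladderAmplitude, hR, hv]
    rw [mul_add, neg_add, Real.exp_add]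
    push_cast
    ring
  have hmeas : ∀ p, Measurable (m p) := fun p => by
    simp only [hm, ladderAmplitude, hR]
    exact ((measurable_dilationAmplitude θ h₁.continuous h₂'.continuous _ _).comp
      (by fun_prop)).mul ((measurable_dilationAmplitude θ h₃.continuous h₄'.continuous _ _).comp
      (by fun_prop))
  have hmle : ∀ p s t X, 0 < s → 0 < t → 0 < X → X ≤ R s + R t → ‖m p (s, t)‖ ≤
      C * ((bracket (v (p.1 + p.2)) ^ 4)⁻¹ * ((1 + X * sqNorm (v p.2)) ^ 4)⁻¹) := by
    intro p s t X hs ht hX hXle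
    have h := hC (v p.1) (v p.2) (R s) (R t) (hR0 hs).le (hR1 s) (hR0 ht).le (hR1 t)
    rw [hv, ← latticePoint_add, ← hv] at h
    have hJ := bracket_pos (v (p.1 + p.2))
    have hK := one_add_mul_sqNorm_pos hX.le (v p.2)
    rw [← mul_inv, ← div_eq_mul_inv, le_div_iff₀ (by positivity), ← mul_assoc]
    refine le_trans ?_ h
    have := mul_le_mul_of_nonneg_right hXle (sqNorm_nonneg (v p.2))
    gcongr
  have hmsum : ∀ ε : ℝ, 0 < ε → ∃ u : Mode × Mode → ℝ, Summable u ∧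
      ∀ p s t, ε < s → ε < t → ‖m p (s, t)‖ ≤ u p := by
    intro ε hε
    have hX := hR0 hε
    refine ⟨_, (hsumJK (R ε) hX (by linarith [hR1 ε])).summable.mul_left C,
      fun p s t hs ht => hmle p s t (R ε) (hε.trans hs) (hε.trans ht) hX ?_⟩
    have h1 : R ε ≤ R s := by
      simp only [hR]
      gcongr
    have h2 := hR0 (hε.trans ht)
    linarith
  set T := ∑' γ, (bracket (v γ) ^ 4)⁻¹ with hT
  have hT0 : 0 ≤ T := tsum_nonneg fun γ => by
    have := bracket_pos (v γ)
    positivity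
  have hC0 : 0 ≤ C := by
    refine le_trans ?_ (hC 0 0 0 0 le_rfl zero_le_one le_rfl zero_le_one)
    have := bracket_pos (0 + 0)
    have := one_add_mul_sqNorm_pos (add_zero (0 : ℝ)).ge (0 : C2)
    positivity
  have hD0 : 0 ≤ D := by
    refine nonneg_of_mul_nonneg_left (le_trans ?_
      (hD 0 0 1 1 zero_le_one le_rfl zero_le_one le_rfl)) (by positivity : 0 < √((1 : ℝ) + 1))
    have := bracket_pos (0 + 0)
    have := one_add_mul_sqNorm_pos (by norm_num : (0 : ℝ) ≤ 1 + 1) (0 : C2)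
    positivity
  have hL0 : 0 ≤ L := by
    have h := (hL 1 one_pos one_le_two).2
    rw [one_pow, inv_one, mul_one] at h
    refine le_trans (tsum_nonneg fun γ => ?_) h
    have := one_add_mul_sqNorm_pos zero_le_one (latticePoint θ γ)
    positivity
  have hG0 : 0 ≤ G := by
    obtain ⟨S, -, hS⟩ := hG 1 one_pos one_le_two
    simp only [Real.sqrt_one, mul_one, inv_one] at hS
    exact (abs_nonneg _).trans hS
  set E := D * T * L + ‖Q₀‖ * G with hE
  have hE0 : 0 ≤ E := by positivity
  set c₁ := (2 * freq θ * √(2 * freq θ))⁻¹ with hc₁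
  have hc₁0 : 0 < c₁ := by positivity
  have hlead : ∀ s t : ℝ, 0 < s → 0 < t →
      ‖∑' p, m p (s, t) - (Q₀ * (((4 * freq θ ^ 2 * θ ^ 2)⁻¹ : ℝ) : ℂ)) *
        (((s + t) ^ 2)⁻¹ : ℝ)‖ ≤
        (E * (4 * (1 + c₁)) + ‖Q₀‖ * ((θ ^ 2)⁻¹ * (1 + 2 * (2 * freq θ)⁻¹))) *
          (singularWeight s * singularWeight t) := by
    intro s t hs ht
    set W := singularWeight s * singularWeight t with hW
    have hW1 : 1 ≤ W := one_le_singularWeight_mul hs ht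
    have hWi : (s + t)⁻¹ ≤ W := inv_add_le_singularWeight hs ht
    have hWs : 1 + ((s + t) * √(s + t))⁻¹ ≤ W := one_add_inv_mul_sqrt_le hs ht
    have hst : 0 < s + t := by positivity
    set X := R s + R t with hX
    have hX0 : 0 < X := add_pos (hR0 hs) (hR0 ht)
    have hX2 : X ≤ 2 := by linarith [hR1 s, hR1 t]
    set u := 2 * freq θ * (s + t) with hu
    have hu0 : 0 < u := by positivity
    have hXu : X ≤ u := by
      have a1 := one_sub_exp_neg_le (2 * freq θ * s)
      have a2 := one_sub_exp_neg_le (2 * freq θ * t)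
      simp only [hX, hR, hu]
      linarith
    -- `1 - e^{-u} = 1 - (1 - x)(1 - y) ≤ x + y` for `x = R s` and `y = R t`
    have huX : 1 - Real.exp (-u) ≤ X := by
      have h1 : Real.exp (-u) = (1 - R s) * (1 - R t) := by
        simp only [hR, hu, sub_sub_cancel]
        rw [← Real.exp_add]
        ring_nf
      rw [h1, hX]
      have := mul_pos (hR0 hs) (hR0 ht)
      linarith
    have hXW : (X * √X)⁻¹ ≤ 4 * (1 + c₁) * W := by
      have h1 := inv_mul_sqrt_le hu0 huX
      have h2 : (u * √u)⁻¹ = c₁ * ((s + t) * √(s + t))⁻¹ := by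
        rw [hu, Real.sqrt_mul (by positivity), hc₁, ← mul_inv]
        ring_nf
      rw [h2] at h1
      have h3 : ((s + t) * √(s + t))⁻¹ ≤ W := by linarith
      have h4 := mul_le_mul_of_nonneg_left h3 hc₁0.le
      linarith
    obtain ⟨S, hS, hSle⟩ := hG X hX0 hX2
    -- the sum of the leading terms factorizes in the sum of the momenta and the second momentum
    have hlsum : HasSum (fun p : Mode × Mode =>
        ((Real.exp (-(freq θ * X * sqNorm (v p.2))) : ℝ) : ℂ) * q (p.1 + p.2)) (S * Q₀) := by
      have h1 : HasSum (fun γ => ((Real.exp (-(freq θ * X * sqNorm (v γ))) : ℝ) : ℂ)) (S : ℂ) := by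
        exact_mod_cast hS
      have h2 := modeShear.hasSum_iff.2 (hasSum_prod_mul hQsum h1)
      rw [show (fun p : Mode × Mode => ((Real.exp (-(freq θ * X * sqNorm (v p.2))) : ℝ) : ℂ) *
        q (p.1 + p.2)) = fun p => q (p.1 + p.2) *
          ((Real.exp (-(freq θ * X * sqNorm (v p.2))) : ℝ) : ℂ) from
        funext fun p => mul_comm _ _, mul_comm (S : ℂ)]
      exact h2
    have hdiff : ∀ p : Mode × Mode, ‖m p (s, t) -
        ((Real.exp (-(freq θ * X * sqNorm (v p.2))) : ℝ) : ℂ) * q (p.1 + p.2)‖ ≤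
        D * √X * ((bracket (v (p.1 + p.2)) ^ 4)⁻¹ * ((1 + X * sqNorm (v p.2)) ^ 4)⁻¹) := by
      intro p
      have h := hD (v p.1) (v p.2) (R s) (R t) (hR0 hs).le (hR1 s) (hR0 ht).le (hR1 t)
      rw [hv, ← latticePoint_add, ← latticePoint_neg, ← hv] at h
      have hJ := bracket_pos (v (p.1 + p.2))
      have hK := one_add_mul_sqNorm_pos hX0.le (v p.2)
      rw [← mul_inv, ← div_eq_mul_inv, le_div_iff₀ (by positivity), ← mul_assoc]
      exact h
    have hsum := hsumJK X hX0 hX2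
    have hrem : Summable fun p : Mode × Mode => m p (s, t) -
        ((Real.exp (-(freq θ * X * sqNorm (v p.2))) : ℝ) : ℂ) * q (p.1 + p.2) :=
      Summable.of_norm_bounded (hsum.summable.mul_left _) hdiff
    have hms : ∑' p, m p (s, t) = (∑' p : Mode × Mode, (m p (s, t) -
        ((Real.exp (-(freq θ * X * sqNorm (v p.2))) : ℝ) : ℂ) * q (p.1 + p.2))) + S * Q₀ := by
      have := hrem.hasSum.add hlsum
      simp only [sub_add_cancel] at this
      exact this.tsum_eq
    have hinv : √X * (X ^ 2)⁻¹ = (X * √X)⁻¹ := by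
      have : 0 < √X := Real.sqrt_pos.2 hX0
      rw [mul_inv, ← div_eq_mul_inv, div_eq_iff (by positivity)]
      field_simp
      rw [Real.sq_sqrt hX0.le]
    -- the remainder: `√X` from each term, `X⁻²` from the sum over the second momentum
    have hbd : ‖∑' p : Mode × Mode, (m p (s, t) -
        ((Real.exp (-(freq θ * X * sqNorm (v p.2))) : ℝ) : ℂ) * q (p.1 + p.2))‖ ≤
        D * T * L * (X * √X)⁻¹ := by
      refine (tsum_of_norm_bounded (hsum.mul_left (D * √X)) hdiff).trans ?_
      have h1 := (hL X hX0 hX2).2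
      calc D * √X * (T * ∑' γ, ((1 + X * sqNorm (v γ)) ^ 4)⁻¹)
          ≤ D * √X * (T * (L * (X ^ 2)⁻¹)) := by gcongr
        _ = D * T * L * (√X * (X ^ 2)⁻¹) := by ring
        _ = _ := by rw [hinv]
    have hes := abs_inv_sq_sub_inv_sq_le hu0 huX hXu
    have huW : u⁻¹ ≤ (2 * freq θ)⁻¹ * W := by
      rw [hu, mul_inv]
      exact mul_le_mul_of_nonneg_left hWi (by positivity)
    have hSu : |S - ((θ * u) ^ 2)⁻¹| ≤
        G * (X * √X)⁻¹ + (θ ^ 2)⁻¹ * ((1 + 2 * (2 * freq θ)⁻¹) * W) := by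
      have e : S - ((θ * u) ^ 2)⁻¹ =
          (S - ((θ * X) ^ 2)⁻¹) + (θ ^ 2)⁻¹ * ((X ^ 2)⁻¹ - (u ^ 2)⁻¹) := by
        simp only [mul_pow, mul_inv]
        ring
      rw [e]
      refine (abs_add_le _ _).trans (add_le_add hSle ?_)
      rw [abs_mul, abs_of_pos (by positivity : 0 < (θ ^ 2)⁻¹)]
      refine mul_le_mul_of_nonneg_left (hes.trans ?_) (by positivity)
      linarith
    have hQe : Q₀ * (((4 * freq θ ^ 2 * θ ^ 2)⁻¹ : ℝ) : ℂ) * (((s + t) ^ 2)⁻¹ : ℝ) =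
        ((((θ * u) ^ 2)⁻¹ : ℝ) : ℂ) * Q₀ := by
      rw [mul_assoc, ← Complex.ofReal_mul, ← mul_inv, hu, mul_comm,
        show 4 * freq θ ^ 2 * θ ^ 2 * (s + t) ^ 2 = (θ * (2 * freq θ * (s + t))) ^ 2 by ring]
    rw [hms, hQe, add_sub_assoc, ← sub_mul, ← Complex.ofReal_sub]
    refine (norm_add_le _ _).trans ?_
    rw [norm_mul, Complex.norm_real, Real.norm_eq_abs]
    have h1 := mul_le_mul_of_nonneg_right hSu (norm_nonneg Q₀)
    have h2 := mul_le_mul_of_nonneg_left hXW hE0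
    rw [hE] at h2 ⊢
    linarith
  obtain ⟨hs, c, hc⟩ := tendsto_tsum_integral_sub_log hM hmeas hmsum hlead
  set κ : ℂ := -(4 / (Nat.factorial 2 : ℂ)) * ((lam / 2 : ℝ) : ℂ) ^ 2 with hκ
  refine ⟨fun ε hε => ?_, κ * c, ?_⟩
  · rw [show ladderTerm θ μ₀ lam ε φ₁ φ₂ φ₃ φ₄ = _ from funext (hterm ε hε)]
    exact (hs ε hε).mul_left κ
  · refine (hc.const_mul κ).congr' ?_
    filter_upwards [self_mem_nhdsWithin] with ε hε
    rw [ladderGraph, tsum_congr (hterm ε hε), tsum_mul_left, mul_sub]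
    congr 1
    have hω' : (freq θ : ℂ) ≠ 0 := by exact_mod_cast hω.ne'
    have hθ' : (θ : ℂ) ≠ 0 := by exact_mod_cast hθ.ne'
    rw [hκ]
    push_cast [Nat.factorial]
    field_simp
    ring

end HeisenbergQFT

theorem mainTheorem5 (θ : ℝ) (hθ : 0 < θ) (μ₀ lam : ℝ) (φ₁ φ₂ φ₃ φ₄ : HeisenbergQFT.C2 → ℂ)
    (h₁ : φ₁ ∈ HeisenbergQFT.heisenbergModule θ) (h₂ : φ₂ ∈ HeisenbergQFT.heisenbergModule θ)
    (h₃ : φ₃ ∈ HeisenbergQFT.heisenbergModule θ) (h₄ : φ₄ ∈ HeisenbergQFT.heisenbergModule θ) :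
    -- for a positive cut-off, all traces and lattice sums converge absolutely
    (∀ ε : ℝ, 0 < ε →
      (∀ γ₁ γ₂ : HeisenbergQFT.Mode, Summable fun n : Fin 2 → ℕ =>
        HeisenbergQFT.bargmannInner θ (HeisenbergQFT.monomialBasis θ n)
          (HeisenbergQFT.bubbleLoop θ μ₀ ε γ₁ γ₂ (HeisenbergQFT.monomialBasis θ n))) ∧
      Summable (HeisenbergQFT.bubbleTerm θ μ₀ lam ε φ₁ φ₂ φ₃ φ₄) ∧
      Summable (HeisenbergQFT.ladderTerm θ μ₀ lam ε φ₁ φ₂ φ₃ φ₄)) ∧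
    -- the planar function minus its divergent part has a finite limit
    (∃ c : ℂ, Tendsto
      (fun ε : ℝ => HeisenbergQFT.planarFourPoint θ μ₀ lam ε φ₁ φ₂ φ₃ φ₄ -
        ((-(lam ^ 2 / (8 * HeisenbergQFT.freq θ ^ 2)) * (1 + 1 / θ ^ 2) : ℝ) : ℂ) *
          HeisenbergQFT.quarticTrace θ φ₁ φ₂ φ₃ φ₄ * (Real.log (1 / ε) : ℂ))
      (𝓝[>] 0) (𝓝 c)) ∧
    -- the same for each of the two planar graphs
    (∃ a : ℂ, Tendsto
      (fun ε : ℝ => HeisenbergQFT.bubbleGraph θ μ₀ lam ε φ₁ φ₂ φ₃ φ₄ -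
        ((-(lam ^ 2 / (8 * HeisenbergQFT.freq θ ^ 2)) : ℝ) : ℂ) *
          HeisenbergQFT.quarticTrace θ φ₁ φ₂ φ₃ φ₄ * (Real.log (1 / ε) : ℂ))
      (𝓝[>] 0) (𝓝 a)) ∧
    (∃ b : ℂ, Tendsto
      (fun ε : ℝ => HeisenbergQFT.ladderGraph θ μ₀ lam ε φ₁ φ₂ φ₃ φ₄ -
        ((-(lam ^ 2 / (8 * HeisenbergQFT.freq θ ^ 2)) * (1 / θ ^ 2) : ℝ) : ℂ) *
          HeisenbergQFT.quarticTrace θ φ₁ φ₂ φ₃ φ₄ * (Real.log (1 / ε) : ℂ))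
      (𝓝[>] 0) (𝓝 b)) ∧
    -- the divergence is removed by a shift of the coupling constant of the interaction
    (∃ d : ℂ, Tendsto
      (fun ε : ℝ =>
        HeisenbergQFT.interaction θ
            (lam + lam ^ 2 / (4 * HeisenbergQFT.freq θ ^ 2) * (1 + 1 / θ ^ 2) * Real.log (1 / ε))
            φ₁ φ₂ φ₃ φ₄ +
          HeisenbergQFT.planarFourPoint θ μ₀ lam ε φ₁ φ₂ φ₃ φ₄)
      (𝓝[>] 0) (𝓝 d)) := by
  have r₁ := (HeisenbergQFT.exists_rapidDecay_deriv hθ h₁).1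
  have r₂ := (HeisenbergQFT.exists_rapidDecay_deriv hθ h₂).1
  have r₃ := (HeisenbergQFT.exists_rapidDecay_deriv hθ h₃).1
  have r₄ := (HeisenbergQFT.exists_rapidDecay_deriv hθ h₄).1
  obtain ⟨sa, a, ha⟩ := HeisenbergQFT.bubble_asymptotics hθ μ₀ lam r₁ r₂ r₃ r₄
  obtain ⟨sb, b, hb⟩ := HeisenbergQFT.ladder_asymptotics hθ μ₀ lam r₁ h₂ r₃ h₄
  have hc : Tendsto
      (fun ε : ℝ => HeisenbergQFT.planarFourPoint θ μ₀ lam ε φ₁ φ₂ φ₃ φ₄ -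
        ((-(lam ^ 2 / (8 * HeisenbergQFT.freq θ ^ 2)) * (1 + 1 / θ ^ 2) : ℝ) : ℂ) *
          HeisenbergQFT.quarticTrace θ φ₁ φ₂ φ₃ φ₄ * (Real.log (1 / ε) : ℂ))
      (𝓝[>] 0) (𝓝 (a + b)) := by
    refine (ha.add hb).congr fun ε => ?_
    rw [HeisenbergQFT.planarFourPoint]
    push_cast
    ring
  refine ⟨fun ε hε => ⟨fun γ₁ γ₂ => (HeisenbergQFT.hasSum_bubbleLoop hθ μ₀ hε γ₁ γ₂).summable,
    sa ε hε, sb ε hε⟩, ⟨_, hc⟩, ⟨a, ha⟩, ⟨b, hb⟩, _,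
    (hc.const_add (HeisenbergQFT.interaction θ lam φ₁ φ₂ φ₃ φ₄)).congr fun ε => ?_⟩
  rw [HeisenbergQFT.interaction, HeisenbergQFT.interaction]
  push_cast
  ring
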